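/- Let $n\ge 2$, let $G_{n,k}$ be the Grassmann manifold of $k$-dimensional linear subspaces $\zeta$ of $\mathbb R^n$ with the rotation-invariant measure $d\zeta$ of total mass $1$, and let $\mathcal G_{n,k}$ be the manifold of $k$-planes $\tau=(\zeta,x'')=x''+\zeta$ ($\zeta\in G_{n,k}$, $x''\in\zeta^\perp$) with the measure $d\tau=d\zeta\,dx''$. The $k$-plane transform of $f$ is $\hat f(\tau)=\int_\zeta f(x'+x'')\,dx'$. For a function $w$ on $[0,\infty)$ and $a>0$ put $$(W_a^*\varphi)(x)=\frac1{a^n}\int_{\mathcal G_{n,k}}\varphi(\tau)\,w\Big(\frac{|x-\tau|}{a}\Big)\,d\tau ,$$ where $|x-\tau|$ is the Euclidean distance from $x$ to $\tau$. Let $\sigma_{m-1}=2\pi^{m/2}/\Gamma(m/2)$. **Theorem B.** For an integer $\ell\ge 0$ let $\psi(r)=0$ for $0\le r\le 1$ and $\psi(r)=(r^2-1)^\ell/r^{n+2\ell+1}$ for $r>1$. Then $\psi(|\cdot|)$ has a decreasing radial majorant in $L^1(\mathbb R^n)$. Moreover, for $1\le k<n$ with $k=2\ell$ or $k=2\ell+1$,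 the equation $$c\,r^{2-n}\int_0^r s^{n-k-1}w(s)(r^2-s^2)^{k/2-1}\,ds=\psi(r)\quad(r>0),\qquad c=\frac{\sigma_{k-1}\sigma_{n-k-1}}{\sigma_{n-1}},$$ has the following solution $w$ (the integral being absolutely convergent). (i) If $k=2\ell$, $\ell\ge1$: $w(r)=0$ for $0\le r\le1$, and for $r>1$ $$w(r)=c_\ell\,r^{2+2\ell-n}\Big(\frac1{2r}\frac d{dr}\Big)^{\ell}\Big[\frac{(r^2-1)^\ell}{r^{2\ell+3}}\Big],\qquad c_\ell=\frac{\Gamma(n/2-\ell)}{\Gamma(n/2)}.$$ (ii) If $k=2\ell+1$, $\ell\ge0$: $w(r)=0$ for $0\le r\le1$, and for $r>1$ $$w(r)=\tilde c_\ell\,r^{3+2\ell-n}\Big(\frac1{2r}\frac d{dr}\Big)^{\ell+1}\Big[\frac{(r^2-1)^{\ell+1/2}}{r^{2\ell+2}}\Big],\qquad \tilde c_\ell=\frac{\Gamma((n-1)/2-\ell)\,\ell!}{\Gamma(n/2)\,\Gamma(\ell+3/2)}.$$ In both cases, with $\lambda=\int_{\mathbb R^n}\psi(|x|)\,dx>0$,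 the following holds for all $1\le p<n/k$ and all real or complex $f\in L^p(\mathbb R^n)$: $\hat f(\tau)$ exists as an absolutely convergent integral for almost every $\tau$; for every $a>0$ and every $x\in\mathbb R^n$ $$(W_a^*\hat f)(x)=\int_{\mathbb R^n}f(x-ay)\,\psi(|y|)\,dy,$$ both integrals being absolutely convergent; $W_a^*\hat f\in L^p$ for every $a>0$; and $$\lim_{a\to0^+}(W_a^*\hat f)(x)=\lambda f(x)$$ in the $L^p$-norm and for almost every $x$. If moreover $f$ is continuous and vanishes at infinity, the limit is uniform on $\mathbb R^n$. -/

import Mathlib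

open MeasureTheory Filter Topology

namespace KPlane

/-! ### Grassmannians, planes and their measures -/

/-- Euclidean space `ℝⁿ`. -/
abbrev E (n : ℕ) : Type := EuclideanSpace ℝ (Fin n)

/-- The Grassmann manifold `G_{n,k}` of `k`-dimensional linear subspaces `ζ` of `ℝⁿ`. -/
def Grassmannian (n k : ℕ) : Type :=
  {ζ : Submodule ℝ (E n) // Module.finrank ℝ ζ = k}

/-- The usual topology of `G_{n,k}`: a subspace is identified with the orthogonal projection
onto it. -/
noncomputable instance (n k : ℕ) : TopologicalSpace (Grassmannian n k) :=
  TopologicalSpace.induced (fun ζ => ζ.1.starProjection) inferInstance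

noncomputable instance (n k : ℕ) : MeasurableSpace (Grassmannian n k) := borel _

instance (n k : ℕ) : BorelSpace (Grassmannian n k) := ⟨rfl⟩

/-- The orthogonal group `O(n)`. -/
abbrev OrthGroup (n : ℕ) : Type := unitary (E n →L[ℝ] E n)

noncomputable instance (n : ℕ) : MeasurableSpace (OrthGroup n) := borel _

instance (n : ℕ) : BorelSpace (OrthGroup n) := ⟨rfl⟩

instance (n : ℕ) : ContinuousStar (E n →L[ℝ] E n) :=
  ⟨(ContinuousLinearMap.adjoint (𝕜 := ℝ) (E := E n) (F := E n)).continuous⟩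

instance (n : ℕ) : CompactSpace (OrthGroup n) := by
  have : ProperSpace (E n →L[ℝ] E n) := FiniteDimensional.proper ℝ _
  refine isCompact_iff_compactSpace.mp (Metric.isCompact_of_isClosed_isBounded ?_ ?_)
  · have h : ((unitary (E n →L[ℝ] E n) : Submonoid _) : Set (E n →L[ℝ] E n)) =
        {u | star u * u = 1} ∩ {u | u * star u = 1} := by
      ext u
      simp [Unitary.mem_iff]
    rw [h]
    exact (isClosed_eq (continuous_star.mul continuous_id) continuous_const).inter
      (isClosed_eq (continuous_id.mul continuous_star) continuous_const)
  · refine (Metric.isBounded_closedBall (x := (0 : E n →L[ℝ] E n)) (r := 1)).subset ?_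
    intro u hu
    rw [mem_closedBall_zero_iff]
    refine ContinuousLinearMap.opNorm_le_bound _ zero_le_one fun x => ?_
    rw [one_mul]
    exact (Unitary.norm_map (⟨u, hu⟩ : OrthGroup n) x).le

/-- Normalized Haar measure on `O(n)`. -/
noncomputable def orthHaar (n : ℕ) : Measure (OrthGroup n) :=
  Measure.haarMeasure (⊤ : TopologicalSpace.PositiveCompacts (OrthGroup n))

/-- The image `u ζ` of a subspace `ζ` under `u ∈ O(n)`. -/
noncomputable def rotate {n k : ℕ} (u : OrthGroup n) (ζ : Grassmannian n k) : Grassmannian n k :=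
  ⟨ζ.1.map (Unitary.linearIsometryEquiv u).toLinearEquiv.toLinearMap,
    (LinearEquiv.finrank_map_eq _ _).trans ζ.2⟩

theorem rotate_proj {n k : ℕ} (u : OrthGroup n) (ζ : Grassmannian n k) :
    (rotate u ζ).1.starProjection =
      (u : E n →L[ℝ] E n) * ζ.1.starProjection * star (u : E n →L[ℝ] E n) := by
  ext1 x
  exact Submodule.starProjection_map_apply (Unitary.linearIsometryEquiv u) ζ.1 x

theorem continuous_rotate {n k : ℕ} (ζ : Grassmannian n k) :
    Continuous fun u : OrthGroup n => rotate u ζ := by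
  refine continuous_induced_rng.2 ?_
  have : ((fun ζ : Grassmannian n k => ζ.1.starProjection) ∘ fun u : OrthGroup n => rotate u ζ) =
      fun u : OrthGroup n =>
        (u : E n →L[ℝ] E n) * ζ.1.starProjection * star (u : E n →L[ℝ] E n) := by
    funext u
    exact rotate_proj u ζ
  rw [this]
  exact (continuous_subtype_val.mul continuous_const).mul continuous_subtype_val.star

theorem measurable_rotate {n k : ℕ} (u : OrthGroup n) :
    Measurable fun ζ : Grassmannian n k => rotate u ζ := by
  refine Continuous.measurable (continuous_induced_rng.2 ?_)
  have : ((fun ζ : Grassmannian n k => ζ.1.starProjection) ∘ fun ζ => rotate u ζ) =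
      fun ζ : Grassmannian n k =>
        (u : E n →L[ℝ] E n) * ζ.1.starProjection * star (u : E n →L[ℝ] E n) := by
    funext ζ
    exact rotate_proj u ζ
  rw [this]
  exact (continuous_const.mul continuous_induced_dom).mul continuous_const

theorem rotate_surj {n k : ℕ} (ζ : Grassmannian n k) :
    Function.Surjective fun u : OrthGroup n => rotate u ζ := by
  intro η
  have hfr : Module.finrank ℝ ζ.1 = Module.finrank ℝ η.1 := ζ.2.trans η.2.symm
  let e : ζ.1 ≃ₗᵢ[ℝ] η.1 :=
    (stdOrthonormalBasis ℝ ζ.1).equiv (stdOrthonormalBasis ℝ η.1) (finCongr hfr)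
  let L : ζ.1 →ₗᵢ[ℝ] E n := η.1.subtypeₗᵢ.comp e.toLinearIsometry
  let g : E n ≃ₗᵢ[ℝ] E n := L.extend.toLinearIsometryEquiv rfl
  refine ⟨Unitary.linearIsometryEquiv.symm g, Subtype.ext ?_⟩
  refine Submodule.eq_of_le_of_finrank_eq ?_ ?_
  · rintro _ ⟨x, hx, rfl⟩
    have : g x = L ⟨x, hx⟩ := L.extend_apply ⟨x, hx⟩
    simp only [MulEquiv.apply_symm_apply]
    change g x ∈ η.1
    rw [this]
    exact (e ⟨x, hx⟩).2
  · exact (rotate _ ζ).2.trans η.2.symm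

theorem rotate_mul {n k : ℕ} (u v : OrthGroup n) (ζ : Grassmannian n k) :
    rotate (u * v) ζ = rotate u (rotate v ζ) := by
  refine Subtype.ext ?_
  ext x
  constructor
  · rintro ⟨y, hy, rfl⟩
    exact ⟨_, ⟨y, hy, rfl⟩, rfl⟩
  · rintro ⟨_, ⟨y, hy, rfl⟩, rfl⟩
    exact ⟨y, hy, rfl⟩

instance (n k : ℕ) : T2Space (Grassmannian n k) := by
  refine T2Space.of_injective_continuous
    (f := fun ζ : Grassmannian n k => ζ.1.starProjection) ?_ continuous_induced_dom
  intro a b h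
  exact Subtype.ext (Submodule.starProjection_inj.1 h)

instance (n k : ℕ) : SecondCountableTopology (Grassmannian n k) :=
  (Topology.IsInducing.mk rfl : Topology.IsInducing
    fun ζ : Grassmannian n k => ζ.1.starProjection).secondCountableTopology

/-- The coordinate subspace spanned by the first `k` vectors of the standard basis. -/
noncomputable def coordSubspace {n k : ℕ} (hk : k ≤ n) : Grassmannian n k :=
  ⟨Submodule.span ℝ (Set.range fun i : Fin k =>
      (EuclideanSpace.single (Fin.castLE hk i) (1 : ℝ) : E n)), by
    have h : LinearIndependent ℝ fun i : Fin k =>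
        (EuclideanSpace.single (Fin.castLE hk i) (1 : ℝ) : E n) := by
      have := (EuclideanSpace.basisFun (Fin n) ℝ).toBasis.linearIndependent.comp
        (Fin.castLE hk) (Fin.castLE_injective hk)
      have e : (⇑(EuclideanSpace.basisFun (Fin n) ℝ).toBasis ∘ Fin.castLE hk) =
          fun i : Fin k => (EuclideanSpace.single (Fin.castLE hk i) (1 : ℝ) : E n) := by
        funext i
        simp
      rwa [e] at this
    rw [finrank_span_eq_card h, Fintype.card_fin]⟩

/-- The rotation invariant measure `dζ` on `G_{n,k}` of total mass one: the law of the random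
subspace `u ζ₀`, where `u` is Haar distributed on the orthogonal group. -/
noncomputable def grassMeasure {n k : ℕ} (hk : k ≤ n) : Measure (Grassmannian n k) :=
  (orthHaar n).map fun u => rotate u (coordSubspace hk)

instance {n k : ℕ} (hk : k ≤ n) : IsProbabilityMeasure (grassMeasure hk) := by
  have h : orthHaar n Set.univ = 1 := Measure.haarMeasure_self
    (K₀ := (⊤ : TopologicalSpace.PositiveCompacts (OrthGroup n)))
  have : IsProbabilityMeasure (orthHaar n) := ⟨h⟩
  exact Measure.isProbabilityMeasure_map (continuous_rotate _).measurable.aemeasurable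

/-- `dζ` is invariant under rotations. -/
theorem grassMeasure_map_rotate {n k : ℕ} (hk : k ≤ n) (u : OrthGroup n) :
    (grassMeasure hk).map (fun ζ => rotate u ζ) = grassMeasure hk := by
  have : (orthHaar n).IsMulLeftInvariant := by
    unfold orthHaar
    infer_instance
  unfold grassMeasure
  rw [Measure.map_map (measurable_rotate u) (continuous_rotate _).measurable]
  have h : ((fun ζ : Grassmannian n k => rotate u ζ) ∘ fun u => rotate u (coordSubspace hk)) =
      (fun u => rotate u (coordSubspace hk)) ∘ (fun v => u * v) := by
    funext v
    exact (rotate_mul _ _ _).symm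
  rw [h, ← Measure.map_map (continuous_rotate _).measurable (by fun_prop)]
  congr 1
  exact map_mul_left_eq_self (orthHaar n) u

/-- The affine Grassmann manifold of all `k`-planes `τ` in `ℝⁿ`, parametrized by the pairs
`(ζ, x'')` with `ζ ∈ G_{n,k}` and `x'' ∈ ζᗮ`. -/
def AffineGrassmannian (n k : ℕ) : Type :=
  {τ : Grassmannian n k × E n // τ.2 ∈ τ.1.1ᗮ}

noncomputable instance (n k : ℕ) : MeasurableSpace (AffineGrassmannian n k) :=
  inferInstanceAs (MeasurableSpace {τ : Grassmannian n k × E n // τ.2 ∈ τ.1.1ᗮ})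

/-- The direction `ζ` of the plane `τ = (ζ, x'')`. -/
noncomputable def AffineGrassmannian.dir {n k : ℕ} (τ : AffineGrassmannian n k) :
    Submodule ℝ (E n) := τ.1.1.1

/-- The foot `x''` of the plane `τ = (ζ, x'')`. -/
noncomputable def AffineGrassmannian.foot {n k : ℕ} (τ : AffineGrassmannian n k) : E n := τ.1.2

/-- The plane `τ = x'' + ζ` itself. -/
noncomputable def AffineGrassmannian.plane {n k : ℕ} (τ : AffineGrassmannian n k) :
    AffineSubspace ℝ (E n) :=
  AffineSubspace.mk' τ.foot τ.dir

/-- The volume element `dx''` of `ζᗮ`, carried by the planes `(ζ, x'')` with direction `ζ`. -/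
noncomputable def fiberMeasure {n k : ℕ} (ζ : Grassmannian n k) :
    Measure (AffineGrassmannian n k) :=
  (volume : Measure ζ.1ᗮ).map fun x : ζ.1ᗮ => ⟨(ζ, (x : E n)), x.2⟩

/-- The image of `dx''` on the planes with direction `ζ` depends measurably on `ζ`, so that
`affineMeasure` below is the iterated measure `dζ dx''`. -/
theorem measurable_fiberMeasure {n k : ℕ} (hk : k ≤ n) :
    Measurable fun ζ : Grassmannian n k => fiberMeasure ζ := by
  set ζ₀ := coordSubspace hk
  have hq := (continuous_rotate ζ₀).measurable
  refine (hq.measurable_comp_iff_of_surjective (rotate_surj ζ₀)).1 ?_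
  have hmem : ∀ (p : OrthGroup n × ζ₀.1ᗮ),
      (p.1 : E n →L[ℝ] E n) p.2 ∈ (rotate p.1 ζ₀).1ᗮ := by
    rintro ⟨u, v⟩
    rintro _ ⟨y, hy, rfl⟩
    exact (Unitary.inner_map_map u y v).trans (v.2 y hy)
  let F : OrthGroup n × ζ₀.1ᗮ → AffineGrassmannian n k := fun p =>
    ⟨(rotate p.1 ζ₀, (p.1 : E n →L[ℝ] E n) p.2), hmem p⟩
  have hF : Measurable F := by
    refine Measurable.subtype_mk ?_
    refine Measurable.prodMk (hq.comp measurable_fst) ?_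
    have : Continuous fun p : OrthGroup n × ζ₀.1ᗮ => (p.1 : E n →L[ℝ] E n) p.2 := by fun_prop
    exact this.measurable
  have key : (fun ζ : Grassmannian n k => fiberMeasure ζ) ∘ (fun u => rotate u ζ₀) =
      fun u => ((volume : Measure ζ₀.1ᗮ).map (Prod.mk u)).map F := by
    funext u
    let L : ζ₀.1ᗮ →ₗᵢ[ℝ] (rotate u ζ₀).1ᗮ :=
      { toFun := fun v => ⟨(u : E n →L[ℝ] E n) v, hmem (u, v)⟩
        map_add' := fun x y => Subtype.ext (by simp)
        map_smul' := fun c x => Subtype.ext (by simp)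
        norm_map' := fun x => Unitary.norm_map u x }
    have hfr : Module.finrank ℝ ζ₀.1ᗮ = Module.finrank ℝ (rotate u ζ₀).1ᗮ := by
      have h1 := ζ₀.1.finrank_add_finrank_orthogonal
      have h2 := (rotate u ζ₀).1.finrank_add_finrank_orthogonal
      have h3 := ζ₀.2
      have h4 := (rotate u ζ₀).2
      omega
    have hmp := (L.toLinearIsometryEquiv hfr).measurePreserving
    rw [Measure.map_map hF (by fun_prop)]
    change Measure.map (fun x : (rotate u ζ₀).1ᗮ =>
      (⟨(rotate u ζ₀, (x : E n)), x.2⟩ : AffineGrassmannian n k)) volume = _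
    rw [← hmp.map_eq, Measure.map_map ?_ hmp.measurable]
    · rfl
    · refine Measurable.subtype_mk ?_
      exact Measurable.prodMk measurable_const measurable_subtype_coe
  rw [key]
  refine (Measure.measurable_map _ hF).comp ?_
  exact Measurable.map_prodMk_left

/-- The measure `dτ = dζ dx''` on the affine Grassmann manifold, where `dx''` is the volume
on `ζᗮ`. -/
noncomputable def affineMeasure {n k : ℕ} (hk : k ≤ n) : Measure (AffineGrassmannian n k) :=
  (grassMeasure hk).bind fun ζ => fiberMeasure ζ

/-! ### The `k`-plane transform and the wavelet-like transform -/

section Transforms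

variable {𝕜 : Type*} [RCLike 𝕜]

/-- The `k`-plane transform `f̂(τ) = ∫_ζ f(x' + x'') dx'`. -/
noncomputable def radon {n k : ℕ} (f : E n → 𝕜) (τ : AffineGrassmannian n k) : 𝕜 :=
  ∫ x : τ.dir, f ((x : E n) + τ.foot)

/-- The integrand `φ(τ) w(|x - τ| / a)` of the wavelet-like transform. -/
noncomputable def waveletIntegrand {n k : ℕ} (w : ℝ → ℝ) (φ : AffineGrassmannian n k → 𝕜)
    (a : ℝ) (x : E n) (τ : AffineGrassmannian n k) : 𝕜 :=
  w (Metric.infDist x (τ.plane : Set (E n)) / a) • φ τ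

/-- The wavelet-like transform `(W*_a φ)(x) = a⁻ⁿ ∫ φ(τ) w(|x - τ| / a) dτ`. -/
noncomputable def wavelet {n k : ℕ} (hk : k ≤ n) (w : ℝ → ℝ) (φ : AffineGrassmannian n k → 𝕜)
    (a : ℝ) (x : E n) : 𝕜 :=
  (1 / a ^ n : ℝ) • ∫ τ, waveletIntegrand w φ a x τ ∂(affineMeasure hk)

end Transforms

/-- `λ = ∫ ψ(|x|) dx`. -/
noncomputable def totalMass (n : ℕ) (ψ : ℝ → ℝ) : ℝ := ∫ x : E n, ψ ‖x‖

/-- The inversion of the `k`-plane transform of `f ∈ Lᵖ(ℝⁿ)` (with values in `𝕜`) by means of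
the pair `(w, ψ)`, for all `1 ≤ p < n / k`.  The integrals involved are asserted to converge
absolutely. -/
def InversionHolds (𝕜 : Type*) [RCLike 𝕜] {n k : ℕ} (hk : k ≤ n) (w ψ : ℝ → ℝ) : Prop :=
  0 < totalMass n ψ ∧
  ∀ p : ℝ, 1 ≤ p → p < (n : ℝ) / k →
  ∀ f : E n → 𝕜, MemLp f (ENNReal.ofReal p) volume →
    (∀ᵐ τ ∂(affineMeasure hk), Integrable fun x : τ.dir => f ((x : E n) + τ.foot)) ∧
    (∀ a : ℝ, 0 < a → ∀ x : E n,
      Integrable (waveletIntegrand w (radon f) a x) (affineMeasure hk) ∧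
      Integrable (fun y : E n => ψ ‖y‖ • f (x - a • y)) ∧
      wavelet hk w (radon f) a x = ∫ y : E n, ψ ‖y‖ • f (x - a • y)) ∧
    (∀ a : ℝ, 0 < a → MemLp (wavelet hk w (radon f) a) (ENNReal.ofReal p) volume) ∧
    Tendsto (fun a : ℝ => eLpNorm (fun x => wavelet hk w (radon f) a x - totalMass n ψ • f x)
      (ENNReal.ofReal p) volume) (𝓝[>] 0) (𝓝 0) ∧
    (∀ᵐ x : E n, Tendsto (fun a : ℝ => wavelet hk w (radon f) a x) (𝓝[>] 0)
      (𝓝 (totalMass n ψ • f x))) ∧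
    (Continuous f → Tendsto f (cocompact (E n)) (𝓝 0) →
      TendstoUniformly (fun (a : ℝ) (x : E n) => wavelet hk w (radon f) a x)
        (fun x => totalMass n ψ • f x) (𝓝[>] 0))

/-! ### The Abel type integral equation and the radial majorant -/

/-- The area `σ_{m-1} = 2 π^{m/2} / Γ(m/2)` of the unit sphere `S^{m-1}` in `ℝᵐ`. -/
noncomputable def sphereArea (m : ℕ) : ℝ :=
  2 * Real.pi ^ ((m : ℝ) / 2) / Real.Gamma ((m : ℝ) / 2)

/-- The constant `c = σ_{k-1} σ_{n-k-1} / σ_{n-1}`. -/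
noncomputable def abelConst (n k : ℕ) : ℝ :=
  sphereArea k * sphereArea (n - k) / sphereArea n

/-- The integrand `s^{n-k-1} w(s) (r² - s²)^{k/2-1}`, for `1 ≤ k < n`. -/
noncomputable def abelIntegrand (n k : ℕ) (w : ℝ → ℝ) (r s : ℝ) : ℝ :=
  s ^ (n - k - 1) * w s * (r ^ 2 - s ^ 2) ^ ((k : ℝ) / 2 - 1)

/-- For `1 ≤ k < n`, the function `w` on `[0, ∞)` solves
`c r^{2-n} ∫₀ʳ s^{n-k-1} w(s) (r² - s²)^{k/2-1} ds = ψ(r)` for every `r > 0`, the integral being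
absolutely convergent. -/
def SolvesAbel (n k : ℕ) (w ψ : ℝ → ℝ) : Prop :=
  ∀ r : ℝ, 0 < r →
    IntervalIntegrable (abelIntegrand n k w r) volume 0 r ∧
    abelConst n k * r ^ (2 - (n : ℤ)) * ∫ s in (0 : ℝ)..r, abelIntegrand n k w r s = ψ r

/-- The radial function `ψ(|·|)` on `ℝⁿ` has an integrable decreasing radial majorant. -/
def HasDecreasingMajorant (n : ℕ) (ψ : ℝ → ℝ) : Prop :=
  ∃ Ψ : ℝ → ℝ, AntitoneOn Ψ (Set.Ici 0) ∧ (∀ r, 0 ≤ r → |ψ r| ≤ Ψ r) ∧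
    Integrable fun x : E n => Ψ ‖x‖

/-! ### The explicit functions -/

/-- `ψ(r) = 0` for `0 ≤ r ≤ 1` and `ψ(r) = (r² - 1)^ℓ / r^{n+2ℓ+1}` for `r > 1`. -/
noncomputable def psi (n ℓ : ℕ) (r : ℝ) : ℝ :=
  if r ≤ 1 then 0 else (r ^ 2 - 1) ^ ℓ / r ^ (n + 2 * ℓ + 1)

/-- The differential operator `(1 / 2r) d/dr`. -/
noncomputable def radialDeriv (g : ℝ → ℝ) (r : ℝ) : ℝ := 1 / (2 * r) * deriv g r

/-- `c_ℓ = Γ(n/2 - ℓ) / Γ(n/2)`. -/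
noncomputable def constEven (n ℓ : ℕ) : ℝ :=
  Real.Gamma ((n : ℝ) / 2 - ℓ) / Real.Gamma ((n : ℝ) / 2)

/-- The function `w` for `k = 2ℓ`. -/
noncomputable def wEven (n ℓ : ℕ) (r : ℝ) : ℝ :=
  if r ≤ 1 then 0 else
    constEven n ℓ * r ^ (2 + 2 * (ℓ : ℤ) - n) *
      (radialDeriv^[ℓ] fun t => (t ^ 2 - 1) ^ ℓ / t ^ (2 * ℓ + 3)) r

/-- `c̃_ℓ = Γ((n-1)/2 - ℓ) ℓ! / (Γ(n/2) Γ(ℓ + 3/2))`. -/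
noncomputable def constOdd (n ℓ : ℕ) : ℝ :=
  Real.Gamma (((n : ℝ) - 1) / 2 - ℓ) * (ℓ.factorial : ℝ) /
    (Real.Gamma ((n : ℝ) / 2) * Real.Gamma ((ℓ : ℝ) + 3 / 2))

/-- The function `w` for `k = 2ℓ + 1`. -/
noncomputable def wOdd (n ℓ : ℕ) (r : ℝ) : ℝ :=
  if r ≤ 1 then 0 else
    constOdd n ℓ * r ^ (3 + 2 * (ℓ : ℤ) - n) *
      (radialDeriv^[ℓ + 1] fun t => (t ^ 2 - 1) ^ ((ℓ : ℝ) + 1 / 2) / t ^ (2 * ℓ + 2)) r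

end KPlane

/-! Fix a subspace `ζ`. The planes are the images of pairs `(u, v)`, with `u` in the orthogonal
group and `v ∈ ζᗮ`, and the points of such a plane are `u (x' + v)` with `x' ∈ ζ`. The map `(u, v,
x') ↦ (u, u (x' + v))` carries the product measure to Haar measure times Lebesgue measure
(`measurePreserving_planePoint`), and every point `y` of a plane `τ` satisfies `|x - τ| = dist(u⁻¹
(x - y), ζ)`. Fubini's theorem therefore turns `W*_a f̂ (x)` into `a⁻ⁿ ∫ f(y) M((x - y) / a) dy`,
where `M(y)` is the mean over `u` of `w(dist(u⁻¹ y, ζ))`.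

This mean is radial. Testing it against radial functions and splitting `ℝⁿ = ζ ⊕ ζᗮ` in polar
coordinates identifies it with the left side of the Abel equation at `r = |y|`
(`lintegral_norm_mul_perpNorm`, `ae_lintegral_orbitPerp`). If `w` solves the equation then `M(y) =
ψ(|y|)` almost everywhere, and `W*_a f̂` is the convolution of `f` with a dilate of `ψ(|·|)`
(`wavelet_radon`).

The Abel equation is solved in the variable `u = s²`: apart from a power of `s`, `w` is an iterated
derivative of `(u - 1)^α u^(-β)`. Integration by parts lowers the order of the derivative to one.
What remains is the fundamental theorem of calculus for even `k` and a Beta integral for odd `k`.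

Absolute convergence follows from domination of both functions `w` by one weight, whose spherical
mean is at most a multiple of `r^(k-n)` on `r > 1` (`exists_abelMean_abelWeight_le`). This tail lies
in the dual exponent class of `Lᵖ` exactly when `p < n / k`.

Finally, `ψ(|·|)` is nonnegative, integrable and bounded by a multiple of `(1 + |y|)^(-n-1)`, so its
dilates form an approximate identity in `Lᵖ`, almost everywhere, and uniformly for continuous
functions vanishing at infinity. -/

namespace KPlane

/-! ### Solution of the Abel equation in the variable `u = s²`. -/

open Polynomial in
/-- The polynomials `p_j` for which
`(d/du)^j [(u - 1)^α u^(-β)] = (u - 1)^(α - j) u^(-β) p_j(1/u)`. -/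
noncomputable def abelPoly (α β : ℝ) : ℕ → ℝ[X]
  | 0 => 1
  | j + 1 => C (α - j) * abelPoly α β j -
      (1 - X) * (C β * abelPoly α β j + X * derivative (abelPoly α β j))

/-- The `j`-th derivative of `(u - 1)^α u^(-β)` on `(1, ∞)`. -/
noncomputable def abelDeriv (α β : ℝ) (j : ℕ) (u : ℝ) : ℝ :=
  (u - 1) ^ (α - j) * (u ^ (-β) * (abelPoly α β j).eval u⁻¹)

theorem abelDeriv_zero (α β u : ℝ) : abelDeriv α β 0 u = (u - 1) ^ α * u ^ (-β) := by
  simp [abelDeriv, abelPoly]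

/-- With `X = 1/u`, the derivative of `u^(-β) p(X)` is `-u^(-β) X (β p + X p')`, and pulling out `(u
- 1)^(α - j - 1)` leaves the factor `(u - 1) X = 1 - X`. This is the recursion of `abelPoly`. -/
theorem hasDerivAt_abelDeriv (α β : ℝ) (j : ℕ) {u : ℝ} (hu : 1 < u) :
    HasDerivAt (abelDeriv α β j) (abelDeriv α β (j + 1) u) u := by
  have hu0 : 0 < u := by linarith
  have hu1 : 0 < u - 1 := by linarith
  have h1 : HasDerivAt (fun u : ℝ => (u - 1) ^ (α - j)) (1 * (α - j) * (u - 1) ^ (α - j - 1)) u :=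
    ((hasDerivAt_id u).sub_const 1).rpow_const (Or.inl hu1.ne')
  have h2 : HasDerivAt (fun u : ℝ => u ^ (-β)) (1 * (-β) * u ^ (-β - 1)) u :=
    (hasDerivAt_id u).rpow_const (Or.inl hu0.ne')
  have h3 : HasDerivAt (fun u : ℝ => (abelPoly α β j).eval u⁻¹)
      ((Polynomial.derivative (abelPoly α β j)).eval u⁻¹ * (-(u ^ 2)⁻¹)) u :=
    ((abelPoly α β j).hasDerivAt u⁻¹).comp u (hasDerivAt_inv hu0.ne')
  refine (h1.mul (h2.mul h3)).congr_deriv ?_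
  have e1 : (u - 1) ^ (α - j) = (u - 1) ^ (α - j - 1) * (u - 1) := by
    rw [← Real.rpow_add_one hu1.ne']; congr 1; ring
  have e2 : u ^ (-β - 1) = u ^ (-β) * u⁻¹ := by
    rw [Real.rpow_sub_one hu0.ne', div_eq_mul_inv]
  have e3 : α - (j + 1 : ℕ) = α - j - 1 := by push_cast; ring
  simp only [abelDeriv, abelPoly, Polynomial.eval_sub, Polynomial.eval_mul, Polynomial.eval_add,
    Polynomial.eval_C, Polynomial.eval_X, Polynomial.eval_one, e3, e1, e2, Pi.mul_apply]
  field_simp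
  ring

theorem continuousOn_abelDeriv {α β : ℝ} {j : ℕ} (h : 0 ≤ α - j) :
    ContinuousOn (abelDeriv α β j) (Set.Ici 1) := by
  have h1 : ∀ u ∈ Set.Ici (1 : ℝ), u ≠ 0 := fun u hu => by
    have := Set.mem_Ici.1 hu
    linarith
  refine ContinuousOn.mul ?_ (ContinuousOn.mul ?_ ?_)
  · exact ContinuousOn.rpow_const (by fun_prop) fun u _ => Or.inr h
  · exact ContinuousOn.rpow_const (by fun_prop) fun u hu => Or.inl (h1 u hu)
  · exact (Polynomial.continuous _).comp_continuousOn (continuousOn_inv₀.mono h1)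

theorem measurable_abelDeriv (α β : ℝ) (j : ℕ) : Measurable (abelDeriv α β j) := by
  unfold abelDeriv
  have := (Polynomial.continuous (abelPoly α β j)).measurable
  fun_prop

/-- In the variable `u = r²` the operator `(1/2r) d/dr` becomes `d/du`. Agreement on the open set
`(1, ∞)` suffices, since the derivative is local. -/
theorem radialDeriv_iterate {α β : ℝ} {g : ℝ → ℝ}
    (hg : ∀ r, 1 < r → g r = abelDeriv α β 0 (r ^ 2)) (j : ℕ) {r : ℝ} (hr : 1 < r) :
    (radialDeriv^[j] g) r = abelDeriv α β j (r ^ 2) := by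
  induction j generalizing r with
  | zero => exact hg r hr
  | succ j ih =>
    rw [Function.iterate_succ_apply', radialDeriv]
    have h1 : (radialDeriv^[j] g) =ᶠ[𝓝 r] fun t => abelDeriv α β j (t ^ 2) := by
      filter_upwards [lt_mem_nhds hr] with t ht using ih ht
    have h2 : HasDerivAt (fun t : ℝ => abelDeriv α β j (t ^ 2))
        (abelDeriv α β (j + 1) (r ^ 2) * (2 * r)) r := by
      have h3 : HasDerivAt (fun t : ℝ => t ^ 2) (2 * r) r := by simpa using hasDerivAt_pow 2 r
      exact HasDerivAt.comp r (h₂ := abelDeriv α β j) (h := fun t : ℝ => t ^ 2)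
        (hasDerivAt_abelDeriv α β j (by nlinarith : 1 < r ^ 2)) h3
    rw [h1.deriv_eq, h2.deriv]
    field_simp

/-- The polynomial factor is evaluated at `1/u`, which stays in the compact interval `[0, 1]`. -/
theorem exists_abelDeriv_bound (α β : ℝ) (j : ℕ) :
    ∃ C, 0 ≤ C ∧ ∀ u, 1 < u → |abelDeriv α β j u| ≤ C * ((u - 1) ^ (α - j) * u ^ (-β)) := by
  obtain ⟨C, hC⟩ := (isCompact_Icc (a := (0 : ℝ)) (b := 1)).exists_bound_of_continuousOn
    (Polynomial.continuous (abelPoly α β j)).continuousOn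
  refine ⟨C, (norm_nonneg _).trans (hC 0 (by simp)), fun u hu => ?_⟩
  have hz : u⁻¹ ∈ Set.Icc (0 : ℝ) 1 :=
    ⟨by positivity, inv_le_one_of_one_le₀ hu.le⟩
  have h1 := hC _ hz
  rw [Real.norm_eq_abs] at h1
  have h2 : 0 ≤ (u - 1) ^ (α - j) := Real.rpow_nonneg (by linarith) _
  have h3 : 0 ≤ u ^ (-β) := Real.rpow_nonneg (by linarith) _
  rw [abelDeriv, abs_mul, abs_mul, abs_of_nonneg h2, abs_of_nonneg h3]
  nlinarith [mul_nonneg h2 h3, mul_le_mul_of_nonneg_left h1 (mul_nonneg h2 h3)]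

/-- Cutting at the midpoint leaves one endpoint singularity on each half, the other factor being
continuous there. -/
theorem intervalIntegrable_beta {a b R : ℝ} (ha : -1 < a) (hb : -1 < b) (hR : 1 < R) :
    IntervalIntegrable (fun u => (u - 1) ^ a * (R - u) ^ b) volume 1 R := by
  set m := (1 + R) / 2
  have hm1 : 1 < m := by simp only [m]; linarith
  have hm2 : m < R := by simp only [m]; linarith
  have h1 : IntervalIntegrable (fun u : ℝ => (u - 1) ^ a) volume 1 m := by
    have := (intervalIntegral.intervalIntegrable_rpow' ha (a := 0) (b := m - 1)).comp_sub_right 1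
    simpa using this
  have h2 : IntervalIntegrable (fun u : ℝ => (R - u) ^ b) volume m R := by
    have := (intervalIntegral.intervalIntegrable_rpow' hb (a := R - m) (b := 0)).comp_sub_left R
    simpa using this
  refine IntervalIntegrable.trans (b := m) ?_ ?_
  · refine h1.mul_continuousOn ?_
    rw [Set.uIcc_of_le hm1.le]
    refine ContinuousOn.rpow_const (by fun_prop) fun u hu => Or.inl ?_
    have := hu.2
    linarith
  · refine h2.continuousOn_mul ?_
    rw [Set.uIcc_of_le hm2.le]
    refine ContinuousOn.rpow_const (by fun_prop) fun u hu => Or.inl ?_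
    have := hu.1
    linarith

theorem intervalIntegrable_abelDeriv {α β b R : ℝ} {j : ℕ} (ha : -1 < α - j) (hb : -1 < b)
    (hR : 1 < R) :
    IntervalIntegrable (fun u => abelDeriv α β j u * (R - u) ^ b) volume 1 R := by
  have h := (intervalIntegrable_beta ha hb hR).mul_continuousOn
    (g := fun u => u ^ (-β) * (abelPoly α β j).eval u⁻¹) ?_
  · refine h.congr fun u _ => ?_
    simp only [abelDeriv]
    ring
  · have h1 : ∀ u ∈ Set.uIcc (1 : ℝ) R, u ≠ 0 := fun u hu => by
      rw [Set.uIcc_of_le hR.le] at hu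
      have := hu.1
      linarith
    refine ContinuousOn.mul ?_ ?_
    · exact ContinuousOn.rpow_const (by fun_prop) fun u hu => Or.inl (h1 u hu)
    · exact (Polynomial.continuous _).comp_continuousOn (continuousOn_inv₀.mono h1)

theorem abelDeriv_one {α β : ℝ} {j : ℕ} (h : 0 < α - j) : abelDeriv α β j 1 = 0 := by
  simp [abelDeriv, Real.zero_rpow h.ne']

/-- Integration by parts. The boundary term at `1` vanishes because `α > j`, the one at `R` because
`γ > 0`. -/
theorem integral_abelDeriv_succ {α β γ R : ℝ} {j : ℕ} (ha : 0 < α - j) (hγ : 0 < γ) (hR : 1 < R) :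
    ∫ u in (1 : ℝ)..R, abelDeriv α β (j + 1) u * (R - u) ^ γ =
      γ * ∫ u in (1 : ℝ)..R, abelDeriv α β j u * (R - u) ^ (γ - 1) := by
  have i1 : IntervalIntegrable (fun u => abelDeriv α β (j + 1) u * (R - u) ^ γ) volume 1 R :=
    intervalIntegrable_abelDeriv (by push_cast; linarith) (by linarith) hR
  have i2 : IntervalIntegrable (fun u => γ * (abelDeriv α β j u * (R - u) ^ (γ - 1))) volume 1 R :=
    (intervalIntegrable_abelDeriv (by linarith) (by linarith) hR).const_mul γ
  have h := intervalIntegral.integral_eq_sub_of_hasDerivAt_of_le hR.le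
    (f := fun u => abelDeriv α β j u * (R - u) ^ γ)
    (f' := fun u => abelDeriv α β (j + 1) u * (R - u) ^ γ -
      γ * (abelDeriv α β j u * (R - u) ^ (γ - 1))) ?_ ?_ (i1.sub i2)
  · rw [intervalIntegral.integral_sub i1 i2, intervalIntegral.integral_const_mul] at h
    simp only [sub_self, Real.zero_rpow hγ.ne', abelDeriv_one ha] at h
    linarith
  · refine ((continuousOn_abelDeriv ha.le).mono Set.Icc_subset_Ici_self).mul ?_
    exact ContinuousOn.rpow_const (by fun_prop) fun u _ => Or.inr hγ.le
  · intro u hu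
    have h2 : HasDerivAt (fun u : ℝ => (R - u) ^ γ) (-1 * γ * (R - u) ^ (γ - 1)) u :=
      ((hasDerivAt_id u).const_sub R).rpow_const (Or.inl (sub_pos.2 hu.2).ne')
    refine ((hasDerivAt_abelDeriv α β j hu.1).mul h2).congr_deriv ?_
    ring

/-- The factors `γ + 1, …, γ + i` from `i` integrations by parts multiply to the quotient of Gamma
values. The descent stops at the first derivative because `γ` itself may be `-1/2`, where the
boundary term at `R` would blow up. -/
theorem integral_abelDeriv_add {α β γ R : ℝ} (hγ : -1 < γ) (hR : 1 < R) (i : ℕ) (ha : i < α) :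
    ∫ u in (1 : ℝ)..R, abelDeriv α β (1 + i) u * (R - u) ^ (γ + i) =
      Real.Gamma (γ + i + 1) / Real.Gamma (γ + 1) *
        ∫ u in (1 : ℝ)..R, abelDeriv α β 1 u * (R - u) ^ γ := by
  induction i with
  | zero => simp [div_self (Real.Gamma_pos_of_pos (by linarith : 0 < γ + 1)).ne']
  | succ i ih =>
    have h0 : (0 : ℝ) ≤ i := i.cast_nonneg
    push_cast at ha
    have h1 : γ + ((i + 1 : ℕ) : ℝ) - 1 = γ + i := by push_cast; ring
    have h2 : γ + ((i + 1 : ℕ) : ℝ) + 1 = (γ + i + 1) + 1 := by push_cast; ring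
    rw [← add_assoc, integral_abelDeriv_succ (by push_cast; linarith) (by push_cast; linarith) hR,
      h1, ih (by linarith), h2, Real.Gamma_add_one (by linarith : γ + i + 1 ≠ 0)]
    push_cast
    ring

theorem integral_abelDeriv_one {α β R : ℝ} (ha : 0 < α) (hR : 1 < R) :
    ∫ u in (1 : ℝ)..R, abelDeriv α β 1 u * (R - u) ^ (0 : ℝ) = (R - 1) ^ α * R ^ (-β) := by
  have i1 : IntervalIntegrable (fun u => abelDeriv α β 1 u * (R - u) ^ (0 : ℝ)) volume 1 R :=
    intervalIntegrable_abelDeriv (by push_cast; linarith) (by linarith) hR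
  simp only [Real.rpow_zero, mul_one] at i1 ⊢
  rw [intervalIntegral.integral_eq_sub_of_hasDerivAt_of_le hR.le
    (continuousOn_abelDeriv (j := 0) (by simpa using ha.le) |>.mono Set.Icc_subset_Ici_self)
    (fun u hu => hasDerivAt_abelDeriv α β 0 hu.1) i1, abelDeriv_one (j := 0) (by simpa using ha),
    abelDeriv_zero, sub_zero]

theorem setIntegral_beta {a b : ℝ} (ha : 0 < a) (hb : 0 < b) :
    ∫ x in Set.Ioo (0 : ℝ) 1, x ^ (a - 1) * (1 - x) ^ (b - 1) = ProbabilityTheory.beta a b := by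
  rw [ProbabilityTheory.beta_eq_betaIntegralReal a b ha hb,
    Complex.betaIntegral, intervalIntegral.integral_of_le (by norm_num),
    ← integral_Ioc_eq_integral_Ioo, ← RCLike.re_to_complex, ← integral_re]
  · refine setIntegral_congr_fun measurableSet_Ioc fun x hx => ?_
    have h1 := hx.1
    have h2 := hx.2
    norm_cast
    rw [← Complex.ofReal_cpow, ← Complex.ofReal_cpow, RCLike.re_to_complex,
      Complex.re_mul_ofReal, Complex.ofReal_re]
    all_goals linarith
  · convert! Complex.betaIntegral_convergent (u := a) (v := b) (by simpa) (by simpa)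
    rw [intervalIntegrable_iff_integrableOn_Ioc_of_le (by simp), IntegrableOn]

/-- The Beta integral after the Möbius substitution `u ↦ R (u - 1) / ((R - 1) u)`. -/
theorem integral_beta_moebius {a b R : ℝ} (ha : 0 < a) (hb : 0 < b) (hR : 1 < R) :
    ∫ u in (1 : ℝ)..R, (u - 1) ^ (a - 1) * (R - u) ^ (b - 1) * u ^ (-(a + b)) =
      ProbabilityTheory.beta a b * ((R - 1) ^ (a + b - 1) * R ^ (-a)) := by
  set K : ℝ := R / (R - 1) with hK
  have hR0 : 0 < R := by linarith
  have hR1 : 0 < R - 1 := by linarith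
  have hKpos : 0 < K := div_pos hR0 hR1
  -- `K` is chosen so that `1 ↦ 0` and `R ↦ 1`. Then `1 - t u = (R - u) / ((R - 1) u)`, and the
  -- powers of `u` collect to `-(a + b)`.
  set t : ℝ → ℝ := fun u => K * (1 - u⁻¹) with ht
  have himg : t '' Set.Ioo 1 R = Set.Ioo 0 1 := by
    ext y
    constructor
    · rintro ⟨u, hu, rfl⟩
      have hu0 : 0 < u := by linarith [hu.1]
      have h1 : u⁻¹ < 1 := inv_lt_one_of_one_lt₀ hu.1
      have h2 : R⁻¹ < u⁻¹ := (inv_lt_inv₀ hR0 hu0).2 hu.2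
      refine ⟨mul_pos hKpos (by linarith), ?_⟩
      have h3 : K * (1 - R⁻¹) = 1 := by rw [hK]; field_simp
      calc t u < K * (1 - R⁻¹) := mul_lt_mul_of_pos_left (by linarith) hKpos
        _ = 1 := h3
    · intro hy
      have h1 : 0 < R - y * (R - 1) := by nlinarith [hy.2]
      refine ⟨R / (R - y * (R - 1)), ⟨?_, ?_⟩, ?_⟩
      · rw [lt_div_iff₀ h1]; nlinarith [hy.1]
      · rw [div_lt_iff₀ h1]
        have : 1 < R - y * (R - 1) := by nlinarith [hy.2]
        nlinarith
      · simp only [ht, hK]; field_simp; ring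
  have hinj : Set.InjOn t (Set.Ioo 1 R) := by
    intro u _ v _ h
    have h1 := mul_left_cancel₀ hKpos.ne' h
    exact inv_injective (by linarith)
  have hder : ∀ u ∈ Set.Ioo 1 R, HasDerivWithinAt t (K * (u ^ 2)⁻¹) (Set.Ioo 1 R) u := by
    intro u hu
    have hu0 : u ≠ 0 := by linarith [hu.1]
    have h := ((hasDerivAt_inv hu0).const_sub 1).const_mul K
    simpa using h.hasDerivWithinAt
  have key := integral_image_eq_integral_abs_deriv_smul measurableSet_Ioo hder hinj
    (fun x => x ^ (a - 1) * (1 - x) ^ (b - 1))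
  rw [himg, setIntegral_beta ha hb] at key
  rw [intervalIntegral.integral_of_le hR.le, integral_Ioc_eq_integral_Ioo, key,
    mul_comm, ← integral_const_mul]
  refine setIntegral_congr_fun measurableSet_Ioo fun u hu => ?_
  have hu0 : 0 < u := by linarith [hu.1]
  have hu1 : 0 < u - 1 := by linarith [hu.1]
  have hu2 : 0 < R - u := by linarith [hu.2]
  have e1 : t u = R * ((u - 1) * (u⁻¹ * (R - 1)⁻¹)) := by simp only [ht, hK]; field_simp
  have e2 : 1 - t u = (R - u) * (u⁻¹ * (R - 1)⁻¹) := by simp only [ht, hK]; field_simp; ring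
  have hi := inv_pos.2 hu0
  have hj := inv_pos.2 hR1
  simp only [smul_eq_mul]
  rw [abs_of_pos (by positivity), e2, e1, Real.mul_rpow hR0.le (by positivity),
    Real.mul_rpow hu1.le (by positivity), Real.mul_rpow hi.le hj.le,
    Real.mul_rpow hu2.le (by positivity), Real.mul_rpow hi.le hj.le,
    Real.inv_rpow hu0.le, Real.inv_rpow hu0.le, Real.inv_rpow hR1.le, Real.inv_rpow hR1.le, hK,
    Real.rpow_neg hu0.le, Real.rpow_neg hR0.le, Real.rpow_sub_one hR0.ne' a,
    Real.rpow_sub_one hR1.ne' (a + b), Real.rpow_sub_one hR1.ne' a, Real.rpow_sub_one hR1.ne' b,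
    Real.rpow_sub_one hu0.ne' a, Real.rpow_sub_one hu0.ne' b,
    Real.rpow_add hu0, Real.rpow_add hR1]
  have p1 := (Real.rpow_pos_of_pos hu0 a).ne'
  have p2 := (Real.rpow_pos_of_pos hu0 b).ne'
  have p3 := (Real.rpow_pos_of_pos hR1 a).ne'
  have p4 := (Real.rpow_pos_of_pos hR1 b).ne'
  have p5 := (Real.rpow_pos_of_pos hR0 a).ne'
  field_simp

/-- The choice `β = α + 1/2` makes both terms of the derivative fit the Möbius Beta integral, with
`a = α` and `a = α + 1`. Since `(α + 1/2) B(α + 1, 1/2) = α B(α, 1/2)`, the two values have a common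
coefficient and combine through `R - (R - 1) = 1`. -/
theorem integral_half_order {α R : ℝ} (hα : 0 < α) (hR : 1 < R) :
    ∫ u in (1 : ℝ)..R, abelDeriv α (α + 1 / 2) 1 u * (R - u) ^ (-(1 / 2) : ℝ) =
      α * ProbabilityTheory.beta α (1 / 2) * ((R - 1) ^ (α - 1 / 2) * R ^ (-(α + 1))) := by
  have hR0 : 0 < R := by linarith
  have hR1 : 0 < R - 1 := by linarith
  have h1 := integral_beta_moebius hα (one_half_pos (α := ℝ)) hR
  have h2 := integral_beta_moebius (a := α + 1) (by linarith) (one_half_pos (α := ℝ)) hR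
  have hint : ∀ {a : ℝ}, 0 < a → IntervalIntegrable (fun u : ℝ =>
      (u - 1) ^ (a - 1) * (R - u) ^ ((1 / 2 : ℝ) - 1) * u ^ (-(a + 1 / 2))) volume 1 R := by
    intro a ha
    refine (intervalIntegrable_beta (by linarith) (by norm_num) hR).mul_continuousOn ?_
    refine ContinuousOn.rpow_const (by fun_prop) fun u hu => Or.inl ?_
    rw [Set.uIcc_of_le hR.le] at hu
    linarith [hu.1]
  have e : ∀ u ∈ Set.Ioo (1 : ℝ) R, abelDeriv α (α + 1 / 2) 1 u * (R - u) ^ (-(1 / 2) : ℝ) =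
      α * ((u - 1) ^ (α - 1) * (R - u) ^ ((1 / 2 : ℝ) - 1) * u ^ (-(α + 1 / 2))) -
      (α + 1 / 2) * ((u - 1) ^ (α + 1 - 1) * (R - u) ^ ((1 / 2 : ℝ) - 1) *
        u ^ (-(α + 1 + 1 / 2))) := by
    intro u hu
    have hu0 : 0 < u := by linarith [hu.1]
    have hu1 : 0 < u - 1 := by linarith [hu.1]
    have e1 : (1 / 2 : ℝ) - 1 = -(1 / 2) := by norm_num
    have e2 : (u - 1) ^ (α + 1 - 1) = (u - 1) ^ (α - 1) * (u - 1) := by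
      rw [← Real.rpow_add_one hu1.ne']; congr 1; ring
    have e3 : u ^ (-(α + 1 + 1 / 2)) = u ^ (-(α + 1 / 2)) * u⁻¹ := by
      rw [← Real.rpow_neg_one u, ← Real.rpow_add hu0]; congr 1; ring
    rw [e1, e2, e3]
    simp only [abelDeriv, abelPoly, Nat.cast_one, Nat.cast_zero, Polynomial.eval_sub,
      Polynomial.eval_mul, Polynomial.eval_C, Polynomial.eval_one, Polynomial.eval_X,
      Polynomial.eval_add, Polynomial.derivative_one, Polynomial.eval_zero]
    field_simp
    ring
  have e' : ∫ u in (1 : ℝ)..R, abelDeriv α (α + 1 / 2) 1 u * (R - u) ^ (-(1 / 2) : ℝ) =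
      ∫ u in (1 : ℝ)..R,
      (α * ((u - 1) ^ (α - 1) * (R - u) ^ ((1 / 2 : ℝ) - 1) * u ^ (-(α + 1 / 2))) -
      (α + 1 / 2) * ((u - 1) ^ (α + 1 - 1) * (R - u) ^ ((1 / 2 : ℝ) - 1) *
        u ^ (-(α + 1 + 1 / 2)))) := by
    rw [intervalIntegral.integral_of_le hR.le, intervalIntegral.integral_of_le hR.le,
      integral_Ioc_eq_integral_Ioo, integral_Ioc_eq_integral_Ioo]
    exact setIntegral_congr_fun measurableSet_Ioo e
  rw [e', intervalIntegral.integral_sub ((hint hα).const_mul _)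
    ((hint (by linarith : 0 < α + 1)).const_mul _), intervalIntegral.integral_const_mul,
    intervalIntegral.integral_const_mul, h1, h2]
  have hB : (α + 1 / 2) * ProbabilityTheory.beta (α + 1) (1 / 2) =
      α * ProbabilityTheory.beta α (1 / 2) := by
    unfold ProbabilityTheory.beta
    have g1 : Real.Gamma (α + 1 + 1 / 2) = (α + 1 / 2) * Real.Gamma (α + 1 / 2) := by
      rw [← Real.Gamma_add_one (by linarith)]; congr 1; ring
    have g2 := (Real.Gamma_pos_of_pos (by linarith : 0 < α + 1 / 2)).ne'
    rw [g1, Real.Gamma_add_one hα.ne']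
    field_simp
  have r1 : (R - 1) ^ (α + 1 + 1 / 2 - 1) = (R - 1) ^ (α - 1 / 2) * (R - 1) := by
    rw [← Real.rpow_add_one hR1.ne']; congr 1; ring
  have r2 : (R - 1) ^ (α + 1 / 2 - 1) = (R - 1) ^ (α - 1 / 2) := by congr 1; ring
  have r3 : R ^ (-α) = R ^ (-(α + 1)) * R := by
    rw [← Real.rpow_add_one hR0.ne']; congr 1; ring
  rw [← mul_assoc (α + 1 / 2), hB, r1, r2, r3]
  ring

/-- The substitution `u = s²`. -/
theorem integral_comp_sq {r : ℝ} (hr : 1 < r) (F : ℝ → ℝ) :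
    (IntegrableOn F (Set.Ioo 1 (r ^ 2)) → IntegrableOn (fun s => s * F (s ^ 2)) (Set.Ioo 1 r)) ∧
    ∫ s in Set.Ioo 1 r, s * F (s ^ 2) = 1 / 2 * ∫ u in Set.Ioo 1 (r ^ 2), F u := by
  have himg : (fun s : ℝ => s ^ 2) '' Set.Ioo 1 r = Set.Ioo 1 (r ^ 2) := by
    ext y
    constructor
    · rintro ⟨s, hs, rfl⟩
      exact ⟨by nlinarith [hs.1], by nlinarith [hs.1, hs.2]⟩
    · intro hy
      refine ⟨Real.sqrt y, ⟨?_, ?_⟩, Real.sq_sqrt (by linarith [hy.1])⟩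
      · rw [Real.lt_sqrt (by norm_num)]; linarith [hy.1]
      · rw [Real.sqrt_lt' (by linarith)]; exact hy.2
  have hinj : Set.InjOn (fun s : ℝ => s ^ 2) (Set.Ioo 1 r) := by
    intro u hu v hv h
    exact (pow_left_inj₀ (by linarith [hu.1]) (by linarith [hv.1]) two_ne_zero).1 h
  have hder : ∀ s ∈ Set.Ioo 1 r,
      HasDerivWithinAt (fun s : ℝ => s ^ 2) (2 * s) (Set.Ioo 1 r) s := by
    intro s _
    simpa using (hasDerivAt_pow 2 s).hasDerivWithinAt
  have hc : ∀ s ∈ Set.Ioo 1 r, |2 * s| • F (s ^ 2) = 2 * (s * F (s ^ 2)) := by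
    intro s hs
    rw [abs_of_pos (by linarith [hs.1]), smul_eq_mul, mul_assoc]
  constructor
  · intro h
    rw [← himg, integrableOn_image_iff_integrableOn_abs_deriv_smul measurableSet_Ioo hder hinj,
      integrableOn_congr_fun hc measurableSet_Ioo] at h
    refine (h.const_mul (1 / 2)).congr (ae_of_all _ fun s => ?_)
    simp only
    ring
  · rw [← himg, integral_image_eq_integral_abs_deriv_smul measurableSet_Ioo hder hinj,
      setIntegral_congr_fun measurableSet_Ioo hc, integral_const_mul]
    ring

theorem sphereArea_pos {m : ℕ} (hm : 0 < m) : 0 < sphereArea m := by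
  have : (0 : ℝ) < m := by exact_mod_cast hm
  unfold sphereArea
  have := Real.Gamma_pos_of_pos (by positivity : (0 : ℝ) < m / 2)
  positivity

theorem abelConst_eq {n k : ℕ} (h1 : 1 ≤ k) (hk : k < n) :
    abelConst n k = 2 * Real.Gamma ((n : ℝ) / 2) /
      (Real.Gamma ((k : ℝ) / 2) * Real.Gamma (((n : ℝ) - k) / 2)) := by
  have hk0 : (0 : ℝ) < k := by exact_mod_cast h1
  have hkn : (k : ℝ) < n := by exact_mod_cast hk
  have g1 := (Real.Gamma_pos_of_pos (by linarith : (0 : ℝ) < k / 2)).ne'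
  have g2 := (Real.Gamma_pos_of_pos (by linarith : (0 : ℝ) < ((n : ℝ) - k) / 2)).ne'
  have g3 := (Real.Gamma_pos_of_pos (by linarith : (0 : ℝ) < (n : ℝ) / 2)).ne'
  have hpi := Real.pi_pos
  have e : Real.pi ^ ((n : ℝ) / 2) =
      Real.pi ^ ((k : ℝ) / 2) * Real.pi ^ (((n : ℝ) - k) / 2) := by
    rw [← Real.rpow_add hpi]; congr 1; ring
  have p1 := (Real.rpow_pos_of_pos hpi ((k : ℝ) / 2)).ne'
  have p2 := (Real.rpow_pos_of_pos hpi (((n : ℝ) - k) / 2)).ne'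
  unfold abelConst sphereArea
  rw [Nat.cast_sub hk.le, e]
  field_simp

/-- The substitution `u = s²`, `R = r²` reduces the equation to an identity on `(1, R)`; the factor
`κ / 2` comes from `s ds = du / 2`. For `r ≤ 1` both sides vanish. -/
theorem solvesAbel_of {n k ℓ : ℕ} {w G : ℝ → ℝ} {κ : ℝ} (hw0 : ∀ s ≤ 1, w s = 0)
    (hw : ∀ s, 1 < s → s ^ (n - k - 1) * w s = κ * (s * G (s ^ 2)))
    (hint : ∀ R, 1 < R →
      IntervalIntegrable (fun u => G u * (R - u) ^ ((k : ℝ) / 2 - 1)) volume 1 R)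
    (hval : ∀ R, 1 < R →
      abelConst n k * (κ / 2) * ∫ u in (1 : ℝ)..R, G u * (R - u) ^ ((k : ℝ) / 2 - 1) =
        (R - 1) ^ ℓ * R ^ (-((ℓ : ℝ) + 3 / 2))) :
    SolvesAbel n k w (psi n ℓ) := by
  intro r hr
  have hz : ∀ s ≤ 1, abelIntegrand n k w r s = 0 := fun s hs => by
    simp [abelIntegrand, hw0 s hs]
  rcases le_or_gt r 1 with h1 | h1
  · have hz' : Set.EqOn (fun _ => 0) (abelIntegrand n k w r) (Set.uIcc 0 r) := fun s hs => by
      rw [Set.uIcc_of_le hr.le] at hs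
      exact (hz s (hs.2.trans h1)).symm
    refine ⟨(IntervalIntegrable.refl.trans intervalIntegrable_const).congr
      (hz'.mono Set.uIoc_subset_uIcc), ?_⟩
    rw [← intervalIntegral.integral_congr hz']
    simp [psi, h1]
  · have hz' : Set.EqOn (fun _ => 0) (abelIntegrand n k w r) (Set.uIcc 0 1) := fun s hs => by
      rw [Set.uIcc_of_le zero_le_one] at hs
      exact (hz s hs.2).symm
    have hR : 1 < r ^ 2 := by nlinarith
    have hc : ∀ s ∈ Set.Ioo 1 r, abelIntegrand n k w r s =
        κ * (s * (G (s ^ 2) * (r ^ 2 - s ^ 2) ^ ((k : ℝ) / 2 - 1))) := by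
      intro s hs
      rw [abelIntegrand, hw s hs.1]
      ring
    have i1 := hint _ hR
    have hv := hval _ hR
    rw [intervalIntegrable_iff_integrableOn_Ioo_of_le hR.le] at i1
    have j0 : IntervalIntegrable (abelIntegrand n k w r) volume 0 1 :=
      (intervalIntegrable_const (c := (0 : ℝ))).congr (hz'.mono Set.uIoc_subset_uIcc)
    have sq := integral_comp_sq h1 (fun u => G u * (r ^ 2 - u) ^ ((k : ℝ) / 2 - 1))
    have j1 : IntervalIntegrable (abelIntegrand n k w r) volume 1 r := by
      rw [intervalIntegrable_iff_integrableOn_Ioo_of_le h1.le,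
        integrableOn_congr_fun hc measurableSet_Ioo]
      exact (sq.1 i1).const_mul κ
    refine ⟨j0.trans j1, ?_⟩
    rw [← intervalIntegral.integral_add_adjacent_intervals j0 j1,
      ← intervalIntegral.integral_congr hz', intervalIntegral.integral_of_le h1.le,
      integral_Ioc_eq_integral_Ioo, setIntegral_congr_fun measurableSet_Ioo hc,
      integral_const_mul, sq.2]
    rw [intervalIntegral.integral_of_le hR.le, integral_Ioc_eq_integral_Ioo] at hv
    have e : (r ^ 2) ^ (-((ℓ : ℝ) + 3 / 2)) = (r ^ (2 * ℓ + 3))⁻¹ := by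
      rw [← Real.rpow_natCast r 2, ← Real.rpow_mul hr.le, ← Real.rpow_natCast r (2 * ℓ + 3),
        ← Real.rpow_neg hr.le]
      congr 1
      push_cast
      ring
    rw [e] at hv
    have e2 : r ^ (2 - (n : ℤ)) = r ^ 2 / r ^ n := by
      rw [zpow_sub₀ hr.ne', zpow_natCast]; rfl
    simp only [psi, not_le.2 h1, if_false, intervalIntegral.integral_zero, zero_add]
    calc _ = r ^ (2 - (n : ℤ)) * (abelConst n k * (κ / 2) *
          ∫ u in Set.Ioo 1 (r ^ 2), G u * (r ^ 2 - u) ^ ((k : ℝ) / 2 - 1)) := by ring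
      _ = _ := by
        rw [hv, e2, pow_succ r (n + 2 * ℓ), pow_add r n, pow_add r (2 * ℓ) 3]
        field_simp

theorem wEven_apply {n ℓ : ℕ} {r : ℝ} (hr : 1 < r) :
    wEven n ℓ r = constEven n ℓ * r ^ (2 + 2 * (ℓ : ℤ) - n) *
      abelDeriv ℓ (ℓ + 3 / 2) ℓ (r ^ 2) := by
  rw [wEven, if_neg (not_le.2 hr), radialDeriv_iterate (α := ℓ) (β := ℓ + 3 / 2) ?_ ℓ hr]
  intro t ht
  have ht0 : 0 < t := by linarith
  rw [abelDeriv_zero, Real.rpow_natCast, ← Real.rpow_natCast t 2, ← Real.rpow_mul ht0.le,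
    div_eq_mul_inv, ← Real.rpow_natCast t (2 * ℓ + 3), ← Real.rpow_neg ht0.le]
  congr 2
  push_cast
  ring

theorem wOdd_apply {n ℓ : ℕ} {r : ℝ} (hr : 1 < r) :
    wOdd n ℓ r = constOdd n ℓ * r ^ (3 + 2 * (ℓ : ℤ) - n) *
      abelDeriv (ℓ + 1 / 2) (ℓ + 1) (ℓ + 1) (r ^ 2) := by
  rw [wOdd, if_neg (not_le.2 hr), radialDeriv_iterate (α := ℓ + 1 / 2) (β := ℓ + 1) ?_ (ℓ + 1) hr]
  intro t ht
  have ht0 : 0 < t := by linarith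
  rw [abelDeriv_zero, ← Real.rpow_natCast t 2, ← Real.rpow_mul ht0.le,
    div_eq_mul_inv, ← Real.rpow_natCast t (2 * ℓ + 2), ← Real.rpow_neg ht0.le]
  congr 2
  push_cast
  ring

/-- The power of `s` in `wEven` is the one for which the total exponent is `1`, as the substitution
`u = s²` requires. -/
theorem pow_mul_wEven {n ℓ : ℕ} (hk : 2 * ℓ < n) {s : ℝ} (hs : 1 < s) :
    s ^ (n - 2 * ℓ - 1) * wEven n ℓ s =
      constEven n ℓ * (s * abelDeriv ℓ (ℓ + 3 / 2) ℓ (s ^ 2)) := by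
  have hs0 : s ≠ 0 := by linarith
  have e : s ^ (n - 2 * ℓ - 1) * s ^ (2 + 2 * (ℓ : ℤ) - n) = s := by
    rw [← zpow_natCast, ← zpow_add₀ hs0]
    have : ((n - 2 * ℓ - 1 : ℕ) : ℤ) + (2 + 2 * (ℓ : ℤ) - n) = 1 := by omega
    rw [this, zpow_one]
  rw [wEven_apply hs]
  linear_combination (constEven n ℓ * abelDeriv ℓ (ℓ + 3 / 2) ℓ (s ^ 2)) * e

theorem pow_mul_wOdd {n ℓ : ℕ} (hk : 2 * ℓ + 1 < n) {s : ℝ} (hs : 1 < s) :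
    s ^ (n - (2 * ℓ + 1) - 1) * wOdd n ℓ s =
      constOdd n ℓ * (s * abelDeriv (ℓ + 1 / 2) (ℓ + 1) (ℓ + 1) (s ^ 2)) := by
  have hs0 : s ≠ 0 := by linarith
  have e : s ^ (n - (2 * ℓ + 1) - 1) * s ^ (3 + 2 * (ℓ : ℤ) - n) = s := by
    rw [← zpow_natCast, ← zpow_add₀ hs0]
    have : ((n - (2 * ℓ + 1) - 1 : ℕ) : ℤ) + (3 + 2 * (ℓ : ℤ) - n) = 1 := by omega
    rw [this, zpow_one]
  rw [wOdd_apply hs]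
  linear_combination (constOdd n ℓ * abelDeriv (ℓ + 1 / 2) (ℓ + 1) (ℓ + 1) (s ^ 2)) * e

/-- Here `k/2 - 1 = ℓ - 1` is an integer, so `ℓ - 1` integrations by parts remove the kernel
altogether. The factor `Γ(ℓ)` they produce cancels against `abelConst` and `constEven`. -/
theorem solvesAbel_wEven {n ℓ : ℕ} (hℓ : 1 ≤ ℓ) (hk : 2 * ℓ < n) :
    SolvesAbel n (2 * ℓ) (wEven n ℓ) (psi n ℓ) := by
  obtain ⟨i, rfl⟩ := Nat.exists_eq_add_of_le' hℓ
  set ℓ := i + 1 with hℓdef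
  have hℓ0 : (0 : ℝ) < ℓ := by exact_mod_cast hℓ
  have hkn : 2 * (ℓ : ℝ) < n := by exact_mod_cast hk
  have hexp : ((2 * ℓ : ℕ) : ℝ) / 2 - 1 = 0 + i := by
    rw [hℓdef]; push_cast; ring
  refine solvesAbel_of (κ := constEven n ℓ) (G := abelDeriv ℓ (ℓ + 3 / 2) ℓ)
    (fun s hs => by simp [wEven, hs]) (fun s hs => pow_mul_wEven hk hs) ?_ ?_
  · intro R hR
    refine intervalIntegrable_abelDeriv (by linarith) ?_ hR
    push_cast
    linarith
  · intro R hR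
    have h := integral_abelDeriv_add (α := ℓ) (β := ℓ + 3 / 2) (γ := 0) (by norm_num) hR i
      (by rw [hℓdef]; push_cast; linarith)
    rw [integral_abelDeriv_one hℓ0 hR] at h
    rw [hexp, hℓdef, add_comm i 1]
    rw [hℓdef, add_comm i 1] at h
    rw [h, ← add_comm i 1, ← hℓdef, abelConst_eq (by omega) hk, constEven, Real.rpow_natCast]
    have g1 : (0 : ℝ) + i + 1 = ℓ := by rw [hℓdef]; push_cast; ring
    have g2 : (((2 * ℓ : ℕ) : ℝ)) / 2 = ℓ := by push_cast; ring
    have g3 : ((n : ℝ) - ((2 * ℓ : ℕ) : ℝ)) / 2 = n / 2 - ℓ := by push_cast; ring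
    have p1 := (Real.Gamma_pos_of_pos hℓ0).ne'
    have p2 := (Real.Gamma_pos_of_pos (by linarith : (0 : ℝ) < n / 2 - ℓ)).ne'
    have p3 := (Real.Gamma_pos_of_pos (by linarith : (0 : ℝ) < n / 2)).ne'
    rw [g1, g2, g3, zero_add, Real.Gamma_one]
    generalize Real.Gamma ((n : ℝ) / 2 - ℓ) = F at *
    field_simp

/-- Here `k/2 - 1 = ℓ - 1/2`, so `ℓ` integrations by parts leave the kernel `(R - u)^(-1/2)`, which
`integral_half_order` evaluates with `α = ℓ + 1/2`. -/
theorem solvesAbel_wOdd {n ℓ : ℕ} (hk : 2 * ℓ + 1 < n) :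
    SolvesAbel n (2 * ℓ + 1) (wOdd n ℓ) (psi n ℓ) := by
  have hℓ0 : (0 : ℝ) ≤ ℓ := ℓ.cast_nonneg
  have hkn : 2 * (ℓ : ℝ) + 1 < n := by exact_mod_cast hk
  have hexp : ((2 * ℓ + 1 : ℕ) : ℝ) / 2 - 1 = -(1 / 2) + ℓ := by push_cast; ring
  refine solvesAbel_of (κ := constOdd n ℓ) (G := abelDeriv (ℓ + 1 / 2) (ℓ + 1) (ℓ + 1))
    (fun s hs => by simp [wOdd, hs]) (fun s hs => pow_mul_wOdd hk hs) ?_ ?_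
  · intro R hR
    refine intervalIntegrable_abelDeriv (by push_cast; linarith) ?_ hR
    push_cast
    linarith
  · intro R hR
    have hβ : ((ℓ : ℝ) + 1) = ℓ + 1 / 2 + 1 / 2 := by ring
    have h := integral_abelDeriv_add (α := ℓ + 1 / 2) (β := ℓ + 1 / 2 + 1 / 2) (γ := -(1 / 2)) (by norm_num)
      hR ℓ (by linarith)
    rw [integral_half_order (by linarith) hR, ← hβ] at h
    rw [hexp, add_comm ℓ 1, h, abelConst_eq (by omega) hk, constOdd, ProbabilityTheory.beta]
    have g1 : -(1 / 2 : ℝ) + ℓ + 1 = ℓ + 1 / 2 := by ring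
    have g2 : (((2 * ℓ + 1 : ℕ) : ℝ)) / 2 = ℓ + 1 / 2 := by push_cast; ring
    have g3 : ((n : ℝ) - ((2 * ℓ + 1 : ℕ) : ℝ)) / 2 = (n - 1) / 2 - ℓ := by push_cast; ring
    have g4 : -(1 / 2 : ℝ) + 1 = 1 / 2 := by ring
    have g5 : Real.Gamma ((ℓ : ℝ) + 3 / 2) = (ℓ + 1 / 2) * Real.Gamma ((ℓ : ℝ) + 1 / 2) := by
      rw [← Real.Gamma_add_one (by linarith)]; congr 1; ring
    have g6 : Real.Gamma ((ℓ : ℝ) + 1 / 2 + 1 / 2) = (ℓ.factorial : ℝ) := by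
      rw [← hβ, Real.Gamma_nat_eq_factorial]
    have g7 : (ℓ : ℝ) + 1 / 2 - 1 / 2 = ℓ := by ring
    have g8 : (ℓ : ℝ) + 1 / 2 + 1 = ℓ + 3 / 2 := by ring
    have p1 := (Real.Gamma_pos_of_pos (by linarith : (0 : ℝ) < ℓ + 1 / 2)).ne'
    have p2 := (Real.Gamma_pos_of_pos (by linarith : (0 : ℝ) < ((n : ℝ) - 1) / 2 - ℓ)).ne'
    have p3 := (Real.Gamma_pos_of_pos (by linarith : (0 : ℝ) < n / 2)).ne'
    have p4 := (Real.Gamma_pos_of_pos (by norm_num : (0 : ℝ) < 1 / 2)).ne'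
    have p5 : (ℓ.factorial : ℝ) ≠ 0 := by exact_mod_cast ℓ.factorial_ne_zero
    have p6 : (ℓ : ℝ) + 1 / 2 ≠ 0 := by linarith
    rw [g1, g2, g3, g4, g5, g6, g7, g8, Real.rpow_natCast]
    generalize (R - 1) ^ ℓ = A
    generalize R ^ (-((ℓ : ℝ) + 3 / 2)) = B
    generalize Real.Gamma (1 / 2) = C at *
    generalize Real.Gamma ((ℓ : ℝ) + 1 / 2) = D at *
    generalize Real.Gamma (((n : ℝ) - 1) / 2 - ℓ) = F at *
    generalize Real.Gamma ((n : ℝ) / 2) = H at *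
    generalize (ℓ : ℝ) + 1 / 2 = L at *
    field_simp

theorem measurable_of_eq_on_one_lt {w v : ℝ → ℝ} (hv : Measurable v) (h0 : ∀ s ≤ 1, w s = 0)
    (h : ∀ s, 1 < s → w s = v s) : Measurable w := by
  have : w = fun s => if s ≤ 1 then 0 else v s := by
    funext s
    split_ifs with hs
    · exact h0 s hs
    · exact h s (not_le.1 hs)
  rw [this]
  exact Measurable.ite measurableSet_Iic measurable_const hv

theorem measurable_wEven (n ℓ : ℕ) : Measurable (wEven n ℓ) := by
  have := measurable_abelDeriv ℓ (ℓ + 3 / 2) ℓ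
  exact measurable_of_eq_on_one_lt (by fun_prop) (fun s hs => by simp [wEven, hs])
    (fun s hs => wEven_apply hs)

theorem measurable_wOdd (n ℓ : ℕ) : Measurable (wOdd n ℓ) := by
  have := measurable_abelDeriv (ℓ + 1 / 2) (ℓ + 1) (ℓ + 1)
  exact measurable_of_eq_on_one_lt (by fun_prop) (fun s hs => by simp [wOdd, hs])
    (fun s hs => wOdd_apply hs)

/-- The weight dominating the functions `w`. -/
theorem abel_weight_bound {α β κ : ℝ} {j : ℕ} (h1 : -(1 / 2) ≤ α - j) (h2 : α - j + 3 / 2 ≤ β) :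
    ∃ C, 0 ≤ C ∧ ∀ s, 1 < s →
      |κ * (s * abelDeriv α β j (s ^ 2))| ≤ C * (s⁻¹ * (s ^ 2 - 1) ^ (-(1 / 2) : ℝ)) := by
  obtain ⟨C, hC0, hC⟩ := exists_abelDeriv_bound α β j
  refine ⟨|κ| * C, by positivity, fun s hs => ?_⟩
  have hs0 : 0 < s := by linarith
  have hu : 1 < s ^ 2 := by nlinarith
  have hu0 : 0 < s ^ 2 - 1 := by linarith
  have hd : 0 ≤ α - j + 1 / 2 := by linarith
  have key : (s ^ 2 - 1) ^ (α - j) * (s ^ 2) ^ (-β) ≤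
      (s ^ 2 - 1) ^ (-(1 / 2) : ℝ) * (s ^ 2)⁻¹ := by
    -- After splitting off the singularity `-1/2`, the remaining exponent `α - j + 1/2` is
    -- nonnegative, so `s² - 1` may be replaced by `s²`. The resulting exponent of `s²` is at most
    -- `-1`.
    have e1 : (s ^ 2 - 1) ^ (α - j) =
        (s ^ 2 - 1) ^ (-(1 / 2) : ℝ) * (s ^ 2 - 1) ^ (α - j + 1 / 2) := by
      rw [← Real.rpow_add hu0]; congr 1; ring
    rw [e1, mul_assoc]
    refine mul_le_mul_of_nonneg_left ?_ (Real.rpow_nonneg hu0.le _)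
    calc (s ^ 2 - 1) ^ (α - j + 1 / 2) * (s ^ 2) ^ (-β)
        ≤ (s ^ 2) ^ (α - j + 1 / 2) * (s ^ 2) ^ (-β) := by
          gcongr
          linarith
      _ = (s ^ 2) ^ (α - j + 1 / 2 - β) := by
          rw [← Real.rpow_add (by positivity)]; rfl
      _ ≤ (s ^ 2) ^ (-1 : ℝ) := Real.rpow_le_rpow_of_exponent_le hu.le (by linarith)
      _ = (s ^ 2)⁻¹ := Real.rpow_neg_one _
  rw [abs_mul, abs_mul, abs_of_pos hs0]
  calc |κ| * (s * |abelDeriv α β j (s ^ 2)|)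
      ≤ |κ| * (s * (C * ((s ^ 2 - 1) ^ (-(1 / 2) : ℝ) * (s ^ 2)⁻¹))) := by
        gcongr
        exact (hC _ hu).trans (by gcongr)
    _ = _ := by
        field_simp

theorem wEven_bound {n ℓ : ℕ} (hk : 2 * ℓ < n) : ∃ C, 0 ≤ C ∧ ∀ s, 1 < s →
    |s ^ (n - 2 * ℓ - 1) * wEven n ℓ s| ≤ C * (s⁻¹ * (s ^ 2 - 1) ^ (-(1 / 2) : ℝ)) := by
  obtain ⟨C, h0, hC⟩ := abel_weight_bound (κ := constEven n ℓ) (α := ℓ) (β := ℓ + 3 / 2) (j := ℓ)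
    (by norm_num) (by have : (0 : ℝ) ≤ ℓ := ℓ.cast_nonneg
                      linarith)
  exact ⟨C, h0, fun s hs => by rw [pow_mul_wEven hk hs]; exact hC s hs⟩

theorem wOdd_bound {n ℓ : ℕ} (hk : 2 * ℓ + 1 < n) : ∃ C, 0 ≤ C ∧ ∀ s, 1 < s →
    |s ^ (n - (2 * ℓ + 1) - 1) * wOdd n ℓ s| ≤ C * (s⁻¹ * (s ^ 2 - 1) ^ (-(1 / 2) : ℝ)) := by
  have h0 : (0 : ℝ) ≤ ℓ := ℓ.cast_nonneg
  obtain ⟨C, h0, hC⟩ := abel_weight_bound (κ := constOdd n ℓ) (α := ℓ + 1 / 2) (β := ℓ + 1)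
    (j := ℓ + 1) (by push_cast; linarith) (by push_cast; linarith)
  exact ⟨C, h0, fun s hs => by rw [pow_mul_wOdd hk hs]; exact hC s hs⟩

/-! ### Polar and bipolar coordinates. -/

open scoped ENNReal

/-- Integration of radial functions in polar coordinates. -/
theorem lintegral_fun_norm {F : Type*} [NormedAddCommGroup F] [InnerProductSpace ℝ F]
    [FiniteDimensional ℝ F] [MeasurableSpace F] [BorelSpace F] [Nontrivial F]
    {h : ℝ → ℝ≥0∞} (hh : Measurable h) :
    ∫⁻ x : F, h ‖x‖ = ENNReal.ofReal (sphereArea (Module.finrank ℝ F)) *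
      ∫⁻ r in Set.Ioi (0 : ℝ), ENNReal.ofReal (r ^ (Module.finrank ℝ F - 1)) * h r := by
  set μ : Measure F := volume
  set d := Module.finrank ℝ F
  have hd : 0 < d := Module.finrank_pos
  have e0 : ∫⁻ x : F, h ‖x‖ = ∫⁻ x : ({0}ᶜ : Set F), h ‖x.1‖ ∂(μ.comap (↑)) := by
    rw [lintegral_subtype_comap (measurableSet_singleton _).compl fun x : F => h ‖x‖,
      restrict_compl_singleton]
  have e1 : ∫⁻ x : ({0}ᶜ : Set F), h ‖x.1‖ ∂(μ.comap (↑)) =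
      ∫⁻ x, h x.2 ∂μ.toSphere.prod (.volumeIoiPow (d - 1)) := by
    have := μ.measurePreserving_homeomorphUnitSphereProd.lintegral_comp
      (f := fun p => h p.2) (by fun_prop)
    simpa using this
  have e2 : ∫⁻ x, h x.2 ∂μ.toSphere.prod (.volumeIoiPow (d - 1)) =
      (∫⁻ r : Set.Ioi (0 : ℝ), h r ∂(Measure.volumeIoiPow (d - 1))) * μ.toSphere Set.univ := by
    rw [lintegral_prod _ (by fun_prop)]
    exact lintegral_const (∫⁻ r : Set.Ioi (0 : ℝ), h r ∂(Measure.volumeIoiPow (d - 1)))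
  have e3 : ∫⁻ r : Set.Ioi (0 : ℝ), h r ∂(Measure.volumeIoiPow (d - 1)) =
      ∫⁻ r in Set.Ioi (0 : ℝ), ENNReal.ofReal (r ^ (d - 1)) * h r := by
    rw [Measure.volumeIoiPow, lintegral_withDensity_eq_lintegral_mul _ (by fun_prop)
      (by fun_prop)]
    simp only [Pi.mul_apply]
    rw [lintegral_subtype_comap measurableSet_Ioi fun r : ℝ => ENNReal.ofReal (r ^ (d - 1)) * h r]
  have e4 : μ.toSphere Set.univ = ENNReal.ofReal (sphereArea d) := by
    rw [Measure.toSphere_apply_univ, InnerProductSpace.volume_ball, ENNReal.ofReal_one, one_pow,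
      one_mul, ← ENNReal.ofReal_natCast, ← ENNReal.ofReal_mul (by positivity)]
    congr 1
    have hd0 : (d : ℝ) ≠ 0 := by exact_mod_cast hd.ne'
    have g := (Real.Gamma_pos_of_pos (by positivity : (0 : ℝ) < d / 2)).ne'
    change (d : ℝ) * (√Real.pi ^ d / Real.Gamma ((d : ℝ) / 2 + 1)) = _
    rw [sphereArea, Real.Gamma_add_one (by positivity), Real.sqrt_eq_rpow,
      ← Real.rpow_natCast, ← Real.rpow_mul Real.pi_pos.le]
    have : (1 / 2 : ℝ) * d = d / 2 := by ring
    rw [this]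
    field_simp
  rw [e0, e1, e2, e3, e4, mul_comm]

/-- The map `(x, v) ↦ x + v` from `K × Kᗮ` preserves volume. -/
theorem measurePreserving_add_orthogonal {n : ℕ} (K : Submodule ℝ (E n)) :
    MeasurePreserving (fun p : K × Kᗮ => (p.1 : E n) + p.2) := by
  have h := K.orthogonalDecomposition.symm.measurePreserving.comp
    (WithLp.volume_preserving_toLp K Kᗮ)
  have e : (fun p : K × Kᗮ => (p.1 : E n) + p.2) =
      K.orthogonalDecomposition.symm ∘ WithLp.toLp 2 := by
    funext p
    simp
  rwa [e]

/-- The length of the component of `y` orthogonal to `ζ`. -/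
noncomputable def perpNorm {n k : ℕ} (ζ : Grassmannian n k) (y : E n) : ℝ :=
  ‖y - ζ.1.starProjection y‖

theorem perpNorm_add {n k : ℕ} (ζ : Grassmannian n k) (x : ζ.1) (v : E n) :
    perpNorm ζ (x + v) = perpNorm ζ v := by
  have h1 : ζ.1.starProjection (x : E n) = x := Submodule.starProjection_eq_self_iff.2 x.2
  rw [perpNorm, perpNorm, map_add, h1, add_sub_add_left_eq_sub]

theorem perpNorm_of_mem_orthogonal {n k : ℕ} (ζ : Grassmannian n k) (v : ζ.1ᗮ) :
    perpNorm ζ (v : E n) = ‖(v : E n)‖ := by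
  have h1 : ζ.1.starProjection (v : E n) = 0 :=
    (Submodule.starProjection_apply_eq_zero_iff ζ.1).2 v.2
  rw [perpNorm, h1, sub_zero]

theorem orthGroup_apply_star_apply {n : ℕ} (u : OrthGroup n) (y : E n) :
    (u : E n →L[ℝ] E n) (star (u : E n →L[ℝ] E n) y) = y := by
  have := congrArg (fun T : E n →L[ℝ] E n => T y) (Unitary.mul_star_self_of_mem u.2)
  exact this

theorem orthGroup_star_apply_apply {n : ℕ} (u : OrthGroup n) (y : E n) :
    star (u : E n →L[ℝ] E n) ((u : E n →L[ℝ] E n) y) = y := by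
  have := congrArg (fun T : E n →L[ℝ] E n => T y) (Unitary.star_mul_self_of_mem u.2)
  exact this

theorem perpNorm_rotate {n k : ℕ} (u : OrthGroup n) (ζ : Grassmannian n k) (y : E n) :
    perpNorm (rotate u ζ) y = perpNorm ζ (star (u : E n →L[ℝ] E n) y) := by
  have h2 : (rotate u ζ).1.starProjection y =
      (u : E n →L[ℝ] E n) (ζ.1.starProjection (star (u : E n →L[ℝ] E n) y)) :=
    congrArg (fun T : E n →L[ℝ] E n => T y) (rotate_proj u ζ)
  calc ‖y - (rotate u ζ).1.starProjection y‖
      = ‖(u : E n →L[ℝ] E n) (star (u : E n →L[ℝ] E n) y -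
          ζ.1.starProjection (star (u : E n →L[ℝ] E n) y))‖ := by
        rw [h2, map_sub, orthGroup_apply_star_apply]
    _ = _ := Unitary.norm_map u _

theorem continuous_perpNorm {n k : ℕ} (ζ : Grassmannian n k) : Continuous (perpNorm ζ) := by
  unfold perpNorm
  fun_prop

/-- With `r² = t² + s²` one has `t dt = r dr`, hence `t^(k-1) dt = r (r² - s²)^(k/2-1) dr`. This is
how the Abel kernel arises. -/
theorem lintegral_sqrt_add_sq {k : ℕ} (hk : 1 ≤ k) {s : ℝ} (hs : 0 < s) (h : ℝ → ℝ≥0∞) :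
    ∫⁻ t in Set.Ioi (0 : ℝ), ENNReal.ofReal (t ^ (k - 1)) * h (√(t ^ 2 + s ^ 2)) =
      ∫⁻ r in Set.Ioi s, ENNReal.ofReal (r * (r ^ 2 - s ^ 2) ^ ((k : ℝ) / 2 - 1)) * h r := by
  have hpos : ∀ r ∈ Set.Ioi s, 0 < r ^ 2 - s ^ 2 := fun r hr => by
    have := Set.mem_Ioi.1 hr
    nlinarith
  have himg : (fun r : ℝ => √(r ^ 2 - s ^ 2)) '' Set.Ioi s = Set.Ioi 0 := by
    ext t
    constructor
    · rintro ⟨r, hr, rfl⟩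
      exact Real.sqrt_pos.2 (hpos r hr)
    · intro ht
      have ht := Set.mem_Ioi.1 ht
      refine ⟨√(t ^ 2 + s ^ 2), ?_, ?_⟩
      · exact Real.lt_sqrt_of_sq_lt (by nlinarith)
      · simp only
        rw [Real.sq_sqrt (by positivity), add_sub_cancel_right, Real.sqrt_sq ht.le]
  have hinj : Set.InjOn (fun r : ℝ => √(r ^ 2 - s ^ 2)) (Set.Ioi s) := by
    intro a ha b hb hab
    have h1 := (Real.sqrt_inj (hpos a ha).le (hpos b hb).le).1 hab
    have ha := Set.mem_Ioi.1 ha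
    have hb := Set.mem_Ioi.1 hb
    exact (pow_left_inj₀ (by linarith) (by linarith) two_ne_zero).1 (by linarith)
  have hder : ∀ r ∈ Set.Ioi s, HasDerivWithinAt (fun r : ℝ => √(r ^ 2 - s ^ 2))
      (2 * r / (2 * √(r ^ 2 - s ^ 2))) (Set.Ioi s) r := by
    intro r hr
    have h1 : HasDerivAt (fun r : ℝ => r ^ 2 - s ^ 2) (2 * r) r := by
      simpa using (hasDerivAt_pow 2 r).sub_const (s ^ 2)
    exact (h1.sqrt (hpos r hr).ne').hasDerivWithinAt
  rw [← himg, lintegral_image_eq_lintegral_abs_deriv_mul measurableSet_Ioi hder hinj]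
  refine setLIntegral_congr_fun measurableSet_Ioi fun r hr => ?_
  have hp := hpos r hr
  have hr0 : 0 < r := hs.trans hr
  rw [Real.sq_sqrt hp.le, sub_add_cancel, Real.sqrt_sq hr0.le, ← mul_assoc,
    ← ENNReal.ofReal_mul (abs_nonneg _), abs_of_pos (by positivity)]
  congr 2
  have e1 : √(r ^ 2 - s ^ 2) ^ (k - 1) = (r ^ 2 - s ^ 2) ^ ((k : ℝ) / 2 - 1) * √(r ^ 2 - s ^ 2) := by
    rw [Real.sqrt_eq_rpow, ← Real.rpow_natCast, ← Real.rpow_mul hp.le, ← Real.rpow_add hp,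
      Nat.cast_sub hk]
    congr 1
    push_cast
    ring
  rw [e1]
  have := Real.sqrt_pos.2 hp
  field_simp

/-- The Abel type operator acting on nonnegative functions. -/
noncomputable def abelMean (n k : ℕ) (g : ℝ → ℝ≥0∞) (r : ℝ) : ℝ≥0∞ :=
  ENNReal.ofReal (abelConst n k * r ^ (2 - (n : ℤ))) *
    ∫⁻ s in Set.Ioo 0 r,
      ENNReal.ofReal (s ^ (n - k - 1) * (r ^ 2 - s ^ 2) ^ ((k : ℝ) / 2 - 1)) * g s

/-- A domain of integration free of `r` is what Tonelli's theorem needs. -/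
theorem abelMean_eq (n k : ℕ) (g : ℝ → ℝ≥0∞) (r : ℝ) :
    abelMean n k g r = ENNReal.ofReal (abelConst n k * r ^ (2 - (n : ℤ))) *
    ∫⁻ s in Set.Ioi 0, (Set.Iio r).indicator (fun s =>
      ENNReal.ofReal (s ^ (n - k - 1) * (r ^ 2 - s ^ 2) ^ ((k : ℝ) / 2 - 1)) * g s) s := by
  rw [abelMean, setLIntegral_indicator measurableSet_Iio, Set.inter_comm, Set.Ioi_inter_Iio]

theorem measurable_abel_kernel (n k : ℕ) {g : ℝ → ℝ≥0∞} (hg : Measurable g) :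
    Measurable fun p : ℝ × ℝ => (Set.Iio p.1).indicator (fun s =>
      ENNReal.ofReal (s ^ (n - k - 1) * (p.1 ^ 2 - s ^ 2) ^ ((k : ℝ) / 2 - 1)) * g s) p.2 := by
  have : (fun p : ℝ × ℝ => (Set.Iio p.1).indicator (fun s =>
      ENNReal.ofReal (s ^ (n - k - 1) * (p.1 ^ 2 - s ^ 2) ^ ((k : ℝ) / 2 - 1)) * g s) p.2) =
      {p : ℝ × ℝ | p.2 < p.1}.indicator fun p =>
      ENNReal.ofReal (p.2 ^ (n - k - 1) * (p.1 ^ 2 - p.2 ^ 2) ^ ((k : ℝ) / 2 - 1)) * g p.2 := by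
    ext p
    simp only [Set.indicator, Set.mem_Iio, Set.mem_ofPred_eq]
  rw [this]
  refine Measurable.indicator ?_ (measurableSet_lt measurable_snd measurable_fst)
  fun_prop

theorem measurable_abelMean (n k : ℕ) {g : ℝ → ℝ≥0∞} (hg : Measurable g) :
    Measurable (abelMean n k g) := by
  simp_rw [funext (abelMean_eq n k g)]
  refine Measurable.mul (by fun_prop) ?_
  exact (measurable_abel_kernel n k hg).lintegral_prod_right'

theorem finrank_orthogonal {n k : ℕ} (ζ : Grassmannian n k) :
    Module.finrank ℝ ζ.1ᗮ = n - k := by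
  have h1 := ζ.1.finrank_add_finrank_orthogonal
  have h2 := ζ.2
  have h3 : Module.finrank ℝ (E n) = n := finrank_euclideanSpace_fin
  omega

/-- Integration of functions of `|y|` and of the distance to `ζ`, in bipolar coordinates. -/
theorem lintegral_norm_mul_perpNorm {n k : ℕ} (h1 : 1 ≤ k) (hk : k < n) (ζ : Grassmannian n k)
    {g h : ℝ → ℝ≥0∞} (hg : Measurable g) (hh : Measurable h) :
    ∫⁻ y : E n, h ‖y‖ * g (perpNorm ζ y) = ∫⁻ y : E n, h ‖y‖ * abelMean n k g ‖y‖ := by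
  have hn : Module.finrank ℝ (E n) = n := finrank_euclideanSpace_fin
  have : Nontrivial ζ.1 := Module.nontrivial_of_finrank_pos (R := ℝ) (by rw [ζ.2]; omega)
  have : Nontrivial ζ.1ᗮ :=
    Module.nontrivial_of_finrank_pos (R := ℝ) (by rw [finrank_orthogonal ζ]; omega)
  have : Nontrivial (E n) := Module.nontrivial_of_finrank_pos (R := ℝ) (by rw [hn]; omega)
  have hmeas : Measurable (perpNorm ζ) := (continuous_perpNorm ζ).measurable
  have hnorm : ∀ (x : ζ.1) (v : ζ.1ᗮ), ‖(x : E n) + v‖ = √(‖x‖ ^ 2 + ‖v‖ ^ 2) := by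
    intro x v
    rw [← Real.sqrt_sq (norm_nonneg ((x : E n) + v)), sq, sq, sq,
      norm_add_sq_eq_norm_sq_add_norm_sq_real (v.2 x x.2)]
    rfl
  have hA := measurable_abelMean n k hg
  have sn := sphereArea_pos (by omega : 0 < n)
  calc ∫⁻ y : E n, h ‖y‖ * g (perpNorm ζ y)
      = ∫⁻ p : ζ.1 × ζ.1ᗮ, h (√(‖p.1‖ ^ 2 + ‖p.2‖ ^ 2)) * g ‖p.2‖ := by
        rw [← (measurePreserving_add_orthogonal ζ.1).lintegral_comp (by fun_prop)]
        refine lintegral_congr fun p => ?_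
        rw [hnorm, perpNorm_add, perpNorm_of_mem_orthogonal]
        rfl
    _ = ∫⁻ v : ζ.1ᗮ, (∫⁻ x : ζ.1, h (√(‖x‖ ^ 2 + ‖v‖ ^ 2))) * g ‖v‖ := by
        rw [Measure.volume_eq_prod, lintegral_prod_symm' _ (by fun_prop)]
        refine lintegral_congr fun v => ?_
        have hm : Measurable fun x : ζ.1 => h (√(‖x‖ ^ 2 + ‖v‖ ^ 2)) := by fun_prop
        exact lintegral_mul_const (μ := volume) (g ‖v‖) hm
    _ = ∫⁻ v : ζ.1ᗮ, (ENNReal.ofReal (sphereArea k) * ∫⁻ t in Set.Ioi (0 : ℝ),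
          ENNReal.ofReal (t ^ (k - 1)) * h (√(t ^ 2 + ‖v‖ ^ 2))) * g ‖v‖ := by
        refine lintegral_congr fun v => ?_
        have := lintegral_fun_norm (F := ζ.1) (h := fun t => h (√(t ^ 2 + ‖v‖ ^ 2)))
          (by fun_prop)
        rw [this, ζ.2]
    _ = ENNReal.ofReal (sphereArea (n - k)) * ∫⁻ s in Set.Ioi (0 : ℝ),
          ENNReal.ofReal (s ^ (n - k - 1)) * ((ENNReal.ofReal (sphereArea k) *
          ∫⁻ t in Set.Ioi (0 : ℝ),
            ENNReal.ofReal (t ^ (k - 1)) * h (√(t ^ 2 + s ^ 2))) * g s) := by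
        have hm : Measurable fun s : ℝ => (ENNReal.ofReal (sphereArea k) *
          ∫⁻ t in Set.Ioi (0 : ℝ),
            ENNReal.ofReal (t ^ (k - 1)) * h (√(t ^ 2 + s ^ 2))) * g s := by
          refine Measurable.mul (Measurable.const_mul ?_ _) hg
          exact Measurable.lintegral_prod_right'
            (f := fun p : ℝ × ℝ => ENNReal.ofReal (p.2 ^ (k - 1)) * h (√(p.2 ^ 2 + p.1 ^ 2)))
            (by fun_prop)
        have := lintegral_fun_norm (F := ζ.1ᗮ) hm
        rw [this, finrank_orthogonal]
    _ = ENNReal.ofReal (sphereArea (n - k)) * (ENNReal.ofReal (sphereArea k) *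
          ∫⁻ s in Set.Ioi (0 : ℝ), ∫⁻ r in Set.Ioi (0 : ℝ), ENNReal.ofReal r * h r *
          (Set.Iio r).indicator (fun s => ENNReal.ofReal
            (s ^ (n - k - 1) * (r ^ 2 - s ^ 2) ^ ((k : ℝ) / 2 - 1)) * g s) s) := by
        congr 1
        rw [← lintegral_const_mul' _ _ ENNReal.ofReal_ne_top]
        refine setLIntegral_congr_fun measurableSet_Ioi fun s hs => ?_
        have hs := Set.mem_Ioi.1 hs
        rw [lintegral_sqrt_add_sq h1 hs]
        have e1 : ∀ r : ℝ, ENNReal.ofReal r * h r * (Set.Iio r).indicator (fun s => ENNReal.ofReal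
            (s ^ (n - k - 1) * (r ^ 2 - s ^ 2) ^ ((k : ℝ) / 2 - 1)) * g s) s =
            (Set.Ioi s).indicator (fun r => ENNReal.ofReal (s ^ (n - k - 1)) * g s *
              (ENNReal.ofReal (r * (r ^ 2 - s ^ 2) ^ ((k : ℝ) / 2 - 1)) * h r)) r := by
          intro r
          by_cases hr : s < r
          · have hr0 : 0 < r := hs.trans hr
            rw [Set.indicator_of_mem (by exact hr), Set.indicator_of_mem (by exact hr),
              ENNReal.ofReal_mul (by positivity), ENNReal.ofReal_mul hr0.le]
            ring
          · rw [Set.indicator_of_notMem (by exact hr), Set.indicator_of_notMem (by exact hr),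
              mul_zero]
        simp_rw [e1]
        rw [setLIntegral_indicator measurableSet_Ioi,
          Set.inter_eq_left.2 (Set.Ioi_subset_Ioi hs.le),
          lintegral_const_mul _ (by fun_prop)]
        ring
    _ = ENNReal.ofReal (sphereArea (n - k)) * (ENNReal.ofReal (sphereArea k) *
          ∫⁻ r in Set.Ioi (0 : ℝ), ENNReal.ofReal r * h r *
          ∫⁻ s in Set.Ioi (0 : ℝ), (Set.Iio r).indicator (fun s => ENNReal.ofReal
            (s ^ (n - k - 1) * (r ^ 2 - s ^ 2) ^ ((k : ℝ) / 2 - 1)) * g s) s) := by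
        rw [lintegral_lintegral_swap]
        · congr 2
          refine lintegral_congr fun r => ?_
          rw [lintegral_const_mul]
          exact (measurable_abel_kernel n k hg).comp measurable_prodMk_left
        · refine Measurable.aemeasurable (Measurable.mul (by fun_prop) ?_)
          exact (measurable_abel_kernel n k hg).comp measurable_swap
    _ = ENNReal.ofReal (sphereArea n) * ∫⁻ r in Set.Ioi (0 : ℝ),
          ENNReal.ofReal (r ^ (n - 1)) * (h r * abelMean n k g r) := by
        rw [← mul_assoc, ← ENNReal.ofReal_mul (sphereArea_pos (by omega)).le,
          ← lintegral_const_mul' _ _ ENNReal.ofReal_ne_top,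
          ← lintegral_const_mul' _ _ ENNReal.ofReal_ne_top]
        refine setLIntegral_congr_fun measurableSet_Ioi fun r hr => ?_
        have hr := Set.mem_Ioi.1 hr
        rw [abelMean_eq]
        generalize (∫⁻ s in Set.Ioi (0 : ℝ), (Set.Iio r).indicator (fun s => ENNReal.ofReal
            (s ^ (n - k - 1) * (r ^ 2 - s ^ 2) ^ ((k : ℝ) / 2 - 1)) * g s) s) = I
        -- The normalization of the Abel equation appears here: the areas of the spheres in `ζ` and
        -- `ζᗮ` are traded for that of the sphere in `ℝⁿ`, and `r` for `r^(n-1) r^(2-n)`.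
        have hc : sphereArea (n - k) * sphereArea k * r =
            sphereArea n * (r ^ (n - 1) * (abelConst n k * r ^ (2 - (n : ℤ)))) := by
          have e : r ^ (n - 1) * r ^ (2 - (n : ℤ)) = r := by
            rw [← zpow_natCast, ← zpow_add₀ hr.ne']
            have : ((n - 1 : ℕ) : ℤ) + (2 - (n : ℤ)) = 1 := by omega
            rw [this, zpow_one]
          rw [abelConst]
          calc _ = sphereArea (n - k) * sphereArea k * (r ^ (n - 1) * r ^ (2 - (n : ℤ))) := by
                rw [e]
            _ = _ := by
                field_simp
        have hab : 0 ≤ sphereArea (n - k) * sphereArea k :=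
          (mul_pos (sphereArea_pos (by omega)) (sphereArea_pos (by omega))).le
        calc _ = ENNReal.ofReal (sphereArea (n - k) * sphereArea k * r) * (h r * I) := by
              rw [ENNReal.ofReal_mul hab]; ring
          _ = _ := by
              rw [hc, ENNReal.ofReal_mul sn.le, ENNReal.ofReal_mul (by positivity)]; ring
    _ = ∫⁻ y : E n, h ‖y‖ * abelMean n k g ‖y‖ := by
        have := lintegral_fun_norm (F := E n) (h := fun r => h r * abelMean n k g r)
          (by fun_prop)
        rw [this, hn]

/-! ### Averages over the orthogonal group. -/

instance (n : ℕ) : IsProbabilityMeasure (orthHaar n) :=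
  ⟨Measure.haarMeasure_self (K₀ := (⊤ : TopologicalSpace.PositiveCompacts (OrthGroup n)))⟩

instance (n : ℕ) : (orthHaar n).IsMulLeftInvariant := by
  unfold orthHaar
  infer_instance

/-- The action of `u` on `ℝⁿ`. -/
noncomputable def orthApply {n : ℕ} (u : OrthGroup n) (y : E n) : E n := (u : E n →L[ℝ] E n) y

/-- The action of `u⁻¹` on `ℝⁿ`. -/
noncomputable def orthInvApply {n : ℕ} (u : OrthGroup n) (y : E n) : E n :=
  star (u : E n →L[ℝ] E n) y

theorem orthInvApply_orthApply {n : ℕ} (u : OrthGroup n) (y : E n) :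
    orthInvApply u (orthApply u y) = y := orthGroup_star_apply_apply u y

theorem orthApply_orthInvApply {n : ℕ} (u : OrthGroup n) (y : E n) :
    orthApply u (orthInvApply u y) = y := orthGroup_apply_star_apply u y

theorem orthInvApply_mul {n : ℕ} (v u : OrthGroup n) (y : E n) :
    orthInvApply (v * u) y = orthInvApply u (orthInvApply v y) := by
  have h : star ((v * u : OrthGroup n) : E n →L[ℝ] E n) =
      star (u : E n →L[ℝ] E n) * star (v : E n →L[ℝ] E n) := star_mul _ _
  have := congrArg (fun T : E n →L[ℝ] E n => T y) h
  exact this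

theorem orthInvApply_sub {n : ℕ} (u : OrthGroup n) (x y : E n) :
    orthInvApply u (x - y) = orthInvApply u x - orthInvApply u y := map_sub _ _ _

theorem orthInvApply_smul {n : ℕ} (u : OrthGroup n) (c : ℝ) (y : E n) :
    orthInvApply u (c • y) = c • orthInvApply u y := map_smul _ _ _

theorem continuous_orthInvApply (n : ℕ) :
    Continuous fun p : OrthGroup n × E n => orthInvApply p.1 p.2 := by
  have h : Continuous fun p : OrthGroup n × E n => star (p.1 : E n →L[ℝ] E n) :=
    (continuous_subtype_val.comp continuous_fst).star
  exact h.clm_apply continuous_snd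

theorem continuous_orthApply (n : ℕ) :
    Continuous fun p : OrthGroup n × E n => orthApply p.1 p.2 :=
  (continuous_subtype_val.comp continuous_fst).clm_apply continuous_snd

theorem measurePreserving_orthInvApply {n : ℕ} (u : OrthGroup n) :
    MeasurePreserving fun y : E n => orthInvApply u y :=
  (Unitary.linearIsometryEquiv (star u)).measurePreserving

theorem measurePreserving_orthApply {n : ℕ} (u : OrthGroup n) :
    MeasurePreserving fun y : E n => orthApply u y :=
  (Unitary.linearIsometryEquiv u).measurePreserving

theorem norm_orthInvApply {n : ℕ} (u : OrthGroup n) (y : E n) :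
    ‖orthInvApply u y‖ = ‖y‖ :=
  (Unitary.linearIsometryEquiv (star u)).norm_map y

/-- The reflection in the hyperplane orthogonal to `x - y` exchanges `x` and `y`. -/
theorem exists_orthApply_eq {n : ℕ} {x y : E n} (h : ‖x‖ = ‖y‖) :
    ∃ u : OrthGroup n, orthApply u x = y := by
  refine ⟨Unitary.linearIsometryEquiv.symm (Submodule.reflection (ℝ ∙ (x - y))ᗮ), ?_⟩
  exact Submodule.reflection_sub h

/-- The distance from `y` to `u ζ`. -/
noncomputable def orbitPerp {n k : ℕ} (ζ : Grassmannian n k) (u : OrthGroup n) (y : E n) : ℝ :=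
  perpNorm ζ (orthInvApply u y)

theorem measurable_orbitPerp {n k : ℕ} (ζ : Grassmannian n k) :
    Measurable fun p : OrthGroup n × E n => orbitPerp ζ p.1 p.2 :=
  ((continuous_perpNorm ζ).comp (continuous_orthInvApply n)).measurable

attribute [irreducible] orthApply orthInvApply orbitPerp

theorem measurable_orbitPerp_left {n k : ℕ} (ζ : Grassmannian n k) (y : E n) :
    Measurable fun u : OrthGroup n => orbitPerp ζ u y :=
  (measurable_orbitPerp ζ).comp (f := fun u => (u, y)) measurable_prodMk_right

/-- Left invariance of Haar measure and `(v u)⁻¹ v y = u⁻¹ y`. As the group is transitive on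
spheres, the average depends on `‖y‖` only. -/
theorem lintegral_orbitPerp_orthApply {n k : ℕ} (ζ : Grassmannian n k) (g : ℝ → ℝ≥0∞)
    (v : OrthGroup n) (y : E n) :
    ∫⁻ u, g (orbitPerp ζ u (orthApply v y)) ∂orthHaar n =
      ∫⁻ u, g (orbitPerp ζ u y) ∂orthHaar n := by
  rw [← lintegral_mul_left_eq_self (fun u => g (orbitPerp ζ u (orthApply v y))) v]
  refine lintegral_congr fun u => ?_
  rw [orbitPerp, orthInvApply_mul, orthInvApply_orthApply, orbitPerp]

theorem sigmaFinite_map_norm (n : ℕ) :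
    SigmaFinite ((volume : Measure (E n)).map fun y => ‖y‖) := by
  have : IsFiniteMeasureOnCompacts ((volume : Measure (E n)).map fun y => ‖y‖) := by
    refine ⟨fun K hK => ?_⟩
    obtain ⟨r, hr⟩ := hK.isBounded.subset_closedBall 0
    refine (measure_mono hr).trans_lt ?_
    rw [Measure.map_apply measurable_norm measurableSet_closedBall]
    refine (measure_mono ?_).trans_lt (measure_closedBall_lt_top (x := (0 : E n)) (r := r))
    intro y hy
    simpa using hy
  infer_instance

/-- The distribution of the distance from a point to a random `k`-dimensional subspace. -/
theorem ae_lintegral_orbitPerp {n k : ℕ} (h1 : 1 ≤ k) (hk : k < n) (ζ : Grassmannian n k)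
    {g : ℝ → ℝ≥0∞} (hg : Measurable g) :
    ∀ᵐ y : E n, ∫⁻ u, g (orbitPerp ζ u y) ∂orthHaar n =
      abelMean n k g ‖y‖ := by
  set M : E n → ℝ≥0∞ := fun y => ∫⁻ u, g (orbitPerp ζ u y) ∂orthHaar n
    with hM
  have hm2 : Measurable fun p : OrthGroup n × E n => g (orbitPerp ζ p.1 p.2) :=
    hg.comp (measurable_orbitPerp ζ)
  have hMm : Measurable M := Measurable.lintegral_prod_left' hm2
  set e : E n := EuclideanSpace.single (⟨0, by omega⟩ : Fin n) 1
  have he : ‖e‖ = 1 := by simp [e]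
  have hrad : ∀ y, M (‖y‖ • e) = M y := by
    intro y
    obtain ⟨v, hv⟩ := exists_orthApply_eq (x := ‖y‖ • e) (y := y) (by simp [norm_smul, he])
    have h := lintegral_orbitPerp_orthApply ζ g v (‖y‖ • e)
    rw [hv] at h
    exact h.symm
  have hmm : Measurable fun r : ℝ => M (r • e) := hMm.comp (by fun_prop)
  have hA := measurable_abelMean n k hg
  have := sigmaFinite_map_norm n
  -- Both sides are functions of the radius, so it is enough that they have equal integrals over
  -- every measurable set of radii. After Tonelli, each `u` is removed by `y ↦ u⁻¹ y`, which
  -- preserves norm and volume, and the bipolar formula applies.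
  have key : (fun r : ℝ => M (r • e)) =ᵐ[(volume : Measure (E n)).map fun y => ‖y‖]
      abelMean n k g := by
    refine ae_eq_of_forall_setLIntegral_eq_of_sigmaFinite hmm hA fun s hs _ => ?_
    have hI : Measurable (s.indicator (1 : ℝ → ℝ≥0∞)) := measurable_one.indicator hs
    have hsi : ∀ f : ℝ → ℝ≥0∞, Measurable f →
        ∫⁻ r in s, f r ∂((volume : Measure (E n)).map fun y => ‖y‖) =
        ∫⁻ y : E n, s.indicator 1 ‖y‖ * f ‖y‖ := by
      intro f hf
      rw [← lintegral_indicator hs, lintegral_map (hf.indicator hs) measurable_norm]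
      refine lintegral_congr fun y => ?_
      by_cases hy : ‖y‖ ∈ s <;> simp [hy]
    rw [hsi _ hmm, hsi _ hA, ← lintegral_norm_mul_perpNorm h1 hk ζ hg hI]
    simp_rw [hrad, hM]
    have hjm : Measurable fun p : E n × OrthGroup n => s.indicator (1 : ℝ → ℝ≥0∞) ‖p.1‖ *
        g (orbitPerp ζ p.2 p.1) := by
      have ha : Measurable fun p : E n × OrthGroup n => s.indicator (1 : ℝ → ℝ≥0∞) ‖p.1‖ :=
        hI.comp measurable_fst.norm
      have hb : Measurable fun p : E n × OrthGroup n => g (orbitPerp ζ p.2 p.1) :=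
        hm2.comp measurable_swap
      exact ha.mul hb
    calc _ = ∫⁻ y : E n, ∫⁻ u, s.indicator 1 ‖y‖ *
          g (orbitPerp ζ u y) ∂orthHaar n := by
          refine lintegral_congr fun y => ?_
          rw [lintegral_const_mul]
          exact hg.comp (measurable_orbitPerp_left ζ y)
      _ = ∫⁻ u, ∫⁻ y : E n, s.indicator 1 ‖y‖ *
          g (orbitPerp ζ u y) ∂volume ∂orthHaar n :=
          lintegral_lintegral_swap (f := fun y u => s.indicator 1 ‖y‖ * g (orbitPerp ζ u y))
            hjm.aemeasurable
      _ = ∫⁻ _u : OrthGroup n, ∫⁻ y : E n, s.indicator 1 ‖y‖ * g (perpNorm ζ y)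
            ∂volume ∂orthHaar n := by
          refine lintegral_congr fun u => ?_
          rw [← (measurePreserving_orthInvApply u).lintegral_comp
            (f := fun y => s.indicator 1 ‖y‖ * g (perpNorm ζ y))
            ((hI.comp measurable_norm).mul (hg.comp (continuous_perpNorm ζ).measurable))]
          simp_rw [norm_orthInvApply]
          simp_rw [orbitPerp]
      _ = _ := by rw [lintegral_const, measure_univ, mul_one]
  have h2 := ae_of_ae_map measurable_norm.aemeasurable key
  filter_upwards [h2] with y hy
  rw [hrad] at hy
  exact hy

/-- The formula for nonnegative functions is applied to the positive and negative parts of `w`.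
Absolute convergence of the Abel integral makes both results finite, so they can be subtracted. -/
theorem ae_integral_orbitPerp {n k : ℕ} (h1 : 1 ≤ k) (hk : k < n) (ζ : Grassmannian n k)
    {w ψ : ℝ → ℝ} (hw : Measurable w) (hsol : SolvesAbel n k w ψ) :
    ∀ᵐ y : E n,
      ∫ u, w (orbitPerp ζ u y) ∂orthHaar n = ψ ‖y‖ := by
  have : Nontrivial (E n) := Module.nontrivial_of_finrank_pos (R := ℝ)
    (by rw [finrank_euclideanSpace_fin]; omega)
  filter_upwards [ae_lintegral_orbitPerp h1 hk ζ hw.ennreal_ofReal,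
    ae_lintegral_orbitPerp h1 hk ζ hw.neg.ennreal_ofReal, Measure.ae_ne volume (0 : E n)]
    with y hp hn hy
  have hr : 0 < ‖y‖ := norm_pos_iff.2 hy
  obtain ⟨hi, he⟩ := hsol _ hr
  generalize ‖y‖ = r at *
  rw [intervalIntegrable_iff_integrableOn_Ioo_of_le hr.le] at hi
  rw [intervalIntegral.integral_of_le hr.le, integral_Ioc_eq_integral_Ioo] at he
  have hK : ∀ s ∈ Set.Ioo 0 r, 0 ≤ s ^ (n - k - 1) * (r ^ 2 - s ^ 2) ^ ((k : ℝ) / 2 - 1) := by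
    intro s hs
    have := hs.1
    exact mul_nonneg (by positivity) (Real.rpow_nonneg (by nlinarith [hs.2]) _)
  have hc : 0 ≤ abelConst n k * r ^ (2 - (n : ℤ)) := by
    have : 0 < abelConst n k := div_pos (mul_pos (sphereArea_pos (by omega))
      (sphereArea_pos (by omega))) (sphereArea_pos (by omega))
    positivity
  have hpos : abelMean n k (fun s => ENNReal.ofReal (w s)) r =
      ENNReal.ofReal (abelConst n k * r ^ (2 - (n : ℤ))) *
        ∫⁻ s in Set.Ioo 0 r, ENNReal.ofReal (abelIntegrand n k w r s) := by
    rw [abelMean]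
    congr 1
    refine setLIntegral_congr_fun measurableSet_Ioo fun s hs => ?_
    rw [← ENNReal.ofReal_mul (hK s hs), abelIntegrand]
    congr 1
    ring
  have hneg : abelMean n k (fun s => ENNReal.ofReal ((-w) s)) r =
      ENNReal.ofReal (abelConst n k * r ^ (2 - (n : ℤ))) *
        ∫⁻ s in Set.Ioo 0 r, ENNReal.ofReal (-abelIntegrand n k w r s) := by
    rw [abelMean]
    congr 1
    refine setLIntegral_congr_fun measurableSet_Ioo fun s hs => ?_
    rw [← ENNReal.ofReal_mul (hK s hs), abelIntegrand]
    congr 1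
    simp only [Pi.neg_apply]
    ring
  have hfp : ∫⁻ s in Set.Ioo 0 r, ENNReal.ofReal (abelIntegrand n k w r s) < ∞ :=
    hi.lintegral_lt_top
  have hfn : ∫⁻ s in Set.Ioo 0 r, ENNReal.ofReal (-abelIntegrand n k w r s) < ∞ :=
    hi.neg.lintegral_lt_top
  rw [hpos] at hp
  rw [hneg] at hn
  have hwm : Measurable fun u : OrthGroup n => w (orbitPerp ζ u y) :=
    hw.comp (measurable_orbitPerp_left ζ y)
  have hint : Integrable (fun u : OrthGroup n => w (orbitPerp ζ u y))
      (orthHaar n) := by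
    refine ⟨hwm.aestronglyMeasurable, ?_⟩
    rw [hasFiniteIntegral_iff_norm]
    have : ∀ t : ℝ, ENNReal.ofReal ‖t‖ = ENNReal.ofReal t + ENNReal.ofReal (-t) := by
      intro t
      rcases le_total 0 t with ht | ht
      · rw [Real.norm_of_nonneg ht, ENNReal.ofReal_of_nonpos (by linarith : -t ≤ 0), add_zero]
      · rw [Real.norm_of_nonpos ht, ENNReal.ofReal_of_nonpos ht, zero_add]
    simp_rw [this]
    rw [lintegral_add_left hwm.ennreal_ofReal]
    refine ENNReal.add_lt_top.2 ⟨?_, ?_⟩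
    · rw [hp]; exact ENNReal.mul_lt_top ENNReal.ofReal_lt_top hfp
    · have hn' := hn
      simp only [Pi.neg_apply] at hn'
      rw [hn']; exact ENNReal.mul_lt_top ENNReal.ofReal_lt_top hfn
  rw [integral_eq_lintegral_pos_part_sub_lintegral_neg_part hint, hp]
  simp only [Pi.neg_apply] at hn
  rw [hn, ENNReal.toReal_mul, ENNReal.toReal_mul, ENNReal.toReal_ofReal hc, ← he,
    integral_eq_lintegral_pos_part_sub_lintegral_neg_part hi]
  ring

/-! ### The dominating weight and its spherical mean. -/

/-- A weight which dominates the functions `w` of the theorem. -/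
noncomputable def abelWeight (n k : ℕ) (s : ℝ) : ℝ :=
  if s ≤ 1 then 0 else (s ^ (n - k))⁻¹ * (s ^ 2 - 1) ^ (-(1 / 2) : ℝ)

/-- The function `r^(k-n)` on `(1, ∞)`, extended by zero. -/
noncomputable def tailKernel (n k : ℕ) (r : ℝ) : ℝ := if r ≤ 1 then 0 else (r ^ (n - k))⁻¹

theorem measurable_abelWeight (n k : ℕ) : Measurable (abelWeight n k) :=
  Measurable.ite measurableSet_Iic measurable_const (by fun_prop)

theorem measurable_tailKernel (n k : ℕ) : Measurable (tailKernel n k) :=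
  Measurable.ite measurableSet_Iic measurable_const (by fun_prop)

theorem abelWeight_nonneg (n k : ℕ) (s : ℝ) : 0 ≤ abelWeight n k s := by
  unfold abelWeight
  split_ifs with h
  · exact le_rfl
  · have h := not_le.1 h
    have : 0 ≤ s ^ 2 - 1 := by nlinarith
    positivity

theorem abelWeight_pos {n k : ℕ} {s : ℝ} (h : 1 < s) : 0 < abelWeight n k s := by
  rw [abelWeight, if_neg (not_le.2 h)]
  have : 0 < s ^ 2 - 1 := by nlinarith
  positivity

theorem tailKernel_nonneg (n k : ℕ) (s : ℝ) : 0 ≤ tailKernel n k s := by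
  unfold tailKernel
  split_ifs with h
  · exact le_rfl
  · have h := not_le.1 h
    positivity

theorem abs_le_abelWeight {n k : ℕ} (hk : k < n) {w : ℝ → ℝ} {C : ℝ} (hw0 : ∀ s ≤ 1, w s = 0)
    (hC : ∀ s, 1 < s → |s ^ (n - k - 1) * w s| ≤ C * (s⁻¹ * (s ^ 2 - 1) ^ (-(1 / 2) : ℝ)))
    (s : ℝ) : |w s| ≤ C * abelWeight n k s := by
  unfold abelWeight
  split_ifs with h
  · simp [hw0 s h]
  · have h := not_le.1 h
    have hs0 : 0 < s := by linarith
    have h2 := hC s h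
    have e : n - k = n - k - 1 + 1 := by omega
    rw [abs_mul, abs_of_pos (pow_pos hs0 _)] at h2
    rw [e, pow_succ, mul_inv]
    have hp := pow_pos hs0 (n - k - 1)
    calc |w s| = (s ^ (n - k - 1))⁻¹ * (s ^ (n - k - 1) * |w s|) := by field_simp
      _ ≤ (s ^ (n - k - 1))⁻¹ * (C * (s⁻¹ * (s ^ 2 - 1) ^ (-(1 / 2) : ℝ))) := by gcongr
      _ = _ := by ring

/-- Bounding `(r² - s²)^(k/2-1)` by `r^(k-1) (r² - s²)^(-1/2)` reduces every `k` to the Beta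
integral with `a = b = 1/2`, whose value is a multiple of `r⁻¹`. Then `r^(2-n) r^(k-1) r⁻¹ =
r^(k-n)`. -/
theorem exists_abelMean_abelWeight_le {n k : ℕ} (h1 : 1 ≤ k) (hk : k < n) :
    ∃ C, 0 ≤ C ∧ ∀ r, 0 ≤ r → abelMean n k (fun s => ENNReal.ofReal (abelWeight n k s)) r ≤
      ENNReal.ofReal (C * tailKernel n k r) := by
  have hc : 0 < abelConst n k := div_pos (mul_pos (sphereArea_pos (by omega))
    (sphereArea_pos (by omega))) (sphereArea_pos (by omega))
  set B := ProbabilityTheory.beta (1 / 2) (1 / 2)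
  have hB : 0 < B := ProbabilityTheory.beta_pos (by norm_num) (by norm_num)
  refine ⟨abelConst n k * (B / 2), by positivity, fun r hr0 => ?_⟩
  rcases le_or_gt r 1 with hr | hr
  · have : ∫⁻ s in Set.Ioo 0 r, ENNReal.ofReal (s ^ (n - k - 1) *
        (r ^ 2 - s ^ 2) ^ ((k : ℝ) / 2 - 1)) * ENNReal.ofReal (abelWeight n k s) = 0 := by
      refine setLIntegral_eq_zero measurableSet_Ioo fun s hs => ?_
      simp [abelWeight, (hs.2.trans_le hr).le]
    simp [abelMean, this]
  set P : ℝ → ℝ := fun u => (u - 1) ^ ((1 / 2 : ℝ) - 1) * (r ^ 2 - u) ^ ((1 / 2 : ℝ) - 1) *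
    u ^ (-((1 / 2 : ℝ) + 1 / 2)) with hP
  have hR : 1 < r ^ 2 := by nlinarith
  have hr' : 0 < r := by linarith
  have iP : IntegrableOn P (Set.Ioo 1 (r ^ 2)) := by
    rw [← intervalIntegrable_iff_integrableOn_Ioo_of_le hR.le]
    refine (intervalIntegrable_beta (by norm_num) (by norm_num) hR).mul_continuousOn ?_
    refine ContinuousOn.rpow_const (by fun_prop) fun u hu => Or.inl ?_
    rw [Set.uIcc_of_le hR.le] at hu
    linarith [hu.1]
  have vP : ∫ u in Set.Ioo 1 (r ^ 2), P u = B * r⁻¹ := by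
    have := integral_beta_moebius (a := 1 / 2) (b := 1 / 2) one_half_pos one_half_pos hR
    rw [intervalIntegral.integral_of_le hR.le, integral_Ioc_eq_integral_Ioo] at this
    rw [hP, this]
    have e1 : (r ^ 2 - 1) ^ ((1 / 2 : ℝ) + 1 / 2 - 1) = 1 := by norm_num
    have e2 : (r ^ 2) ^ (-(1 / 2) : ℝ) = r⁻¹ := by
      rw [← Real.rpow_natCast, ← Real.rpow_mul hr'.le, ← Real.rpow_neg_one]
      norm_num
    rw [e1, e2, one_mul]
  obtain ⟨j1, j2⟩ := integral_comp_sq hr P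
  have j1 := j1 iP
  rw [vP] at j2
  have hle : ∀ s ∈ Set.Ioo 1 r,
      s ^ (n - k - 1) * (r ^ 2 - s ^ 2) ^ ((k : ℝ) / 2 - 1) * abelWeight n k s ≤
      r ^ (k - 1) * (s * P (s ^ 2)) := by
    intro s hs
    have hs0 : 0 < s := by linarith [hs.1]
    have ha : 0 < s ^ 2 - 1 := by nlinarith [hs.1]
    have hb : 0 < r ^ 2 - s ^ 2 := by nlinarith [hs.1, hs.2]
    have e : n - k = n - k - 1 + 1 := by omega
    have e1 : (r ^ 2 - s ^ 2) ^ ((k : ℝ) / 2 - 1) ≤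
        r ^ (k - 1) * (r ^ 2 - s ^ 2) ^ ((1 / 2 : ℝ) - 1) := by
      have : (k : ℝ) / 2 - 1 = ((k - 1 : ℕ) : ℝ) / 2 + (1 / 2 - 1) := by
        rw [Nat.cast_sub h1]; push_cast; ring
      rw [this, Real.rpow_add hb]
      refine mul_le_mul_of_nonneg_right ?_ (Real.rpow_nonneg hb.le _)
      calc (r ^ 2 - s ^ 2) ^ (((k - 1 : ℕ) : ℝ) / 2) ≤ (r ^ 2) ^ (((k - 1 : ℕ) : ℝ) / 2) := by
            refine Real.rpow_le_rpow hb.le (by nlinarith) (by positivity)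
        _ = r ^ (k - 1) := by
            rw [← Real.rpow_natCast, ← Real.rpow_mul hr'.le, ← Real.rpow_natCast]
            congr 1
            push_cast
            ring
    have e2 : (s ^ 2) ^ (-((1 / 2 : ℝ) + 1 / 2)) = (s ^ 2)⁻¹ := by
      rw [← Real.rpow_neg_one]; norm_num
    have e3 : (1 / 2 : ℝ) - 1 = -(1 / 2) := by norm_num
    rw [abelWeight, if_neg (not_le.2 hs.1)]
    simp only [hP]
    rw [e2, e, pow_succ s (n - k - 1), mul_inv, Nat.add_sub_cancel]
    rw [e3] at e1 ⊢
    have p1 := pow_pos hs0 (n - k - 1)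
    have p2 := Real.rpow_pos_of_pos ha (-(1 / 2) : ℝ)
    calc s ^ (n - k - 1) * (r ^ 2 - s ^ 2) ^ ((k : ℝ) / 2 - 1) *
          ((s ^ (n - k - 1))⁻¹ * s⁻¹ * (s ^ 2 - 1) ^ (-(1 / 2) : ℝ))
        = (r ^ 2 - s ^ 2) ^ ((k : ℝ) / 2 - 1) * (s⁻¹ * (s ^ 2 - 1) ^ (-(1 / 2) : ℝ)) := by
          field_simp
      _ ≤ r ^ (k - 1) * (r ^ 2 - s ^ 2) ^ (-(1 / 2) : ℝ) *
          (s⁻¹ * (s ^ 2 - 1) ^ (-(1 / 2) : ℝ)) := by gcongr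
      _ = _ := by field_simp
  have hbd : ∫⁻ s in Set.Ioo 0 r, ENNReal.ofReal (s ^ (n - k - 1) *
        (r ^ 2 - s ^ 2) ^ ((k : ℝ) / 2 - 1)) * ENNReal.ofReal (abelWeight n k s) ≤
      ENNReal.ofReal (r ^ (k - 1) * (1 / 2 * (B * r⁻¹))) := by
    rw [← j2, ← integral_const_mul, ofReal_integral_eq_lintegral_ofReal (j1.const_mul _) ?_]
    · rw [← lintegral_indicator measurableSet_Ioo, ← lintegral_indicator measurableSet_Ioo]
      refine lintegral_mono fun s => ?_
      by_cases hs : s ∈ Set.Ioo 1 r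
      · have hs0 : 0 < s := by linarith [hs.1]
        have hs' : s ∈ Set.Ioo 0 r := ⟨hs0, hs.2⟩
        have hb : 0 < r ^ 2 - s ^ 2 := by nlinarith [hs.1, hs.2]
        rw [Set.indicator_of_mem hs, Set.indicator_of_mem hs', ← ENNReal.ofReal_mul (by positivity)]
        exact ENNReal.ofReal_le_ofReal (hle s hs)
      · rw [Set.indicator_of_notMem hs]
        by_cases hs' : s ∈ Set.Ioo 0 r
        · have : s ≤ 1 := by
            by_contra h
            exact hs ⟨not_le.1 h, hs'.2⟩
          rw [Set.indicator_of_mem hs']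
          simp [abelWeight, this]
        · rw [Set.indicator_of_notMem hs']
    · filter_upwards [ae_restrict_mem measurableSet_Ioo] with s hs
      have hs0 : 0 < s := by linarith [hs.1]
      have ha : 0 < s ^ 2 - 1 := by nlinarith [hs.1]
      have hb : 0 < r ^ 2 - s ^ 2 := by nlinarith [hs.1, hs.2]
      simp only [hP, Pi.zero_apply]
      positivity
  rw [abelMean]
  refine (mul_le_mul_right hbd _).trans ?_
  rw [← ENNReal.ofReal_mul (by positivity)]
  refine ENNReal.ofReal_le_ofReal (le_of_eq ?_)
  rw [tailKernel, if_neg (not_le.2 hr)]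
  have e1 : r ^ (2 - (n : ℤ)) = r ^ 2 * (r ^ n)⁻¹ := by
    rw [zpow_sub₀ hr'.ne', zpow_natCast]; rfl
  have e2 : r ^ n = r ^ (n - k) * (r ^ (k - 1) * r) := by
    rw [← pow_succ, ← pow_add]; congr 1; omega
  rw [e1, e2]
  field_simp

/-! ### Planes and their points, parametrized by the orthogonal group. -/

theorem infDist_mk' {n k : ℕ} (ζ : Grassmannian n k) (x v : E n) :
    Metric.infDist x (AffineSubspace.mk' v ζ.1 : Set (E n)) = perpNorm ζ (x - v) := by
  have hne : (AffineSubspace.mk' v ζ.1 : Set (E n)).Nonempty := ⟨v, AffineSubspace.self_mem_mk' v _⟩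
  refine le_antisymm ?_ ?_
  · have hmem : v + ζ.1.starProjection (x - v) ∈ (AffineSubspace.mk' v ζ.1 : Set (E n)) := by
      rw [SetLike.mem_coe, AffineSubspace.mem_mk', vsub_eq_sub, add_sub_cancel_left]
      exact Submodule.starProjection_apply_mem _ _
    refine (Metric.infDist_le_dist_of_mem hmem).trans (le_of_eq ?_)
    rw [dist_eq_norm, perpNorm, sub_add_eq_sub_sub]
  · refine (Metric.le_infDist hne).2 fun y hy => ?_
    rw [SetLike.mem_coe, AffineSubspace.mem_mk', vsub_eq_sub] at hy
    have hb : BddBelow (Set.range fun m : ζ.1 => ‖x - v - m‖) :=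
      ⟨0, by rintro _ ⟨m, rfl⟩; exact norm_nonneg _⟩
    have h := ciInf_le hb ⟨y - v, hy⟩
    rw [← Submodule.starProjection_minimal] at h
    rw [dist_eq_norm]
    refine h.trans (le_of_eq ?_)
    congr 1
    simp

theorem orthApply_mem_orthogonal {n k : ℕ} (ζ : Grassmannian n k) (u : OrthGroup n) (v : ζ.1ᗮ) :
    orthApply u (v : E n) ∈ (rotate u ζ).1ᗮ := by
  rintro _ ⟨y, hy, rfl⟩
  rw [orthApply]
  exact (Unitary.inner_map_map u y v).trans (v.2 y hy)

/-- The parametrization `(u, v) ↦ (u ζ, u v)` of the manifold of planes. -/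
noncomputable def planeMap {n k : ℕ} (ζ : Grassmannian n k) (p : OrthGroup n × ζ.1ᗮ) :
    AffineGrassmannian n k :=
  ⟨(rotate p.1 ζ, orthApply p.1 (p.2 : E n)), orthApply_mem_orthogonal ζ p.1 p.2⟩

theorem measurable_planeMap {n k : ℕ} (ζ : Grassmannian n k) : Measurable (planeMap ζ) := by
  refine Measurable.subtype_mk ?_
  refine Measurable.prodMk ((continuous_rotate ζ).measurable.comp measurable_fst) ?_
  have h : Continuous fun p : OrthGroup n × ζ.1ᗮ => (p.1, (p.2 : E n)) := by fun_prop
  have := (continuous_orthApply n).comp h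
  exact this.measurable

theorem planeMap_surjective {n k : ℕ} (ζ : Grassmannian n k) :
    Function.Surjective (planeMap ζ) := by
  rintro ⟨⟨η, x⟩, hx⟩
  obtain ⟨u, rfl⟩ := rotate_surj ζ η
  have hmem : orthInvApply u x ∈ ζ.1ᗮ := by
    intro y hy
    have h := hx (orthApply u y) ⟨y, hy, by rw [orthApply]; rfl⟩
    rw [← orthApply_orthInvApply u x] at h
    have h2 := Unitary.inner_map_map u y (orthInvApply u x)
    rw [orthApply, orthApply] at h
    exact h2.symm.trans h
  refine ⟨(u, ⟨orthInvApply u x, hmem⟩), ?_⟩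
  refine Subtype.ext (Prod.ext rfl ?_)
  exact orthApply_orthInvApply u x

/-- Measurability descends along a measurable surjection from a standard Borel space onto a
countably separated one. It is thus checked on the product, where the parametrized integrals are
measurable. -/
theorem measurable_comp_planeMap_iff {n k : ℕ} (ζ : Grassmannian n k) {β : Type*}
    [MeasurableSpace β] {g : AffineGrassmannian n k → β} :
    Measurable (g ∘ planeMap ζ) ↔ Measurable g := by
  have : MeasurableSpace.CountablySeparated (AffineGrassmannian n k) :=
    inferInstanceAs (MeasurableSpace.CountablySeparated
      {τ : Grassmannian n k × E n // τ.2 ∈ τ.1.1ᗮ})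
  exact (measurable_planeMap ζ).measurable_comp_iff_of_surjective (planeMap_surjective ζ)

theorem measurableSet_preimage_planeMap_iff {n k : ℕ} (ζ : Grassmannian n k)
    {s : Set (AffineGrassmannian n k)} :
    MeasurableSet (planeMap ζ ⁻¹' s) ↔ MeasurableSet s := by
  have : MeasurableSpace.CountablySeparated (AffineGrassmannian n k) :=
    inferInstanceAs (MeasurableSpace.CountablySeparated
      {τ : Grassmannian n k × E n // τ.2 ∈ τ.1.1ᗮ})
  exact (measurable_planeMap ζ).measurableSet_preimage_iff_of_surjective (planeMap_surjective ζ)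

/-- The restriction of `u` to a subspace. -/
noncomputable def rotateIso {n k : ℕ} (u : OrthGroup n) (ζ : Grassmannian n k) :
    ζ.1 ≃ₗᵢ[ℝ] (rotate u ζ).1 :=
  (Unitary.linearIsometryEquiv u).submoduleMap ζ.1

theorem rotateIso_apply {n k : ℕ} (u : OrthGroup n) (ζ : Grassmannian n k) (x : ζ.1) :
    (rotateIso u ζ x : E n) = orthApply u (x : E n) := by
  rw [orthApply]
  rfl

theorem norm_orthApply {n : ℕ} (u : OrthGroup n) (x : E n) : ‖orthApply u x‖ = ‖x‖ := by
  rw [orthApply]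
  exact Unitary.norm_map u x

theorem fiberMeasure_rotate {n k : ℕ} (u : OrthGroup n) (ζ : Grassmannian n k) :
    fiberMeasure (rotate u ζ) = ((volume : Measure ζ.1ᗮ).map (Prod.mk u)).map (planeMap ζ) := by
  let L : ζ.1ᗮ →ₗᵢ[ℝ] (rotate u ζ).1ᗮ :=
    { toFun := fun v => ⟨orthApply u (v : E n), orthApply_mem_orthogonal ζ u v⟩
      map_add' := fun x y => Subtype.ext (by simp [orthApply])
      map_smul' := fun c x => Subtype.ext (by simp [orthApply])
      norm_map' := fun x => norm_orthApply u (x : E n) }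
  have hfr : Module.finrank ℝ ζ.1ᗮ = Module.finrank ℝ (rotate u ζ).1ᗮ := by
    rw [finrank_orthogonal, finrank_orthogonal]
  have hmp := (L.toLinearIsometryEquiv hfr).measurePreserving
  rw [Measure.map_map (measurable_planeMap ζ) (by fun_prop)]
  change Measure.map (fun x : (rotate u ζ).1ᗮ =>
    (⟨(rotate u ζ, (x : E n)), x.2⟩ : AffineGrassmannian n k)) volume = _
  rw [← hmp.map_eq, Measure.map_map ?_ hmp.measurable]
  · rfl
  · refine Measurable.subtype_mk ?_
    exact Measurable.prodMk measurable_const measurable_subtype_coe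

/-- Integrals over the manifold of planes become integrals over a fixed product space, where
Fubini's theorem applies. -/
theorem affineMeasure_eq_map {n k : ℕ} (hk : k ≤ n) :
    affineMeasure hk =
      ((orthHaar n).prod (volume : Measure (coordSubspace hk).1ᗮ)).map
        (planeMap (coordSubspace hk)) := by
  ext s hs
  have hq := (continuous_rotate (n := n) (coordSubspace hk)).measurable
  have hm : Measurable fun ζ : Grassmannian n k => fiberMeasure ζ s :=
    (Measure.measurable_coe hs).comp (measurable_fiberMeasure hk)
  rw [affineMeasure, Measure.bind_apply hs (measurable_fiberMeasure hk).aemeasurable, grassMeasure,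
    lintegral_map hm hq,
    Measure.map_apply (measurable_planeMap _) hs,
    Measure.prod_apply (measurable_planeMap _ hs)]
  refine lintegral_congr fun u => ?_
  rw [fiberMeasure_rotate, Measure.map_apply (measurable_planeMap _) hs,
    Measure.map_apply (by fun_prop) (measurable_planeMap _ hs)]

theorem infDist_planeMap {n k : ℕ} (ζ : Grassmannian n k) (x : E n) (p : OrthGroup n × ζ.1ᗮ) :
    Metric.infDist x ((planeMap ζ p).plane : Set (E n)) =
      perpNorm ζ (orthInvApply p.1 x - p.2) := by
  have h1 : Metric.infDist x ((planeMap ζ p).plane : Set (E n)) =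
      perpNorm (rotate p.1 ζ) (x - orthApply p.1 (p.2 : E n)) := infDist_mk' _ _ _
  have h2 := perpNorm_rotate p.1 ζ (x - orthApply p.1 (p.2 : E n))
  have h3 : star (p.1 : E n →L[ℝ] E n) (x - orthApply p.1 (p.2 : E n)) =
      orthInvApply p.1 x - p.2 := by
    have : star (p.1 : E n →L[ℝ] E n) (x - orthApply p.1 (p.2 : E n)) =
      orthInvApply p.1 (x - orthApply p.1 (p.2 : E n)) := by rw [orthInvApply]
    rw [this, orthInvApply_sub, orthInvApply_orthApply]
  rw [h1, h2, h3]

/-- The point `u (x + v)` of the plane with parameters `(u, v)`. -/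
noncomputable def planePoint {n k : ℕ} (ζ : Grassmannian n k)
    (q : (OrthGroup n × ζ.1ᗮ) × ζ.1) : E n :=
  orthApply q.1.1 ((q.2 : E n) + q.1.2)

/-- Moving along the plane changes `x - y` only by a vector of the direction `u ζ`, so the distance
does not depend on the component in `ζ`. -/
theorem orbitPerp_sub_planePoint {n k : ℕ} (ζ : Grassmannian n k) (x : E n)
    (q : (OrthGroup n × ζ.1ᗮ) × ζ.1) :
    orbitPerp ζ q.1.1 (x - planePoint ζ q) = perpNorm ζ (orthInvApply q.1.1 x - q.1.2) := by
  rw [orbitPerp, orthInvApply_sub, planePoint, orthInvApply_orthApply]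
  have : orthInvApply q.1.1 x - ((q.2 : E n) + q.1.2) =
      ((-q.2 : ζ.1) : E n) + (orthInvApply q.1.1 x - q.1.2) := by
    rw [Submodule.coe_neg]; abel
  rw [this, perpNorm_add]

/-- For fixed `u`, the orthogonal sum `ζᗮ × ζ → ℝⁿ` followed by the isometry `u` preserves volume; a
skew product over `u` does the rest. -/
theorem measurePreserving_planePoint {n k : ℕ} (ζ : Grassmannian n k) :
    MeasurePreserving (fun q : (OrthGroup n × ζ.1ᗮ) × ζ.1 => (q.1.1, planePoint ζ q))
      (((orthHaar n).prod volume).prod volume) ((orthHaar n).prod volume) := by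
  have h1 := measurePreserving_prodAssoc (orthHaar n) (volume : Measure ζ.1ᗮ)
    (volume : Measure ζ.1)
  have h2 : MeasurePreserving (fun p : OrthGroup n × (ζ.1ᗮ × ζ.1) =>
      (p.1, orthApply p.1 ((p.2.2 : E n) + p.2.1)))
      ((orthHaar n).prod (volume.prod volume)) ((orthHaar n).prod volume) := by
    refine (MeasurePreserving.id (orthHaar n)).skew_product
      (g := fun u (p : ζ.1ᗮ × ζ.1) => orthApply u ((p.2 : E n) + p.1)) ?_ ?_
    · have h : Continuous fun p : OrthGroup n × (ζ.1ᗮ × ζ.1) =>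
          (p.1, (p.2.2 : E n) + p.2.1) :=
        continuous_fst.prodMk ((continuous_subtype_val.comp (continuous_snd.comp continuous_snd)).add
          (continuous_subtype_val.comp (continuous_fst.comp continuous_snd)))
      exact ((continuous_orthApply n).comp h).measurable
    · refine ae_of_all _ fun u => ?_
      have h3 := (measurePreserving_orthApply u).comp
        ((measurePreserving_add_orthogonal ζ.1).comp
          (Measure.measurePreserving_swap (μ := (volume : Measure ζ.1ᗮ))
            (ν := (volume : Measure ζ.1))))
      exact h3.map_eq
  exact h2.comp h1

section Transforms

variable {𝕜 : Type*} [RCLike 𝕜]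

theorem measurePreserving_rotateIso {n k : ℕ} (u : OrthGroup n) (ζ : Grassmannian n k) :
    MeasurePreserving (rotateIso u ζ) := (rotateIso u ζ).measurePreserving

theorem measurableEmbedding_rotateIso {n k : ℕ} (u : OrthGroup n) (ζ : Grassmannian n k) :
    MeasurableEmbedding (rotateIso u ζ) :=
  (rotateIso u ζ).toHomeomorph.measurableEmbedding

theorem rotateIso_add_foot {n k : ℕ} (ζ : Grassmannian n k) (p : OrthGroup n × ζ.1ᗮ) (x : ζ.1) :
    (rotateIso p.1 ζ x : E n) + (planeMap ζ p).foot = planePoint ζ (p, x) := by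
  rw [rotateIso_apply, planePoint]
  have : (planeMap ζ p).foot = orthApply p.1 (p.2 : E n) := rfl
  rw [this]
  simp only [orthApply]
  exact (map_add _ _ _).symm

theorem radon_planeMap {n k : ℕ} (ζ : Grassmannian n k) (f : E n → 𝕜) (p : OrthGroup n × ζ.1ᗮ) :
    radon f (planeMap ζ p) = ∫ x : ζ.1, f (planePoint ζ (p, x)) := by
  have h := (measurePreserving_rotateIso p.1 ζ).integral_comp
    (measurableEmbedding_rotateIso p.1 ζ)
    (fun x : (rotate p.1 ζ).1 => f ((x : E n) + (planeMap ζ p).foot))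
  simp_rw [rotateIso_add_foot] at h
  exact h.symm

theorem integrable_planeMap_iff {n k : ℕ} (ζ : Grassmannian n k) (f : E n → 𝕜)
    (p : OrthGroup n × ζ.1ᗮ) :
    (Integrable fun x : (planeMap ζ p).dir => f ((x : E n) + (planeMap ζ p).foot)) ↔
      Integrable fun x : ζ.1 => f (planePoint ζ (p, x)) := by
  have h := (measurePreserving_rotateIso p.1 ζ).integrable_comp_emb
    (measurableEmbedding_rotateIso p.1 ζ)
    (g := fun x : (rotate p.1 ζ).1 => f ((x : E n) + (planeMap ζ p).foot))
  rw [← iff_comm] at h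
  have e : ((fun x : (rotate p.1 ζ).1 => f ((x : E n) + (planeMap ζ p).foot)) ∘
      rotateIso p.1 ζ) = fun x : ζ.1 => f (planePoint ζ (p, x)) := by
    funext x
    simp only [Function.comp_apply, rotateIso_add_foot]
  rw [e] at h
  exact h

theorem ae_planeMap_iff {n k : ℕ} (ζ : Grassmannian n k) (s : Set (E n))
    (p : OrthGroup n × ζ.1ᗮ) :
    (∀ᵐ x : (planeMap ζ p).dir, (x : E n) + (planeMap ζ p).foot ∈ s) ↔
      ∀ᵐ x : ζ.1, planePoint ζ (p, x) ∈ s := by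
  have h := (measurePreserving_rotateIso p.1 ζ).map_eq
  have h2 := (measurableEmbedding_rotateIso p.1 ζ).ae_map_iff (μ := volume)
    (p := fun x : (rotate p.1 ζ).1 => (x : E n) + (planeMap ζ p).foot ∈ s)
  rw [h] at h2
  simp_rw [rotateIso_add_foot] at h2
  exact h2

theorem measurable_planePoint {n k : ℕ} (ζ : Grassmannian n k) : Measurable (planePoint ζ) :=
  measurable_snd.comp (measurePreserving_planePoint ζ).measurable

/-- A set of full measure contains almost every point of almost every plane. -/
theorem ae_ae_mem_plane {n k : ℕ} (hk : k ≤ n) {s : Set (E n)} (hs : MeasurableSet s)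
    (h : ∀ᵐ x, x ∈ s) :
    ∀ᵐ τ : AffineGrassmannian n k ∂affineMeasure hk, ∀ᵐ x : τ.dir, (x : E n) + τ.foot ∈ s := by
  set ζ := coordSubspace hk
  have hpre : planeMap ζ ⁻¹' {τ : AffineGrassmannian n k | ∀ᵐ x : τ.dir, (x : E n) + τ.foot ∈ s} =
      {p | (volume : Measure ζ.1) (Prod.mk p ⁻¹' (planePoint ζ ⁻¹' s)ᶜ) = 0} := by
    ext p
    exact ae_planeMap_iff ζ s p
  -- Needed to test an almost everywhere statement for an image measure on its preimage.
  have hm : MeasurableSet {τ : AffineGrassmannian n k | ∀ᵐ x : τ.dir, (x : E n) + τ.foot ∈ s} := by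
    rw [← measurableSet_preimage_planeMap_iff ζ, hpre]
    exact measurable_measure_prodMk_left (measurable_planePoint ζ hs).compl
      (measurableSet_singleton 0)
  rw [affineMeasure_eq_map, ae_map_iff (measurable_planeMap ζ).aemeasurable hm]
  have h1 : ∀ᵐ q ∂(orthHaar n).prod (volume : Measure (E n)), q.2 ∈ s :=
    Measure.quasiMeasurePreserving_snd.ae h
  have h2 := (measurePreserving_planePoint ζ).quasiMeasurePreserving.ae h1
  filter_upwards [Measure.ae_ae_of_ae_prod h2] with p hp
  exact (ae_planeMap_iff ζ s p).2 hp

end Transforms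

/-! ### The wavelet-like transform of `f̂` as a convolution. -/

section Wavelet

variable {𝕜 : Type*} [RCLike 𝕜]

/-- The integrand of the wavelet-like transform of `f̂`, after unfolding the `k`-plane transform
of `f`. -/
noncomputable def orbitIntegrand {n k : ℕ} (ζ : Grassmannian n k) (w : ℝ → ℝ) (f : E n → 𝕜)
    (a : ℝ) (x : E n) (q : OrthGroup n × E n) : 𝕜 :=
  w (orbitPerp ζ q.1 (x - q.2) / a) • f q.2

theorem measurable_orbitPerp_sub_div {n k : ℕ} (ζ : Grassmannian n k) (a : ℝ) (x : E n) :
    Measurable fun q : OrthGroup n × E n => orbitPerp ζ q.1 (x - q.2) / a := by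
  have h : Measurable fun q : OrthGroup n × E n => (q.1, x - q.2) :=
    measurable_fst.prodMk (measurable_snd.const_sub x)
  exact ((measurable_orbitPerp ζ).comp h).div_const a

theorem measurable_orbitIntegrand {n k : ℕ} (ζ : Grassmannian n k) {w : ℝ → ℝ}
    (hw : Measurable w) {f : E n → 𝕜} (hf : Measurable f) (a : ℝ) (x : E n) :
    Measurable (orbitIntegrand ζ w f a x) :=
  (hw.comp (measurable_orbitPerp_sub_div ζ a x)).smul (hf.comp measurable_snd)

/-- The distance is constant along the plane, so the factor `w` moves under the integral. This needs
no integrability of `f` on the plane. -/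
theorem waveletIntegrand_planeMap {n k : ℕ} (ζ : Grassmannian n k) (w : ℝ → ℝ) (f : E n → 𝕜)
    (a : ℝ) (x : E n) (p : OrthGroup n × ζ.1ᗮ) :
    waveletIntegrand w (radon f) a x (planeMap ζ p) =
      ∫ y : ζ.1, orbitIntegrand ζ w f a x (p.1, planePoint ζ (p, y)) := by
  rw [waveletIntegrand, infDist_planeMap, radon_planeMap, ← integral_smul]
  refine integral_congr_ae (ae_of_all _ fun y => ?_)
  simp only [orbitIntegrand]
  rw [orbitPerp_sub_planePoint ζ x (p, y)]

theorem integrable_waveletIntegrand {n k : ℕ} (hk : k ≤ n) {w : ℝ → ℝ} (hw : Measurable w)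
    {f : E n → 𝕜} (hf : Measurable f) {a : ℝ} {x : E n}
    (hi : Integrable (orbitIntegrand (coordSubspace hk) w f a x) ((orthHaar n).prod volume)) :
    Integrable (waveletIntegrand w (radon f) a x) (affineMeasure hk) ∧
    ∫ τ, waveletIntegrand w (radon f) a x τ ∂affineMeasure hk =
      ∫ q, orbitIntegrand (coordSubspace hk) w f a x q ∂((orthHaar n).prod volume) := by
  set ζ := coordSubspace hk
  set Θ : (OrthGroup n × ζ.1ᗮ) × ζ.1 → OrthGroup n × E n := fun q => (q.1.1, planePoint ζ q)
  have hΘ : MeasurePreserving Θ (((orthHaar n).prod volume).prod volume)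
      ((orthHaar n).prod volume) := measurePreserving_planePoint ζ
  have hm := measurable_orbitIntegrand ζ hw hf a x
  have hmΘ : Measurable fun q => orbitIntegrand ζ w f a x (Θ q) := hm.comp hΘ.measurable
  have hcomp : waveletIntegrand w (radon f) a x ∘ planeMap ζ =
      fun p => ∫ y : ζ.1, orbitIntegrand ζ w f a x (Θ (p, y)) := by
    funext p
    exact waveletIntegrand_planeMap ζ w f a x p
  have hmw : Measurable (waveletIntegrand w (radon f) a x : AffineGrassmannian n k → 𝕜) := by
    rw [← measurable_comp_planeMap_iff ζ, hcomp]
    exact hmΘ.stronglyMeasurable.integral_prod_right'.measurable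
  have hi' : Integrable (fun q => orbitIntegrand ζ w f a x (Θ q))
      (((orthHaar n).prod volume).prod volume) := hΘ.integrable_comp_of_integrable hi
  rw [affineMeasure_eq_map]
  constructor
  · rw [integrable_map_measure hmw.aestronglyMeasurable (measurable_planeMap ζ).aemeasurable,
      hcomp]
    exact hi'.integral_prod_left
  · rw [integral_map (measurable_planeMap ζ).aemeasurable hmw.aestronglyMeasurable]
    have e1 : ∫ p, waveletIntegrand w (radon f) a x (planeMap ζ p)
        ∂(orthHaar n).prod (volume : Measure ζ.1ᗮ) =
        ∫ p, (∫ y : ζ.1, orbitIntegrand ζ w f a x (Θ (p, y)))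
          ∂(orthHaar n).prod (volume : Measure ζ.1ᗮ) :=
      congrArg (fun F => ∫ p, F p ∂(orthHaar n).prod (volume : Measure ζ.1ᗮ)) hcomp
    rw [e1, ← integral_prod _ hi', ← hΘ.map_eq,
      integral_map hΘ.measurable.aemeasurable hm.aestronglyMeasurable]

theorem orbitPerp_div {n k : ℕ} (ζ : Grassmannian n k) {a : ℝ} (ha : 0 < a) (u : OrthGroup n)
    (y : E n) : orbitPerp ζ u y / a = orbitPerp ζ u (a⁻¹ • y) := by
  rw [orbitPerp, orbitPerp, orthInvApply_smul, perpNorm, perpNorm, map_smul, ← smul_sub,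
    norm_smul, Real.norm_of_nonneg (inv_nonneg.2 ha.le), div_eq_inv_mul]

theorem quasiMeasurePreserving_dilate {n : ℕ} {a : ℝ} (ha : 0 < a) (x : E n) :
    Measure.QuasiMeasurePreserving (fun y : E n => a⁻¹ • (x - y)) volume volume :=
  (Measure.quasiMeasurePreserving_smul volume (inv_ne_zero ha.ne')).comp
    (Measure.measurePreserving_sub_left volume x).quasiMeasurePreserving

theorem sub_smul_inv_smul_sub {n : ℕ} {a : ℝ} (ha : 0 < a) (x y : E n) :
    x - a • a⁻¹ • (x - y) = y := by
  rw [smul_inv_smul₀ ha.ne', sub_sub_cancel]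

theorem integrable_dilate {n : ℕ} {a : ℝ} (ha : 0 < a) (x : E n) {G : Type*}
    [NormedAddCommGroup G] {h : E n → G} (hh : Integrable h) :
    Integrable fun y : E n => h (a⁻¹ • (x - y)) :=
  (hh.comp_smul (inv_ne_zero ha.ne')).comp_sub_left x

theorem integral_dilate {n : ℕ} {a : ℝ} (ha : 0 < a) (x : E n) (h : E n → 𝕜) :
    ∫ y : E n, h (a⁻¹ • (x - y)) = a ^ n • ∫ z : E n, h z := by
  rw [integral_sub_left_eq_self (fun y => h (a⁻¹ • y)) volume x,
    Measure.integral_comp_inv_smul_of_nonneg volume h ha.le, finrank_euclideanSpace_fin]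

/-- Integrating first over `u`, the weight dominating `|w|` averages to at most a multiple of the
tail kernel at `(x - y) / a`. Hypothesis `ht` is the remaining integral over `y`, after dilation. -/
theorem integrable_orbitIntegrand {n k : ℕ} (h1 : 1 ≤ k) (hk : k < n) (ζ : Grassmannian n k)
    {w : ℝ → ℝ} (hw : Measurable w) {C : ℝ} (hC : ∀ s, |w s| ≤ C * abelWeight n k s)
    {f : E n → 𝕜} (hf : Measurable f) {a : ℝ} (ha : 0 < a) (x : E n)
    (ht : Integrable fun z : E n => tailKernel n k ‖z‖ * ‖f (x - a • z)‖) :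
    Integrable (orbitIntegrand ζ w f a x) ((orthHaar n).prod volume) := by
  obtain ⟨C', hC', hb⟩ := exists_abelMean_abelWeight_le h1 hk
  have hm := measurable_orbitIntegrand ζ hw hf a x
  refine ⟨hm.aestronglyMeasurable, ?_⟩
  have hd := (integrable_dilate ha x ht).const_mul C'
  simp_rw [sub_smul_inv_smul_sub ha] at hd
  have hae := (quasiMeasurePreserving_dilate ha x).ae
    (ae_lintegral_orbitPerp h1 hk ζ (measurable_abelWeight n k).ennreal_ofReal)
  rw [hasFiniteIntegral_iff_enorm, lintegral_prod_symm' _ hm.enorm]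
  have hle : ∀ᵐ y : E n, ∫⁻ u, ‖orbitIntegrand ζ w f a x (u, y)‖ₑ ∂orthHaar n ≤
      ENNReal.ofReal C *
        ENNReal.ofReal (C' * (tailKernel n k ‖a⁻¹ • (x - y)‖ * ‖f y‖)) := by
    filter_upwards [hae] with y hy
    have hpt : ∀ u, ‖orbitIntegrand ζ w f a x (u, y)‖ₑ ≤ ENNReal.ofReal C *
        ENNReal.ofReal (abelWeight n k (orbitPerp ζ u (a⁻¹ • (x - y)))) * ‖f y‖ₑ := by
      intro u
      simp only [orbitIntegrand]
      rw [enorm_smul, orbitPerp_div ζ ha]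
      refine mul_le_mul_left ?_ _
      rw [← ENNReal.ofReal_mul' (abelWeight_nonneg _ _ _), Real.enorm_eq_ofReal_abs]
      exact ENNReal.ofReal_le_ofReal (hC _)
    refine (lintegral_mono hpt).trans ?_
    have hmu : Measurable fun u : OrthGroup n =>
        ENNReal.ofReal (abelWeight n k (orbitPerp ζ u (a⁻¹ • (x - y)))) :=
      ((measurable_abelWeight n k).comp (measurable_orbitPerp_left ζ _)).ennreal_ofReal
    rw [lintegral_mul_const _ (hmu.const_mul _), lintegral_const_mul _ hmu, hy, mul_assoc]
    refine mul_le_mul_right ?_ _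
    refine (mul_le_mul_left (hb _ (norm_nonneg _)) _).trans (le_of_eq ?_)
    rw [← ofReal_norm, ← ENNReal.ofReal_mul
      (mul_nonneg hC' (tailKernel_nonneg _ _ _)), mul_assoc]
  refine (lintegral_mono_ae hle).trans_lt ?_
  rw [lintegral_const_mul' _ _ ENNReal.ofReal_ne_top]
  exact ENNReal.mul_lt_top ENNReal.ofReal_lt_top hd.lintegral_lt_top

/-- The representation of the wavelet-like transform of `f̂` as an approximate identity. -/
theorem wavelet_radon_of_measurable {n k : ℕ} (h1 : 1 ≤ k) (hk : k < n) {w ψ : ℝ → ℝ}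
    (hw : Measurable w) {C : ℝ} (hC : ∀ s, |w s| ≤ C * abelWeight n k s)
    (hsol : SolvesAbel n k w ψ) {f : E n → 𝕜} (hf : Measurable f) {a : ℝ} (ha : 0 < a) (x : E n)
    (ht : Integrable fun z : E n => tailKernel n k ‖z‖ * ‖f (x - a • z)‖) :
    Integrable (waveletIntegrand w (radon f) a x) (affineMeasure hk.le) ∧
    wavelet hk.le w (radon f) a x = ∫ y : E n, ψ ‖y‖ • f (x - a • y) := by
  set ζ := coordSubspace hk.le
  have hi := integrable_orbitIntegrand h1 hk ζ hw hC hf ha x ht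
  obtain ⟨h2, h3⟩ := integrable_waveletIntegrand hk.le hw hf hi
  refine ⟨h2, ?_⟩
  -- The exceptional null set lies in the variable of integration `y`, so the resulting formula
  -- holds at every `x`.
  have hae := (quasiMeasurePreserving_dilate ha x).ae (ae_integral_orbitPerp h1 hk ζ hw hsol)
  have e : ∀ᵐ y : E n, ∫ u, orbitIntegrand ζ w f a x (u, y) ∂orthHaar n =
      ψ ‖a⁻¹ • (x - y)‖ • f (x - a • a⁻¹ • (x - y)) := by
    filter_upwards [hae] with y hy
    simp only [orbitIntegrand]
    simp_rw [orbitPerp_div ζ ha]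
    rw [integral_smul_const, hy, sub_smul_inv_smul_sub ha]
  rw [wavelet, h3, integral_prod_symm _ hi, integral_congr_ae e,
    integral_dilate ha x (fun z => ψ ‖z‖ • f (x - a • z)), smul_smul, one_div,
    inv_mul_cancel₀ (by positivity), one_smul]

/-- Fubini's theorem for the positive weight at `x = 0` makes weight times `f` integrable on almost
every plane. On a plane at distance `‖v‖` from the origin the weight is constant, and nonzero once
`‖v‖ > a`. The scales `a = 1 / (m + 1)` cover all planes with `v ≠ 0`, which are almost all because
`k < n`. -/
theorem ae_integrable_plane_of_measurable {n k : ℕ} (h1 : 1 ≤ k) (hk : k < n)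
    {f : E n → 𝕜} (hf : Measurable f)
    (ht : ∀ a : ℝ, 0 < a → Integrable fun z : E n => tailKernel n k ‖z‖ * ‖f (0 - a • z)‖) :
    ∀ᵐ τ : AffineGrassmannian n k ∂affineMeasure hk.le,
      Integrable fun x : τ.dir => f ((x : E n) + τ.foot) := by
  set ζ := coordSubspace hk.le
  have hpre : planeMap ζ ⁻¹' {τ : AffineGrassmannian n k |
      Integrable fun x : τ.dir => f ((x : E n) + τ.foot)} =
      {p | Integrable (fun x : ζ.1 => f (planePoint ζ (p, x)))} := by
    ext p
    exact integrable_planeMap_iff ζ f p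
  have hm : MeasurableSet {τ : AffineGrassmannian n k |
      Integrable fun x : τ.dir => f ((x : E n) + τ.foot)} := by
    rw [← measurableSet_preimage_planeMap_iff ζ, hpre]
    exact measurableSet_integrable (hf.comp (measurable_planePoint ζ)).stronglyMeasurable
  rw [affineMeasure_eq_map, ae_map_iff (measurable_planeMap ζ).aemeasurable hm]
  have : Nontrivial ζ.1ᗮ :=
    Module.nontrivial_of_finrank_pos (R := ℝ) (by rw [finrank_orthogonal ζ]; omega)
  have hne : ∀ᵐ p ∂(orthHaar n).prod (volume : Measure ζ.1ᗮ), p.2 ≠ 0 :=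
    Measure.quasiMeasurePreserving_snd.ae (Measure.ae_ne volume 0)
  have hint : ∀ᵐ p ∂(orthHaar n).prod (volume : Measure ζ.1ᗮ), ∀ m : ℕ,
      Integrable fun y : ζ.1 =>
        orbitIntegrand ζ (abelWeight n k) f (1 / (m + 1)) 0 (p.1, planePoint ζ (p, y)) := by
    rw [ae_all_iff]
    intro m
    have ha : (0 : ℝ) < 1 / (m + 1) := by positivity
    have hi := integrable_orbitIntegrand h1 hk ζ (measurable_abelWeight n k) (C := 1)
      (fun s => by rw [one_mul, abs_of_nonneg (abelWeight_nonneg n k s)]) hf ha 0 (ht _ ha)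
    exact ((measurePreserving_planePoint ζ).integrable_comp_of_integrable hi).prod_right_ae
  filter_upwards [hne, hint] with p hp hq
  refine (integrable_planeMap_iff ζ f p).2 ?_
  have hv : 0 < ‖p.2‖ := norm_pos_iff.2 hp
  obtain ⟨m, hm⟩ := exists_nat_one_div_lt hv
  have hq := hq m
  set c := abelWeight n k (‖p.2‖ / (1 / ((m : ℝ) + 1)))
  have hc : 0 < c := abelWeight_pos ((one_lt_div (by positivity)).2 hm)
  have e : ∀ y : ζ.1, orbitIntegrand ζ (abelWeight n k) f (1 / (m + 1)) 0
      (p.1, planePoint ζ (p, y)) = c • f (planePoint ζ (p, y)) := by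
    intro y
    simp only [orbitIntegrand]
    rw [orbitPerp_sub_planePoint ζ 0 (p, y)]
    have h0 : orthInvApply p.1 0 - (p.2 : E n) = ((-p.2 : ζ.1ᗮ) : E n) := by
      rw [orthInvApply, map_zero, zero_sub, Submodule.coe_neg]
    rw [h0, perpNorm_of_mem_orthogonal, Submodule.coe_neg, norm_neg]
    rfl
  simp_rw [e] at hq
  have := hq.smul c⁻¹
  refine this.congr (ae_of_all _ fun y => ?_)
  simp only [Pi.smul_apply]
  rw [smul_smul, inv_mul_cancel₀ hc.ne', one_smul]

/-- The conclusions on the transforms for measurable functions, up to the integrability of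
`f` against the kernels. -/
theorem wavelet_radon {n k : ℕ} (h1 : 1 ≤ k) (hk : k < n) {w ψ : ℝ → ℝ}
    (hw : Measurable w) {C : ℝ} (hC : ∀ s, |w s| ≤ C * abelWeight n k s)
    (hsol : SolvesAbel n k w ψ) {f : E n → 𝕜} (hf : AEStronglyMeasurable f)
    (ht : ∀ a : ℝ, 0 < a → ∀ x : E n,
      Integrable fun z : E n => tailKernel n k ‖z‖ * ‖f (x - a • z)‖) :
    (∀ᵐ τ : AffineGrassmannian n k ∂affineMeasure hk.le,
      Integrable fun x : τ.dir => f ((x : E n) + τ.foot)) ∧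
    ∀ a : ℝ, 0 < a → ∀ x : E n,
      Integrable (waveletIntegrand w (radon f) a x) (affineMeasure hk.le) ∧
      wavelet hk.le w (radon f) a x = ∫ y : E n, ψ ‖y‖ • f (x - a • y) := by
  set g := hf.mk f
  have hg : Measurable g := hf.stronglyMeasurable_mk.measurable
  have hfg : f =ᵐ[volume] g := hf.ae_eq_mk
  -- Off this null Borel set `f` equals its measurable version `g`. Almost every plane meets the set
  -- in a null set, so `f̂ = ĝ` almost everywhere.
  obtain ⟨s, hsub, hs, hs0⟩ := exists_measurable_superset_of_null hfg
  have hsae : ∀ᵐ x : E n, x ∈ sᶜ := by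
    rw [ae_iff]
    simpa using hs0
  have heq : ∀ x ∈ sᶜ, f x = g x := by
    intro x hx
    by_contra h
    exact hx (hsub h)
  have hplane := ae_ae_mem_plane hk.le hs.compl hsae
  have htr : ∀ a : ℝ, 0 < a → ∀ x : E n, ∀ᵐ z : E n, f (x - a • z) = g (x - a • z) := by
    intro a ha x
    have hq : Measure.QuasiMeasurePreserving (fun z : E n => x - a • z) volume volume :=
      (Measure.measurePreserving_sub_left volume x).quasiMeasurePreserving.comp
        (Measure.quasiMeasurePreserving_smul volume ha.ne')
    exact hq.ae hfg
  have htg : ∀ a : ℝ, 0 < a → ∀ x : E n,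
      Integrable fun z : E n => tailKernel n k ‖z‖ * ‖g (x - a • z)‖ := by
    intro a ha x
    refine (ht a ha x).congr ?_
    filter_upwards [htr a ha x] with z hz
    rw [hz]
  have hrad : ∀ᵐ τ : AffineGrassmannian n k ∂affineMeasure hk.le, radon f τ = radon g τ := by
    filter_upwards [hplane] with τ hτ
    refine integral_congr_ae ?_
    filter_upwards [hτ] with x hx using heq _ hx
  constructor
  · filter_upwards [hplane, ae_integrable_plane_of_measurable h1 hk hg (fun a ha => htg a ha 0)]
      with τ hτ hi
    refine hi.congr ?_
    filter_upwards [hτ] with x hx using (heq _ hx).symm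
  · intro a ha x
    obtain ⟨h2, h3⟩ := wavelet_radon_of_measurable h1 hk hw hC hsol hg ha x (htg a ha x)
    have hwi : waveletIntegrand w (radon g) a x =ᵐ[affineMeasure hk.le]
        waveletIntegrand w (radon f) a x := by
      filter_upwards [hrad] with τ hτ
      rw [waveletIntegrand, waveletIntegrand, hτ]
    refine ⟨h2.congr hwi, ?_⟩
    rw [wavelet, ← integral_congr_ae hwi, ← wavelet, h3]
    refine integral_congr_ae ?_
    filter_upwards [htr a ha x] with z hz
    rw [hz]

end Wavelet

/-! ### The function `ψ` -/

/-- For `r > 1` one has `1 + r ≤ 2 r`. The right side has no cutoff and is decreasing on `[0, ∞)`,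
so it serves as a majorant. -/
theorem inv_pow_le_one_add_rpow {r : ℝ} (hr : 1 < r) (m : ℕ) :
    (r ^ m)⁻¹ ≤ 2 ^ m * (1 + r) ^ (-(m : ℝ)) := by
  have h0 : 0 < 1 + r := by linarith
  rw [Real.rpow_neg h0.le, Real.rpow_natCast, ← div_eq_mul_inv, le_div_iff₀ (by positivity),
    inv_mul_le_iff₀ (by positivity), ← mul_pow]
  exact pow_le_pow_left₀ h0.le (by linarith) m

theorem measurable_psi (n ℓ : ℕ) : Measurable (psi n ℓ) :=
  Measurable.ite measurableSet_Iic measurable_const (by fun_prop)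

theorem psi_pos {n ℓ : ℕ} {r : ℝ} (hr : 1 < r) : 0 < psi n ℓ r := by
  have h : 0 < r ^ 2 - 1 := by nlinarith
  rw [psi, if_neg (not_le.2 hr)]
  positivity

theorem psi_nonneg (n ℓ : ℕ) (r : ℝ) : 0 ≤ psi n ℓ r := by
  rcases le_or_gt r 1 with h | h
  · simp [psi, h]
  · exact (psi_pos h).le

theorem psi_le_inv_pow {n ℓ : ℕ} {r : ℝ} (hr : 1 < r) : psi n ℓ r ≤ (r ^ (n + 1))⁻¹ := by
  have h : 0 ≤ r ^ 2 - 1 := by nlinarith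
  have h0 : 0 < r := by linarith
  rw [psi, if_neg (not_le.2 hr), div_le_iff₀ (by positivity),
    show n + 2 * ℓ + 1 = (n + 1) + 2 * ℓ by ring, pow_add r (n + 1),
    inv_mul_cancel_left₀ (by positivity), pow_mul]
  exact pow_le_pow_left₀ h (by linarith) ℓ

/-- Integrability against the tail kernel thus also yields absolute convergence of the convolution
with `ψ`. -/
theorem psi_le_tailKernel (n k ℓ : ℕ) (r : ℝ) : psi n ℓ r ≤ tailKernel n k r := by
  rcases le_or_gt r 1 with h | h
  · simp [psi, tailKernel, h]
  · refine (psi_le_inv_pow h).trans ?_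
    rw [tailKernel, if_neg (not_le.2 h)]
    have h0 : 0 < r := by linarith
    gcongr
    · exact h.le
    · omega

theorem psi_le_one_add_rpow (n ℓ : ℕ) {r : ℝ} (hr : 0 ≤ r) :
    psi n ℓ r ≤ 2 ^ (n + 1) * (1 + r) ^ (-((n : ℝ) + 1)) := by
  rcases le_or_gt r 1 with h | h
  · simp only [psi, h, if_true]
    positivity
  · have := (psi_le_inv_pow (n := n) (ℓ := ℓ) h).trans (inv_pow_le_one_add_rpow h (n + 1))
    push_cast at this
    exact this

theorem tailKernel_le_one_add_rpow (n k : ℕ) {r : ℝ} (hr : 0 ≤ r) :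
    tailKernel n k r ≤ 2 ^ (n - k) * (1 + r) ^ (-((n - k : ℕ) : ℝ)) := by
  rcases le_or_gt r 1 with h | h
  · simp only [tailKernel, h, if_true]
    positivity
  · rw [tailKernel, if_neg (not_le.2 h)]
    exact inv_pow_le_one_add_rpow h _

theorem tailKernel_le_one (n k : ℕ) (r : ℝ) : tailKernel n k r ≤ 1 := by
  rcases le_or_gt r 1 with h | h
  · simp [tailKernel, h]
  · rw [tailKernel, if_neg (not_le.2 h)]
    exact inv_le_one_of_one_le₀ (one_le_pow₀ h.le)

theorem integrable_psi (n ℓ : ℕ) : Integrable fun y : E n => psi n ℓ ‖y‖ := by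
  have h : Integrable fun y : E n => 2 ^ (n + 1) * (1 + ‖y‖) ^ (-((n : ℝ) + 1)) :=
    (integrable_one_add_norm (by simp)).const_mul _
  refine h.mono ((measurable_psi n ℓ).comp measurable_norm).aestronglyMeasurable
    (ae_of_all _ fun y => ?_)
  have := psi_le_one_add_rpow n ℓ (norm_nonneg y)
  have h0 := psi_nonneg n ℓ ‖y‖
  rw [Real.norm_of_nonneg h0, Real.norm_of_nonneg (h0.trans this)]
  exact this

theorem hasDecreasingMajorant_psi (n ℓ : ℕ) : HasDecreasingMajorant n (psi n ℓ) := by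
  refine ⟨fun r => 2 ^ (n + 1) * (1 + r) ^ (-((n : ℝ) + 1)), ?_, fun r hr => ?_,
    (integrable_one_add_norm (by simp)).const_mul _⟩
  · intro r hr s hs hrs
    have hr : 0 ≤ r := hr
    have : (1 + s) ^ (-((n : ℝ) + 1)) ≤ (1 + r) ^ (-((n : ℝ) + 1)) :=
      Real.rpow_le_rpow_of_nonpos (by linarith) (by linarith)
        (by have : (0 : ℝ) ≤ n := n.cast_nonneg
            linarith)
    show 2 ^ (n + 1) * (1 + s) ^ (-((n : ℝ) + 1)) ≤ 2 ^ (n + 1) * (1 + r) ^ (-((n : ℝ) + 1))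
    gcongr
  · rw [abs_of_nonneg (psi_nonneg n ℓ r)]
    exact psi_le_one_add_rpow n ℓ hr

theorem totalMass_psi_pos {n : ℕ} (hn : n ≠ 0) (ℓ : ℕ) : 0 < totalMass n (psi n ℓ) := by
  have : Nonempty (Fin n) := ⟨⟨0, Nat.pos_of_ne_zero hn⟩⟩
  rw [totalMass, integral_pos_iff_support_of_nonneg (fun y => psi_nonneg n ℓ ‖y‖)
    (integrable_psi n ℓ)]
  have ho : IsOpen {y : E n | 1 < ‖y‖} := isOpen_lt continuous_const continuous_norm
  obtain ⟨y, hy⟩ := NormedSpace.exists_lt_norm ℝ (E n) 1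
  exact (ho.measure_pos volume ⟨y, hy⟩).trans_le (measure_mono fun z hz => (psi_pos hz).ne')

/-! ### Integrability against the tail kernel -/

section Tail

variable {𝕜 : Type*} [RCLike 𝕜]

theorem quasiMeasurePreserving_sub_smul {n : ℕ} {a : ℝ} (ha : a ≠ 0) (x : E n) :
    Measure.QuasiMeasurePreserving (fun z : E n => x - a • z) volume volume :=
  (Measure.measurePreserving_sub_left volume x).quasiMeasurePreserving.comp
    (Measure.quasiMeasurePreserving_smul volume ha)

theorem memLp_sub_smul {n : ℕ} {a : ℝ} (ha : a ≠ 0) (x : E n) {p : ℝ≥0∞}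
    {f : E n → 𝕜} (hf : MemLp f p volume) : MemLp (fun z : E n => f (x - a • z)) p volume := by
  have h1 : MemLp (fun y : E n => f (x - y)) p volume :=
    hf.comp_measurePreserving (Measure.measurePreserving_sub_left volume x)
  refine MemLp.comp_of_map (f := fun z : E n => a • z) (g := fun y : E n => f (x - y)) ?_
    (by fun_prop)
  rw [Measure.map_addHaar_smul _ ha]
  exact h1.smul_measure ENNReal.ofReal_ne_top

/-- For `p' = p / (p - 1)`, the integrability condition `(n - k) p' > n` is equivalent to `p < n /
k`. -/
theorem memLp_tailKernel {n k : ℕ} (hk : k < n) (h1 : 1 ≤ k) {p : ℝ} (hp : 1 < p)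
    (hpn : p < (n : ℝ) / k) :
    MemLp (fun z : E n => tailKernel n k ‖z‖) (ENNReal.ofReal (p / (p - 1))) volume := by
  have hk0 : (0 : ℝ) < k := by exact_mod_cast h1
  have hp1 : 0 < p - 1 := by linarith
  have hq : 0 < p / (p - 1) := by positivity
  rw [lt_div_iff₀ hk0] at hpn
  have hm : AEStronglyMeasurable (fun z : E n => tailKernel n k ‖z‖) volume :=
    ((measurable_tailKernel n k).comp measurable_norm).aestronglyMeasurable
  refine MemLp.mono (g := fun z : E n => 2 ^ (n - k) * (1 + ‖z‖) ^ (-((n - k : ℕ) : ℝ))) ?_ hm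
    (ae_of_all _ fun z => ?_)
  · refine MemLp.const_mul ?_ _
    rw [← integrable_norm_rpow_iff (by
        refine Measurable.aestronglyMeasurable ?_
        fun_prop) (by simpa using hq) ENNReal.ofReal_ne_top,
      ENNReal.toReal_ofReal hq.le]
    have : ∀ z : E n, ‖(1 + ‖z‖) ^ (-((n - k : ℕ) : ℝ))‖ ^ (p / (p - 1)) =
        (1 + ‖z‖) ^ (-(((n - k : ℕ) : ℝ) * (p / (p - 1)))) := by
      intro z
      have h0 : 0 ≤ 1 + ‖z‖ := by positivity
      rw [Real.norm_of_nonneg (by positivity), ← Real.rpow_mul h0, neg_mul]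
    simp_rw [this]
    refine integrable_one_add_norm ?_
    rw [finrank_euclideanSpace_fin, Nat.cast_sub hk.le, ← mul_div_assoc, lt_div_iff₀ hp1]
    nlinarith
  · have := tailKernel_le_one_add_rpow n k (norm_nonneg z)
    have h0 := tailKernel_nonneg n k ‖z‖
    rw [Real.norm_of_nonneg h0, Real.norm_of_nonneg (h0.trans this)]
    exact this

theorem integrable_tailKernel_mul {n k : ℕ} (hk : k < n) (h1 : 1 ≤ k) {p : ℝ} (hp : 1 ≤ p)
    (hpn : p < (n : ℝ) / k) {f : E n → 𝕜} (hf : MemLp f (ENNReal.ofReal p) volume)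
    {a : ℝ} (ha : a ≠ 0) (x : E n) :
    Integrable fun z : E n => tailKernel n k ‖z‖ * ‖f (x - a • z)‖ := by
  have hF : MemLp (fun z : E n => ‖f (x - a • z)‖) (ENNReal.ofReal p) volume :=
    (memLp_sub_smul ha x hf).norm
  -- For `p = 1` the conjugate exponent is infinite, and boundedness of the tail kernel replaces
  -- Hölder's inequality.
  rcases hp.eq_or_lt with rfl | hp
  · rw [ENNReal.ofReal_one, memLp_one_iff_integrable] at hF
    refine hF.bdd_mul (c := 1)
      ((measurable_tailKernel n k).comp measurable_norm).aestronglyMeasurable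
      (ae_of_all _ fun z => ?_)
    rw [Real.norm_of_nonneg (tailKernel_nonneg n k _)]
    exact tailKernel_le_one n k _
  · have hc : Real.HolderConjugate (p / (p - 1)) p :=
      (Real.HolderConjugate.conjExponent hp).symm
    have := hc.ennrealOfReal
    exact (memLp_tailKernel hk h1 hp hpn).integrable_mul hF

theorem integrable_psi_smul {n k : ℕ} (ℓ : ℕ) {f : E n → 𝕜} (hf : AEStronglyMeasurable f volume)
    {a : ℝ} (ha : a ≠ 0) {x : E n}
    (ht : Integrable fun z : E n => tailKernel n k ‖z‖ * ‖f (x - a • z)‖) :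
    Integrable fun y : E n => psi n ℓ ‖y‖ • f (x - a • y) := by
  refine ht.mono (((measurable_psi n ℓ).comp measurable_norm).aestronglyMeasurable.smul
    (hf.comp_quasiMeasurePreserving (quasiMeasurePreserving_sub_smul ha x)))
    (ae_of_all _ fun y => ?_)
  rw [norm_smul, norm_mul, norm_norm, Real.norm_of_nonneg (psi_nonneg n ℓ _),
    Real.norm_of_nonneg (tailKernel_nonneg n k _)]
  gcongr
  exact psi_le_tailKernel n k ℓ _

end Tail

/-! ### Approximate identities: uniform convergence -/

section Uniform

variable {𝕜 : Type*} [RCLike 𝕜] {n : ℕ} {K : E n → ℝ}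

/-- All three modes of convergence are proved by estimating this average of differences. -/
theorem integral_smul_sub_integral_smul (hK : Integrable K) {f : E n → 𝕜} {a : ℝ} {x : E n}
    (h : Integrable fun y : E n => K y • f (x - a • y)) :
    (∫ y : E n, K y • f (x - a • y)) - (∫ y, K y) • f x =
      ∫ y : E n, K y • (f (x - a • y) - f x) := by
  simp_rw [smul_sub]
  rw [integral_sub h (hK.smul_const _), integral_smul_const]

theorem tendstoUniformly_integral_smul (hK : Integrable K) {f : E n → 𝕜} (hf : Continuous f)
    (h0 : Tendsto f (cocompact (E n)) (𝓝 0)) :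
    TendstoUniformly (fun (a : ℝ) (x : E n) => ∫ y : E n, K y • f (x - a • y))
      (fun x => (∫ y, K y) • f x) (𝓝[>] 0) := by
  have huc : UniformContinuous f := hf.uniformContinuous_of_tendsto_cocompact h0
  obtain ⟨C, hC⟩ : ∃ C, ∀ x, ‖f x‖ ≤ C := by
    obtain ⟨C, hC⟩ := (ZeroAtInftyContinuousMap.isBounded_range
      (⟨⟨f, hf⟩, h0⟩ : ZeroAtInftyContinuousMap (E n) 𝕜)).exists_norm_le
    exact ⟨C, fun x => hC _ ⟨x, rfl⟩⟩
  have hi : ∀ (a : ℝ) (x : E n), Integrable fun y : E n => K y • f (x - a • y) := by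
    intro a x
    refine (hK.norm.mul_const C).mono (hK.1.smul (by fun_prop)) (ae_of_all _ fun y => ?_)
    rw [norm_smul, norm_mul, norm_norm]
    gcongr
    exact (hC _).trans (le_abs_self C)
  -- Uniform convergence in `x` is convergence along `𝓝[>] 0 ×ˢ ⊤`. This filter is countably
  -- generated, so dominated convergence applies, and uniform continuity of `f` gives the limit for
  -- each fixed `y`.
  rw [tendstoUniformly_iff_tendsto, tendsto_uniformity_iff_dist_tendsto_zero]
  have key : Tendsto (fun q : ℝ × E n => ∫ y : E n, K y • (f (q.2 - q.1 • y) - f q.2))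
      (𝓝[>] 0 ×ˢ ⊤) (𝓝 (∫ y : E n, (0 : 𝕜))) := by
    have : (𝓝[>] (0 : ℝ) ×ˢ (⊤ : Filter (E n))).IsCountablyGenerated := by infer_instance
    refine tendsto_integral_filter_of_dominated_convergence (fun y => ‖K y‖ * (2 * C))
      (Eventually.of_forall fun q => hK.1.smul (by fun_prop))
      (Eventually.of_forall fun q => ae_of_all _ fun y => ?_) (hK.norm.mul_const _)
      (ae_of_all _ fun y => ?_)
    · rw [norm_smul]
      gcongr
      linarith [norm_sub_le (f (q.2 - q.1 • y)) (f q.2), hC (q.2 - q.1 • y), hC q.2]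
    · suffices h : Tendsto (fun q : ℝ × E n => f (q.2 - q.1 • y) - f q.2)
          (𝓝[>] (0 : ℝ) ×ˢ ⊤) (𝓝 0) by
        simpa using h.const_smul (K y)
      rw [tendsto_zero_iff_norm_tendsto_zero]
      simp_rw [← dist_eq_norm]
      have h1 : Tendsto (fun q : ℝ × E n => (q.2 - q.1 • y, q.2)) (𝓝[>] (0 : ℝ) ×ˢ ⊤)
          (uniformity (E n)) := by
        rw [tendsto_uniformity_iff_dist_tendsto_zero]
        simp only [dist_eq_norm, sub_sub_cancel_left, norm_neg, norm_smul]
        have : Tendsto (fun q : ℝ × E n => q.1) (𝓝[>] (0 : ℝ) ×ˢ ⊤) (𝓝 0) :=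
          tendsto_fst.mono_right nhdsWithin_le_nhds
        simpa using this.norm.mul_const ‖y‖
      exact tendsto_uniformity_iff_dist_tendsto_zero.1 (Tendsto.comp huc h1)
  rw [integral_zero] at key
  have := key.norm
  rw [norm_zero] at this
  refine this.congr fun q => ?_
  rw [dist_comm, dist_eq_norm, ← integral_smul_sub_integral_smul hK (hi _ _)]

end Uniform

/-! ### Approximate identities: convergence in `Lᵖ` -/

section MeanConvergence

variable {𝕜 : Type*} [RCLike 𝕜] {n : ℕ} {K : E n → ℝ}

/-- Translations act continuously on `Lᵖ` for finite exponents; the action of `-h` is `f ↦ f(· -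
h)`. -/
theorem tendsto_eLpNorm_translate_sub {q : ℝ≥0∞} (h1 : 1 ≤ q) (hq : q ≠ ⊤) {f : E n → 𝕜}
    (hf : MemLp f q volume) :
    Tendsto (fun h : E n => eLpNorm (fun x => f (x - h) - f x) q volume) (𝓝 0) (𝓝 0) := by
  have : Fact (1 ≤ q) := ⟨h1⟩
  have : Fact (q ≠ ⊤) := ⟨hq⟩
  have hc : Continuous fun h : E n => DomAddAct.mk (-h) +ᵥ hf.toLp f := by
    have : Continuous fun h : E n => DomAddAct.mk (-h) :=
      DomAddAct.continuous_mk.comp continuous_neg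
    exact this.vadd continuous_const
  have h0 : DomAddAct.mk (-(0 : E n)) +ᵥ hf.toLp f = hf.toLp f := by
    rw [neg_zero, DomAddAct.mk_zero, zero_vadd]
  have ht := hc.tendsto 0
  rw [h0, tendsto_iff_edist_tendsto_0] at ht
  refine ht.congr fun h => ?_
  rw [DomAddAct.mk_vadd_toLp, Lp.edist_toLp_toLp]
  congr 1
  funext x
  simp [sub_eq_neg_add]

/-- Comparison of the `L¹` and `Lᵖ` norms for the measure `K dy`, whose total mass enters with
exponent `p (1 - 1/p) = p - 1`. -/
theorem enorm_integral_smul_rpow_le (hKm : Measurable K) (hK0 : ∀ y, 0 ≤ K y) {p : ℝ}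
    (hp : 1 ≤ p) {F : E n → 𝕜} (hF : AEStronglyMeasurable F volume) :
    ‖∫ y, K y • F y‖ₑ ^ p ≤ (∫⁻ y, ENNReal.ofReal (K y)) ^ (p - 1) *
      ∫⁻ y, ENNReal.ofReal (K y) * ‖F y‖ₑ ^ p := by
  have hp0 : 0 < p := by linarith
  have hk : Measurable fun y => ENNReal.ofReal (K y) := hKm.ennreal_ofReal
  set κ : Measure (E n) := volume.withDensity fun y => ENNReal.ofReal (K y) with hκ
  have hFκ : AEStronglyMeasurable F κ := hF.mono_ac (withDensity_absolutelyContinuous _ _)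
  have hJ := eLpNorm'_le_eLpNorm'_mul_rpow_measure_univ one_pos hp hFκ
  have hint : ∀ r : ℝ, 0 ≤ r → ∫⁻ y, ‖F y‖ₑ ^ r ∂κ =
      ∫⁻ y, ENNReal.ofReal (K y) * ‖F y‖ₑ ^ r := by
    intro r hr
    rw [hκ, lintegral_withDensity_eq_lintegral_mul₀ hk.aemeasurable (hF.enorm.pow_const r)]
    rfl
  have huniv : κ Set.univ = ∫⁻ y, ENNReal.ofReal (K y) := by
    rw [hκ, withDensity_apply _ MeasurableSet.univ, setLIntegral_univ]
  rw [eLpNorm'_eq_lintegral_enorm, eLpNorm'_eq_lintegral_enorm, hint 1 zero_le_one, hint p hp0.le,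
    huniv] at hJ
  simp only [ENNReal.rpow_one, div_one] at hJ
  have h1 : ‖∫ y, K y • F y‖ₑ ≤ ∫⁻ y, ENNReal.ofReal (K y) * ‖F y‖ₑ := by
    refine (enorm_integral_le_lintegral_enorm _).trans (lintegral_mono fun y => ?_)
    rw [enorm_smul, Real.enorm_of_nonneg (hK0 y)]
  calc ‖∫ y, K y • F y‖ₑ ^ p
      ≤ ((∫⁻ y, ENNReal.ofReal (K y) * ‖F y‖ₑ ^ p) ^ (1 / p) *
          (∫⁻ y, ENNReal.ofReal (K y)) ^ (1 - 1 / p)) ^ p :=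
        ENNReal.rpow_le_rpow (h1.trans hJ) hp0.le
    _ = _ := by
        rw [ENNReal.mul_rpow_of_nonneg _ _ hp0.le, ← ENNReal.rpow_mul, ← ENNReal.rpow_mul,
          one_div_mul_cancel hp0.ne', ENNReal.rpow_one, mul_comm, sub_mul, one_mul,
          one_div_mul_cancel hp0.ne']

theorem eLpNorm_ofReal_rpow {p : ℝ} (hp : 0 < p) {X : Type*} [MeasurableSpace X]
    {μ : Measure X} (f : X → 𝕜) :
    eLpNorm f (ENNReal.ofReal p) μ ^ p = ∫⁻ x, ‖f x‖ₑ ^ p ∂μ := by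
  rw [eLpNorm_eq_lintegral_rpow_enorm_toReal (by simpa using hp) ENNReal.ofReal_ne_top,
    ENNReal.toReal_ofReal hp.le, ← ENNReal.rpow_mul, one_div_mul_cancel hp.ne', ENNReal.rpow_one]

theorem stronglyMeasurable_translate_sub {g : E n → 𝕜} (hg : StronglyMeasurable g) (a : ℝ) :
    StronglyMeasurable fun q : E n × E n => g (q.1 - a • q.2) - g q.1 :=
  (hg.comp_measurable (g := fun q : E n × E n => q.1 - a • q.2) (by fun_prop)).sub
    (hg.comp_measurable measurable_fst)

theorem stronglyMeasurable_integral_smul_translate_sub (hKm : Measurable K) {g : E n → 𝕜}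
    (hg : StronglyMeasurable g) (a : ℝ) :
    StronglyMeasurable fun x : E n => ∫ y : E n, K y • (g (x - a • y) - g x) :=
  StronglyMeasurable.integral_prod_right' (ν := volume)
    (f := fun q : E n × E n => K q.2 • (g (q.1 - a • q.2) - g q.1))
    ((hKm.stronglyMeasurable.comp_measurable measurable_snd).smul
      (stronglyMeasurable_translate_sub hg a))

theorem eLpNorm_integral_smul_rpow_le (hKm : Measurable K) (hK0 : ∀ y, 0 ≤ K y) {p : ℝ}
    (hp : 1 ≤ p) {g : E n → 𝕜} (hg : StronglyMeasurable g) (a : ℝ) :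
    eLpNorm (fun x : E n => ∫ y : E n, K y • (g (x - a • y) - g x)) (ENNReal.ofReal p)
      volume ^ p ≤ (∫⁻ y, ENNReal.ofReal (K y)) ^ (p - 1) *
      ∫⁻ y : E n, ENNReal.ofReal (K y) *
        eLpNorm (fun x => g (x - a • y) - g x) (ENNReal.ofReal p) volume ^ p := by
  have hp0 : 0 < p := by linarith
  have hm : Measurable fun q : E n × E n =>
      ENNReal.ofReal (K q.2) * ‖g (q.1 - a • q.2) - g q.1‖ₑ ^ p :=
    (hKm.comp measurable_snd).ennreal_ofReal.mul
      ((stronglyMeasurable_translate_sub hg a).enorm.pow_const p)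
  have hm1 : ∀ x : E n, Measurable fun y : E n => g (x - a • y) - g x := fun x =>
    (stronglyMeasurable_translate_sub hg a).measurable.comp measurable_prodMk_left
  have hm2 : ∀ y : E n, Measurable fun x : E n => g (x - a • y) - g x := fun y =>
    (stronglyMeasurable_translate_sub hg a).measurable.comp measurable_prodMk_right
  rw [eLpNorm_ofReal_rpow hp0]
  calc ∫⁻ x : E n, ‖∫ y : E n, K y • (g (x - a • y) - g x)‖ₑ ^ p
      ≤ ∫⁻ x : E n, (∫⁻ y, ENNReal.ofReal (K y)) ^ (p - 1) *
          ∫⁻ y : E n, ENNReal.ofReal (K y) * ‖g (x - a • y) - g x‖ₑ ^ p :=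
        lintegral_mono fun x => enorm_integral_smul_rpow_le hKm hK0 hp
          (hm1 x).aestronglyMeasurable
    _ = (∫⁻ y, ENNReal.ofReal (K y)) ^ (p - 1) *
          ∫⁻ x : E n, ∫⁻ y : E n, ENNReal.ofReal (K y) * ‖g (x - a • y) - g x‖ₑ ^ p :=
        lintegral_const_mul _ hm.lintegral_prod_right'
    _ = _ := by
        rw [lintegral_lintegral_swap hm.aemeasurable]
        congr 1
        refine lintegral_congr fun y => ?_
        rw [lintegral_const_mul _ ((hm2 y).enorm.pow_const p), eLpNorm_ofReal_rpow hp0]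

theorem eLpNorm_translate_sub_le {q : ℝ≥0∞} (h1 : 1 ≤ q) {g : E n → 𝕜}
    (hg : AEStronglyMeasurable g volume) (h : E n) :
    eLpNorm (fun x => g (x - h) - g x) q volume ≤ 2 * eLpNorm g q volume := by
  have hmp : MeasurePreserving (fun x : E n => x - h) volume volume :=
    measurePreserving_sub_right volume h
  have h2 := eLpNorm_sub_le (hg.comp_measurePreserving hmp) hg h1
  have h3 := eLpNorm_comp_measurePreserving (p := q) hg hmp
  rw [h3, ← two_mul] at h2
  exact h2

/-- The `p`-th power of the norm is at most a constant times the `K`-average of the `Lᵖ` moduli of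
continuity at `a y`. These tend to zero for each `y` and are at most `2 ‖g‖_p`, so dominated
convergence applies. -/
theorem memLp_and_tendsto_of_stronglyMeasurable (hK : Integrable K) (hKm : Measurable K)
    (hK0 : ∀ y, 0 ≤ K y) {p : ℝ} (hp : 1 ≤ p) {g : E n → 𝕜} (hg : StronglyMeasurable g)
    (hgp : MemLp g (ENNReal.ofReal p) volume) :
    (∀ a : ℝ, MemLp (fun x : E n => ∫ y : E n, K y • (g (x - a • y) - g x)) (ENNReal.ofReal p)
      volume) ∧
    Tendsto (fun a : ℝ => eLpNorm (fun x : E n => ∫ y : E n, K y • (g (x - a • y) - g x))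
      (ENNReal.ofReal p) volume) (𝓝[>] 0) (𝓝 0) := by
  have hp0 : 0 < p := by linarith
  have h1 : 1 ≤ ENNReal.ofReal p := by simpa using hp
  set Λ := ∫⁻ y, ENNReal.ofReal (K y)
  have hΛ : Λ ≠ ⊤ := by
    have := hK.2
    rw [hasFiniteIntegral_iff_ofReal (ae_of_all _ hK0)] at this
    exact this.ne
  have hΛp : Λ ^ (p - 1) ≠ ⊤ := ENNReal.rpow_ne_top_of_nonneg (by linarith) hΛ
  have hB : (2 * eLpNorm g (ENNReal.ofReal p) volume) ^ p ≠ ⊤ :=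
    ENNReal.rpow_ne_top_of_nonneg hp0.le (ENNReal.mul_ne_top (by simp) hgp.2.ne)
  have hdom : ∀ (a : ℝ) (y : E n), ENNReal.ofReal (K y) *
      eLpNorm (fun x => g (x - a • y) - g x) (ENNReal.ofReal p) volume ^ p ≤
      ENNReal.ofReal (K y) * (2 * eLpNorm g (ENNReal.ofReal p) volume) ^ p := by
    intro a y
    gcongr
    exact eLpNorm_translate_sub_le h1 hg.aestronglyMeasurable _
  have hfin : ∫⁻ y, ENNReal.ofReal (K y) * (2 * eLpNorm g (ENNReal.ofReal p) volume) ^ p ≠ ⊤ := by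
    rw [lintegral_mul_const _ hKm.ennreal_ofReal]
    exact ENNReal.mul_ne_top hΛ hB
  have hle := eLpNorm_integral_smul_rpow_le hKm hK0 hp hg
  constructor
  · intro a
    refine ⟨(stronglyMeasurable_integral_smul_translate_sub hKm hg a).aestronglyMeasurable, ?_⟩
    rw [← ENNReal.rpow_lt_top_iff_of_pos hp0]
    refine (hle a).trans_lt (ENNReal.mul_lt_top hΛp.lt_top ?_)
    exact (lintegral_mono (hdom a)).trans_lt hfin.lt_top
  · have hlim : Tendsto (fun a : ℝ => ∫⁻ y : E n, ENNReal.ofReal (K y) *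
        eLpNorm (fun x => g (x - a • y) - g x) (ENNReal.ofReal p) volume ^ p)
        (𝓝[>] 0) (𝓝 (∫⁻ _ : E n, 0)) := by
      refine tendsto_lintegral_filter_of_dominated_convergence _ (Eventually.of_forall fun a => ?_)
        (Eventually.of_forall fun a => ae_of_all _ (hdom a)) hfin (ae_of_all _ fun y => ?_)
      · simp_rw [eLpNorm_ofReal_rpow hp0]
        refine hKm.ennreal_ofReal.mul ?_
        exact Measurable.lintegral_prod_left' (μ := volume)
          (f := fun q : E n × E n => ‖g (q.1 - a • q.2) - g q.1‖ₑ ^ p)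
          ((stronglyMeasurable_translate_sub hg a).enorm.pow_const p)
      · have ht : Tendsto (fun a : ℝ => a • y) (𝓝[>] 0) (𝓝 0) := by
          have : Tendsto (fun a : ℝ => a • y) (𝓝 0) (𝓝 ((0 : ℝ) • y)) :=
            (continuous_id.smul continuous_const).tendsto 0
          rw [zero_smul] at this
          exact this.mono_left nhdsWithin_le_nhds
        have h2 := (tendsto_eLpNorm_translate_sub h1 ENNReal.ofReal_ne_top hgp).comp ht
        have h3 := h2.ennrpow_const p
        rw [ENNReal.zero_rpow_of_pos hp0] at h3
        have h4 := ENNReal.Tendsto.const_mul (a := ENNReal.ofReal (K y)) h3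
          (Or.inr ENNReal.ofReal_ne_top)
        rw [mul_zero] at h4
        exact h4
    rw [lintegral_zero] at hlim
    have h5 := ENNReal.Tendsto.const_mul (a := Λ ^ (p - 1)) hlim (Or.inr hΛp)
    rw [mul_zero] at h5
    have h6 := tendsto_of_tendsto_of_tendsto_of_le_of_le tendsto_const_nhds h5
      (fun _ => zero_le) hle
    have h7 := h6.ennrpow_const (1 / p)
    rw [ENNReal.zero_rpow_of_pos (by positivity)] at h7
    refine h7.congr fun a => ?_
    rw [← ENNReal.rpow_mul, mul_one_div_cancel hp0.ne', ENNReal.rpow_one]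

/-- Dilations of an integrable kernel form an approximate identity in `Lᵖ`. -/
theorem memLp_and_tendsto_eLpNorm_integral_smul (hK : Integrable K) (hKm : Measurable K)
    (hK0 : ∀ y, 0 ≤ K y) {p : ℝ} (hp : 1 ≤ p) {f : E n → 𝕜}
    (hf : MemLp f (ENNReal.ofReal p) volume)
    (hi : ∀ a : ℝ, 0 < a → ∀ x : E n, Integrable fun y : E n => K y • f (x - a • y)) :
    (∀ a : ℝ, 0 < a →
      MemLp (fun x : E n => ∫ y : E n, K y • f (x - a • y)) (ENNReal.ofReal p) volume) ∧
    Tendsto (fun a : ℝ => eLpNorm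
      (fun x : E n => (∫ y : E n, K y • f (x - a • y)) - (∫ y, K y) • f x)
      (ENNReal.ofReal p) volume) (𝓝[>] 0) (𝓝 0) := by
  obtain ⟨g, hg, hfg⟩ := hf.1
  have hgp : MemLp g (ENNReal.ofReal p) volume := (memLp_congr_ae hfg).1 hf
  obtain ⟨h1, h2⟩ := memLp_and_tendsto_of_stronglyMeasurable hK hKm hK0 hp hg hgp
  have heq : ∀ a : ℝ, 0 < a →
      (fun x : E n => (∫ y : E n, K y • f (x - a • y)) - (∫ y, K y) • f x) =ᵐ[volume]
      fun x : E n => ∫ y : E n, K y • (g (x - a • y) - g x) := by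
    intro a ha
    filter_upwards [hfg] with x hx
    rw [integral_smul_sub_integral_smul hK (hi a ha x)]
    refine integral_congr_ae ?_
    filter_upwards [(quasiMeasurePreserving_sub_smul ha.ne' x).ae hfg] with y hy
    rw [hy, hx]
  constructor
  · intro a ha
    have h3 := ((memLp_congr_ae (heq a ha)).2 (h1 a)).add (hf.const_smul (∫ y, K y))
    refine (memLp_congr_ae (ae_of_all _ fun x => ?_)).1 h3
    simp
  · refine h2.congr' ?_
    filter_upwards [self_mem_nhdsWithin] with a ha
    exact (eLpNorm_congr_ae (heq a ha)).symm

end MeanConvergence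

/-! ### Approximate identities: almost everywhere convergence -/

section PointwiseConvergence

variable {𝕜 : Type*} [RCLike 𝕜] {n : ℕ} {K : E n → ℝ}

/-- The mean oscillation of `f` about `f x` on the ball of radius `r` centred at `x`. -/
noncomputable def meanOsc (f : E n → 𝕜) (x : E n) (r : ℝ) : ℝ≥0∞ :=
  (∫⁻ y in Metric.closedBall x r, ‖f y - f x‖ₑ) / volume (Metric.closedBall x r)

theorem ae_tendsto_meanOsc {f : E n → 𝕜} (hf : LocallyIntegrable f volume) :
    ∀ᵐ x : E n, Tendsto (meanOsc f x) (𝓝[>] 0) (𝓝 0) := by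
  filter_upwards [(IsUnifLocDoublingMeasure.vitaliFamily (volume : Measure (E n))
    1).ae_tendsto_lintegral_enorm_sub_div hf] with x hx
  refine hx.comp (IsUnifLocDoublingMeasure.tendsto_closedBall_filterAt (μ := volume) (K := 1)
    (fun _ : ℝ => x) (fun r : ℝ => r) tendsto_id ?_)
  filter_upwards [self_mem_nhdsWithin] with r hr
  exact Metric.mem_closedBall_self (by simpa using (le_of_lt hr))

theorem enorm_le_one_add_rpow {p : ℝ} (hp : 1 ≤ p) (t : ℝ≥0∞) : t ≤ 1 + t ^ p := by
  rcases le_total t 1 with h | h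
  · exact h.trans le_self_add
  · calc t = t ^ (1 : ℝ) := (ENNReal.rpow_one t).symm
      _ ≤ t ^ p := ENNReal.rpow_le_rpow_of_exponent_le h hp
      _ ≤ _ := le_add_self

/-- Small radii are controlled by the limit at `x`. For radii at least `δ`, the inequality `t ≤ 1 +
t^p` and the `Lᵖ` norm bound the mean, the volume of the ball being at least that of the ball of
radius `δ`. -/
theorem exists_meanOsc_le {p : ℝ} (hp : 1 ≤ p) {f : E n → 𝕜} (hfm : StronglyMeasurable f)
    (hf : MemLp f (ENNReal.ofReal p) volume) {x : E n}
    (hx : Tendsto (meanOsc f x) (𝓝[>] 0) (𝓝 0)) :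
    ∃ B : ℝ≥0∞, B ≠ ⊤ ∧ ∀ r, 0 < r → meanOsc f x r ≤ B := by
  have hp0 : 0 < p := by linarith
  obtain ⟨δ, hδ, hδ1⟩ : ∃ δ > 0, ∀ r, 0 < r → r < δ → meanOsc f x r ≤ 1 := by
    have h := hx.eventually (eventually_le_nhds (zero_lt_one (α := ℝ≥0∞)))
    obtain ⟨δ, hδ, h⟩ := mem_nhdsGT_iff_exists_Ioo_subset.1 h
    exact ⟨δ, hδ, fun r h0 h1 => h ⟨h0, h1⟩⟩
  set N := ∫⁻ y, ‖f y‖ₑ ^ p with hN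
  have hNf : N ≠ ⊤ := by
    rw [hN, ← eLpNorm_ofReal_rpow hp0]
    exact ENNReal.rpow_ne_top_of_nonneg hp0.le hf.2.ne
  have hv : ∀ r, 0 < r → volume (Metric.closedBall x r) ≠ 0 := fun r hr =>
    (Metric.measure_closedBall_pos volume x hr).ne'
  have hvf : ∀ r, volume (Metric.closedBall x r) ≠ ⊤ := fun r =>
    measure_closedBall_lt_top.ne
  refine ⟨1 + (N / volume (Metric.closedBall x δ) + (1 + ‖f x‖ₑ)), ?_, fun r hr => ?_⟩
  · have := ENNReal.div_ne_top hNf (hv δ hδ)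
    simp [this]
  rcases lt_or_ge r δ with h | h
  · exact (hδ1 r hr h).trans le_self_add
  refine le_add_left ?_
  have hm : Measurable fun y => ‖f y‖ₑ ^ p := hfm.enorm.pow_const p
  have h1 : ∫⁻ y in Metric.closedBall x r, ‖f y - f x‖ₑ ≤
      N + (1 + ‖f x‖ₑ) * volume (Metric.closedBall x r) := by
    calc ∫⁻ y in Metric.closedBall x r, ‖f y - f x‖ₑ
        ≤ ∫⁻ y in Metric.closedBall x r, (‖f y‖ₑ ^ p + (1 + ‖f x‖ₑ)) := by
          refine lintegral_mono fun y => ?_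
          calc ‖f y - f x‖ₑ ≤ ‖f y‖ₑ + ‖f x‖ₑ := enorm_sub_le
            _ ≤ 1 + ‖f y‖ₑ ^ p + ‖f x‖ₑ := by
                gcongr
                exact enorm_le_one_add_rpow hp _
            _ = _ := by ring
      _ = (∫⁻ y in Metric.closedBall x r, ‖f y‖ₑ ^ p) +
            (1 + ‖f x‖ₑ) * volume (Metric.closedBall x r) := by
          rw [lintegral_add_left hm, setLIntegral_const]
      _ ≤ _ := by
          gcongr
          exact setLIntegral_le_lintegral _ _
  calc meanOsc f x r
      ≤ (N + (1 + ‖f x‖ₑ) * volume (Metric.closedBall x r)) /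
          volume (Metric.closedBall x r) := ENNReal.div_le_div_right h1 _
    _ = N / volume (Metric.closedBall x r) + (1 + ‖f x‖ₑ) := by
        rw [ENNReal.add_div, ENNReal.mul_div_cancel_right (hv r hr) (hvf r)]
    _ ≤ _ := by gcongr

theorem lintegral_closedBall_sub_smul {f : E n → 𝕜} (hf : StronglyMeasurable f) (x : E n)
    {a R : ℝ} (ha : 0 < a) (hR : 0 < R) :
    ∫⁻ y in Metric.closedBall (0 : E n) R, ‖f (x - a • y) - f x‖ₑ =
      ENNReal.ofReal (R ^ n) * volume (Metric.closedBall (0 : E n) 1) *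
        meanOsc f x (a * R) := by
  have haR : 0 < a * R := mul_pos ha hR
  have hT : Measurable fun y : E n => x - a • y := by fun_prop
  have hmap : (volume : Measure (E n)).map (fun y : E n => x - a • y) =
      ENNReal.ofReal ((a ^ n)⁻¹) • volume := by
    have h1 := (Measure.measurePreserving_sub_left (volume : Measure (E n)) x).measurable
    have h2 := (Measure.measurePreserving_sub_left (volume : Measure (E n)) x).map_eq
    have h3 : (fun y : E n => x - a • y) = (fun y => x - y) ∘ fun y => a • y := rfl
    rw [h3, ← Measure.map_map h1 (by fun_prop), Measure.map_addHaar_smul _ ha.ne',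
      Measure.map_smul, h2, finrank_euclideanSpace_fin, abs_of_nonneg (by positivity)]
  have hpre : (fun y : E n => x - a • y) ⁻¹' Metric.closedBall x (a * R) =
      Metric.closedBall (0 : E n) R := by
    ext y
    simp [norm_smul, abs_of_pos ha, dist_eq_norm, mul_le_mul_iff_right₀ ha]
  have hG : Measurable fun y => ‖f y - f x‖ₑ := (hf.sub stronglyMeasurable_const).enorm
  have hvol : volume (Metric.closedBall x (a * R)) =
      ENNReal.ofReal ((a * R) ^ n) * volume (Metric.closedBall (0 : E n) 1) := by
    rw [Measure.addHaar_closedBall' volume x haR.le, finrank_euclideanSpace_fin]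
  have hv1 : volume (Metric.closedBall (0 : E n) 1) ≠ 0 :=
    (Metric.measure_closedBall_pos volume _ one_pos).ne'
  have hv1' : volume (Metric.closedBall (0 : E n) 1) ≠ ⊤ := measure_closedBall_lt_top.ne
  have h0 := setLIntegral_map (μ := volume) Metric.isClosed_closedBall.measurableSet hG hT
    (s := Metric.closedBall x (a * R))
  rw [hpre, hmap, Measure.restrict_smul, lintegral_smul_measure] at h0
  rw [← h0, meanOsc, hvol, smul_eq_mul]
  have hpos : (0 : ℝ) < (a * R) ^ n := by positivity
  have h4 : ENNReal.ofReal (R ^ n) =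
      ENNReal.ofReal ((a ^ n)⁻¹) * ENNReal.ofReal ((a * R) ^ n) := by
    rw [← ENNReal.ofReal_mul (by positivity), mul_pow, inv_mul_cancel_left₀ (by positivity)]
  rw [h4, mul_assoc (ENNReal.ofReal ((a ^ n)⁻¹)), mul_assoc (ENNReal.ofReal ((a ^ n)⁻¹)),
    ENNReal.mul_div_cancel (mul_ne_zero (by simpa using hpos) hv1)
      (ENNReal.mul_ne_top ENNReal.ofReal_ne_top hv1')]

theorem one_add_rpow_le_tsum_indicator (y : E n) :
    ENNReal.ofReal ((1 + ‖y‖) ^ (-((n : ℝ) + 1))) ≤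
      ∑' j : ℕ, (Metric.closedBall (0 : E n) (2 ^ j)).indicator
        (fun _ => ENNReal.ofReal (2 ^ (n + 1) * ((2 ^ j) ^ (n + 1))⁻¹)) y := by
  have h1 : (1 : ℝ) ≤ 1 + ‖y‖ := by linarith [norm_nonneg y]
  obtain ⟨m, hm1, hm2⟩ := exists_nat_pow_near h1 (one_lt_two)
  -- One term is enough: if `2^m ≤ 1 + ‖y‖ < 2^(m+1)`, then `y` lies in the ball of index `m + 1`,
  -- whose coefficient is `2^(-m(n+1))`.
  refine le_trans ?_ (ENNReal.le_tsum (m + 1))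
  have hy : y ∈ Metric.closedBall (0 : E n) (2 ^ (m + 1)) := by
    rw [mem_closedBall_zero_iff]
    linarith
  rw [Set.indicator_of_mem hy]
  refine ENNReal.ofReal_le_ofReal ?_
  have h2 : (-((n : ℝ) + 1)) = -((n + 1 : ℕ) : ℝ) := by push_cast; ring
  rw [h2, Real.rpow_neg (by linarith), Real.rpow_natCast, pow_succ 2 m, mul_pow, mul_inv,
    mul_comm (((2 : ℝ) ^ m) ^ (n + 1))⁻¹, mul_inv_cancel_left₀ (by positivity)]
  gcongr

/-- The kernel is majorized by multiples of indicators of dyadic balls. The coefficient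
`2^(-j(n+1))` times the volume factor `2^(jn)` leaves the summable weight `2^(-j)`. -/
theorem enorm_integral_smul_le_tsum_meanOsc {M : ℝ} (hM : 0 ≤ M) (hK0 : ∀ y, 0 ≤ K y)
    (hKM : ∀ y, K y ≤ M * (1 + ‖y‖) ^ (-((n : ℝ) + 1))) {f : E n → 𝕜}
    (hf : StronglyMeasurable f) (x : E n) {a : ℝ} (ha : 0 < a) :
    ‖∫ y : E n, K y • (f (x - a • y) - f x)‖ₑ ≤
      ∑' j : ℕ, ENNReal.ofReal (M * 2 ^ (n + 1)) * volume (Metric.closedBall (0 : E n) 1) *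
        2⁻¹ ^ j * meanOsc f x (a * 2 ^ j) := by
  have hG : Measurable fun y : E n => ‖f (x - a • y) - f x‖ₑ :=
    ((hf.comp_measurable (g := fun y : E n => x - a • y) (by fun_prop)).sub
      stronglyMeasurable_const).enorm
  have hind : ∀ j : ℕ, Measurable fun y : E n => (Metric.closedBall (0 : E n) (2 ^ j)).indicator
        (fun _ => ENNReal.ofReal (2 ^ (n + 1) * ((2 ^ j) ^ (n + 1))⁻¹)) y := fun j =>
    measurable_const.indicator Metric.isClosed_closedBall.measurableSet
  have hindG : ∀ j : ℕ, Measurable fun y : E n =>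
      (Metric.closedBall (0 : E n) (2 ^ j)).indicator
        (fun _ => ENNReal.ofReal (2 ^ (n + 1) * ((2 ^ j) ^ (n + 1))⁻¹)) y *
        ‖f (x - a • y) - f x‖ₑ := fun j => (hind j).mul hG
  calc ‖∫ y : E n, K y • (f (x - a • y) - f x)‖ₑ
      ≤ ∫⁻ y : E n, ENNReal.ofReal (K y) * ‖f (x - a • y) - f x‖ₑ := by
        refine (enorm_integral_le_lintegral_enorm _).trans (lintegral_mono fun y => ?_)
        rw [enorm_smul, Real.enorm_of_nonneg (hK0 y)]
    _ ≤ ∫⁻ y : E n, ∑' j : ℕ, ENNReal.ofReal M *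
          ((Metric.closedBall (0 : E n) (2 ^ j)).indicator
            (fun _ => ENNReal.ofReal (2 ^ (n + 1) * ((2 ^ j) ^ (n + 1))⁻¹)) y *
            ‖f (x - a • y) - f x‖ₑ) := by
        refine lintegral_mono fun y => ?_
        rw [ENNReal.tsum_mul_left, ENNReal.tsum_mul_right, ← mul_assoc]
        gcongr
        refine (ENNReal.ofReal_le_ofReal (hKM y)).trans ?_
        rw [ENNReal.ofReal_mul hM]
        gcongr
        exact one_add_rpow_le_tsum_indicator y
    _ = ∑' j : ℕ, ENNReal.ofReal M * (ENNReal.ofReal (2 ^ (n + 1) * ((2 ^ j) ^ (n + 1))⁻¹) *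
          ∫⁻ y in Metric.closedBall (0 : E n) (2 ^ j), ‖f (x - a • y) - f x‖ₑ) := by
        rw [lintegral_tsum fun j => ((hindG j).const_mul _).aemeasurable]
        congr 1
        funext j
        rw [lintegral_const_mul _ (hindG j), ← lintegral_const_mul _ hG,
          ← lintegral_indicator Metric.isClosed_closedBall.measurableSet]
        congr 1
        refine lintegral_congr fun y => ?_
        by_cases hy : y ∈ Metric.closedBall (0 : E n) (2 ^ j)
        · simp only [Set.indicator_of_mem hy]
        · simp only [Set.indicator_of_notMem hy, zero_mul]
    _ = _ := by
        congr 1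
        funext j
        rw [lintegral_closedBall_sub_smul hf x ha (by positivity)]
        have h1 : ENNReal.ofReal (2 ^ (n + 1) * ((2 ^ j) ^ (n + 1))⁻¹) *
            ENNReal.ofReal ((2 ^ j) ^ n) = ENNReal.ofReal (2 ^ (n + 1)) * 2⁻¹ ^ j := by
          have h2 : (2⁻¹ : ℝ≥0∞) ^ j = ENNReal.ofReal ((2 ^ j)⁻¹) := by
            rw [ENNReal.ofReal_inv_of_pos (by positivity), ENNReal.ofReal_pow zero_le_two,
              ENNReal.ofReal_ofNat, ENNReal.inv_pow]
          rw [h2, ← ENNReal.ofReal_mul (by positivity), ← ENNReal.ofReal_mul (by positivity)]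
          congr 1
          rw [pow_succ ((2 : ℝ) ^ j) n]
          field_simp
        rw [ENNReal.ofReal_mul hM]
        calc _ = ENNReal.ofReal M * (ENNReal.ofReal (2 ^ (n + 1) * ((2 ^ j) ^ (n + 1))⁻¹) *
              ENNReal.ofReal ((2 ^ j) ^ n)) * volume (Metric.closedBall (0 : E n) 1) *
              meanOsc f x (a * 2 ^ j) := by ring
          _ = _ := by
            rw [h1]
            ring

/-- Dominated convergence for the dyadic series: each mean oscillation tends to zero at a Lebesgue
point, and all are bounded by one constant `B`. -/
theorem tendsto_integral_smul_translate_sub {M : ℝ} (hM : 0 ≤ M) (hK0 : ∀ y, 0 ≤ K y)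
    (hKM : ∀ y, K y ≤ M * (1 + ‖y‖) ^ (-((n : ℝ) + 1))) {p : ℝ} (hp : 1 ≤ p) {f : E n → 𝕜}
    (hfm : StronglyMeasurable f) (hf : MemLp f (ENNReal.ofReal p) volume) {x : E n}
    (hx : Tendsto (meanOsc f x) (𝓝[>] 0) (𝓝 0)) :
    Tendsto (fun a : ℝ => ∫ y : E n, K y • (f (x - a • y) - f x)) (𝓝[>] 0) (𝓝 0) := by
  obtain ⟨B, hB, hle⟩ := exists_meanOsc_le hp hfm hf hx
  set c := ENNReal.ofReal (M * 2 ^ (n + 1)) * volume (Metric.closedBall (0 : E n) 1) with hc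
  have hcf : c ≠ ⊤ := ENNReal.mul_ne_top ENNReal.ofReal_ne_top measure_closedBall_lt_top.ne
  have hlim : Tendsto (fun a : ℝ => ∫⁻ j : ℕ, c * 2⁻¹ ^ j * meanOsc f x (a * 2 ^ j)
      ∂Measure.count) (𝓝[>] 0) (𝓝 (∫⁻ _ : ℕ, 0 ∂Measure.count)) := by
    refine tendsto_lintegral_filter_of_dominated_convergence (fun j => c * 2⁻¹ ^ j * B)
      (Eventually.of_forall fun a => measurable_from_nat) ?_ ?_ (ae_of_all _ fun j => ?_)
    · filter_upwards [self_mem_nhdsWithin] with a ha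
      refine ae_of_all _ fun j => ?_
      have ha : 0 < a := ha
      gcongr
      exact hle _ (by positivity)
    · rw [lintegral_count, ENNReal.tsum_mul_right, ENNReal.tsum_mul_left, ENNReal.tsum_geometric]
      refine ENNReal.mul_ne_top (ENNReal.mul_ne_top hcf ?_) hB
      simp
    · have h1 : Tendsto (fun a : ℝ => a * 2 ^ j) (𝓝[>] 0) (𝓝[>] 0) := by
        refine tendsto_nhdsWithin_iff.2 ⟨?_, ?_⟩
        · have : Tendsto (fun a : ℝ => a * 2 ^ j) (𝓝 0) (𝓝 (0 * 2 ^ j)) :=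
            tendsto_id.mul_const _
          rw [zero_mul] at this
          exact this.mono_left nhdsWithin_le_nhds
        · filter_upwards [self_mem_nhdsWithin] with a ha
          have ha : 0 < a := ha
          exact Set.mem_Ioi.2 (by positivity)
      have h2 := ENNReal.Tendsto.const_mul (a := c * 2⁻¹ ^ j) (hx.comp h1)
        (Or.inr (ENNReal.mul_ne_top hcf (ENNReal.pow_ne_top (by simp))))
      rw [mul_zero] at h2
      exact h2
  rw [lintegral_zero] at hlim
  simp_rw [lintegral_count] at hlim
  rw [tendsto_zero_iff_enorm_tendsto_zero]
  refine tendsto_of_tendsto_of_tendsto_of_le_of_le' tendsto_const_nhds hlim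
    (Eventually.of_forall fun _ => zero_le) ?_
  filter_upwards [self_mem_nhdsWithin] with a ha
  exact enorm_integral_smul_le_tsum_meanOsc hM hK0 hKM hfm x ha

/-- Dilations of a kernel with an integrable decreasing majorant form an approximate identity in
the sense of almost everywhere convergence. -/
theorem ae_tendsto_integral_smul (hK : Integrable K) {M : ℝ} (hM : 0 ≤ M) (hK0 : ∀ y, 0 ≤ K y)
    (hKM : ∀ y, K y ≤ M * (1 + ‖y‖) ^ (-((n : ℝ) + 1))) {p : ℝ} (hp : 1 ≤ p) {f : E n → 𝕜}
    (hf : MemLp f (ENNReal.ofReal p) volume)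
    (hi : ∀ a : ℝ, 0 < a → ∀ x : E n, Integrable fun y : E n => K y • f (x - a • y)) :
    ∀ᵐ x : E n, Tendsto (fun a : ℝ => ∫ y : E n, K y • f (x - a • y)) (𝓝[>] 0)
      (𝓝 ((∫ y, K y) • f x)) := by
  obtain ⟨g, hg, hfg⟩ := hf.1
  have hgp : MemLp g (ENNReal.ofReal p) volume := (memLp_congr_ae hfg).1 hf
  filter_upwards [hfg, ae_tendsto_meanOsc (hgp.locallyIntegrable (by simpa using hp))]
    with x hx hosc
  have h := (tendsto_integral_smul_translate_sub hM hK0 hKM hp hg hgp hosc).add_const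
    ((∫ y, K y) • f x)
  rw [zero_add] at h
  refine h.congr' ?_
  filter_upwards [self_mem_nhdsWithin] with a ha
  rw [sub_eq_iff_eq_add.1 (integral_smul_sub_integral_smul hK (hi a ha x))]
  congr 1
  refine integral_congr_ae ?_
  filter_upwards [(quasiMeasurePreserving_sub_smul ha.ne' x).ae hfg] with y hy
  rw [hy, hx]

end PointwiseConvergence

/-! ### Inversion of the `k`-plane transform -/

/-- Both parities are treated at once: only the support of `w`, its domination by the weight and the
Abel equation enter. -/
theorem inversionHolds_psi (𝕜 : Type*) [RCLike 𝕜] {n k ℓ : ℕ} (h1 : 1 ≤ k) (hk : k < n)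
    {w : ℝ → ℝ} (hw : Measurable w) (hw0 : ∀ s ≤ 1, w s = 0) {C : ℝ}
    (hC : ∀ s, 1 < s → |s ^ (n - k - 1) * w s| ≤ C * (s⁻¹ * (s ^ 2 - 1) ^ (-(1 / 2) : ℝ)))
    (hsol : SolvesAbel n k w (psi n ℓ)) : InversionHolds 𝕜 hk.le w (psi n ℓ) := by
  refine ⟨totalMass_psi_pos (by omega) ℓ, fun p hp hpn f hf => ?_⟩
  have ht : ∀ a : ℝ, 0 < a → ∀ x : E n,
      Integrable fun z : E n => tailKernel n k ‖z‖ * ‖f (x - a • z)‖ := fun a ha x =>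
    integrable_tailKernel_mul hk h1 hp hpn hf ha.ne' x
  have hi : ∀ a : ℝ, 0 < a → ∀ x : E n,
      Integrable fun y : E n => psi n ℓ ‖y‖ • f (x - a • y) := fun a ha x =>
    integrable_psi_smul ℓ hf.1 ha.ne' (ht a ha x)
  obtain ⟨hrad, hwav⟩ := wavelet_radon h1 hk hw (abs_le_abelWeight hk hw0 hC) hsol hf.1 ht
  have hK := integrable_psi n ℓ
  have hK0 : ∀ y : E n, 0 ≤ psi n ℓ ‖y‖ := fun y => psi_nonneg n ℓ _
  have heq : ∀ a : ℝ, 0 < a → wavelet hk.le w (radon f) a =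
      fun x : E n => ∫ y : E n, psi n ℓ ‖y‖ • f (x - a • y) := fun a ha =>
    funext fun x => (hwav a ha x).2
  obtain ⟨hmem, hlim⟩ := memLp_and_tendsto_eLpNorm_integral_smul hK
    ((measurable_psi n ℓ).comp measurable_norm) hK0 hp hf hi
  refine ⟨hrad, fun a ha x => ⟨(hwav a ha x).1, hi a ha x, (hwav a ha x).2⟩, fun a ha => ?_,
    hlim.congr' ?_, ?_, fun hfc hf0 => ?_⟩
  · rw [heq a ha]
    exact hmem a ha
  · filter_upwards [self_mem_nhdsWithin] with a ha
    rw [heq a ha]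
    rfl
  · filter_upwards [ae_tendsto_integral_smul hK (by positivity) hK0
      (fun y => psi_le_one_add_rpow n ℓ (norm_nonneg y)) hp hf hi] with x hx
    refine hx.congr' ?_
    filter_upwards [self_mem_nhdsWithin] with a ha
    rw [heq a ha]
  · intro u hu
    filter_upwards [tendstoUniformly_integral_smul hK hfc hf0 u hu, self_mem_nhdsWithin]
      with a hau ha x
    rw [heq a ha]
    exact hau x

end KPlane

theorem theoremB (𝕜 : Type*) [RCLike 𝕜] (n : ℕ) (hn : 2 ≤ n) (ℓ : ℕ) :
    KPlane.HasDecreasingMajorant n (KPlane.psi n ℓ) ∧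
    (1 ≤ ℓ → ∀ hk : 2 * ℓ < n,
      KPlane.SolvesAbel n (2 * ℓ) (KPlane.wEven n ℓ) (KPlane.psi n ℓ) ∧
      KPlane.InversionHolds 𝕜 hk.le (KPlane.wEven n ℓ) (KPlane.psi n ℓ)) ∧
    (∀ hk : 2 * ℓ + 1 < n,
      KPlane.SolvesAbel n (2 * ℓ + 1) (KPlane.wOdd n ℓ) (KPlane.psi n ℓ) ∧
      KPlane.InversionHolds 𝕜 hk.le (KPlane.wOdd n ℓ) (KPlane.psi n ℓ)) := by
  refine ⟨KPlane.hasDecreasingMajorant_psi n ℓ, fun hℓ hk => ?_, fun hk => ?_⟩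
  · have hsol := KPlane.solvesAbel_wEven hℓ hk
    obtain ⟨C, -, hC⟩ := KPlane.wEven_bound hk
    exact ⟨hsol, KPlane.inversionHolds_psi 𝕜 (by omega) hk (KPlane.measurable_wEven n ℓ)
      (fun s hs => by simp [KPlane.wEven, hs]) hC hsol⟩
  · have hsol := KPlane.solvesAbel_wOdd hk
    obtain ⟨C, -, hC⟩ := KPlane.wOdd_bound hk
    exact ⟨hsol, KPlane.inversionHolds_psi 𝕜 (by omega) hk (KPlane.measurable_wOdd n ℓ)
      (fun s hs => by simp [KPlane.wOdd, hs]) hC hsol⟩
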